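/- **Model.** Fix a known dispersion. Let $\{f(\cdot\mid\gamma):\gamma\in\Gamma\}$, $\Gamma\subseteq\mathbb R$ an open interval, be an exponential family of probability densities $f(y\mid\gamma)=\exp\{(y\gamma-b(\gamma))/a+c(y)\}$, $a>0$, with respect to a $\sigma$-finite measure on $\mathbb R$. Let $g$ be a link function that is $C^2$ with non-vanishing derivative on the set of means of the family. For $\eta$ in $J=\{g(\mu):\mu\text{ a mean of the family}\}$ let $\mu(\eta)=g^{-1}(\eta)$ be the mean and $\sigma^2(\eta)$ the variance (that is, $a$ times the variance function) of the member of the family with mean $g^{-1}(\eta)$. A response $Y$ with covariates $X\in\mathbb R^{p+1}$ and group indicator $A\in\{0,1\}$ has, given $(A,X)$, the density of this family with linear predictor $\eta=\theta^TX+(\beta^TX)A$. Put $\mu^{(0)}(\theta;x)=\mu(\theta^Tx)$, $\mu^{(1)}(\beta,\theta;x)=\mu(\theta^Tx+\beta^Tx)$. **Data.** For each $n$ there are $2n$ independent observations: $n$ i.i.d. pairs $(X^{(0)}_i,Y^{(0)}_i)$ from the control group ($A=0$) and $n$ i.i.d. pairs $(X^{(1)}_i,Y^{(1)}_i)$ from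 the treatment group ($A=1$), with covariate laws $P_0$ and $P_1$ (which may coincide) not depending on the parameters. The true value of $\theta$ is $\theta_0$. Let $\hat\theta_n$ be a measurable function of the control data which is a maximum likelihood estimate of $\theta$ from the control data whenever one exists, the likelihood being maximized over all $\theta\in\mathbb R^{p+1}$ with $\theta^TX^{(0)}_i\in J$ for all $i\le n$. Let $$\bar S_n=\frac1n\sum_{i=1}^n\frac{\partial\mu^{(1)}(\beta,\theta;X_i^{(1)})}{\partial\beta^T}\cdot\frac{Y_i^{(1)}-\mu^{(1)}(\beta,\theta;X_i^{(1)})}{\sigma^2(\theta^TX_i^{(1)}+\beta^TX_i^{(1)})}\Bigg|_{\beta=\beta_0,\ \theta=\hat\theta_n}.$$ **Information.** Let $$I^{(0)}(\theta)=\mathbb E_{X\sim P_0}\!\left[\frac{\frac{\partial\mu^{(0)}}{\partial\theta^T}\frac{\partial\mu^{(0)}}{\partial\theta}}{\sigma^2(\theta^TX)}\right],\qquad I^{(1)}(\theta)=\mathbb E_{X\sim P_1}\!\left[\frac{\frac{\partial\mu^{(1)}}{\partial\theta^T}\frac{\partial\mu^{(1)}}{\partial\beta}}{\sigma^2(\theta^TX+\beta^TX)}\right]_{\beta=\beta_0},$$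 $$V(\theta)=I^{(1)}(\theta)+I^{(1)}(\theta)\,[I^{(0)}(\theta)]^{-1}I^{(1)}(\theta).$$ **Regularity.** Assume that $I^{(0)}(\theta_0)$ is invertible, and that for $(P,v_0)=(P_0,\theta_0)$ and for $(P,v_0)=(P_1,\theta_0+\beta_0)$ the following holds. Write $s(v;x,y)=\frac{y-\mu(v^Tx)}{\sigma^2(v^Tx)}\nabla_v\,\mu(v^Tx)$ for the score of the regression with coefficient vector $v$. There are a ball $B$ around $v_0$ and a $P$-integrable $F$ such that for $P$-almost every $x$ and all $v\in B$: $v^Tx\in J$, and $\mathbb E\big[\sup_{u\in B}\|\partial_u s(u;x,Y)\|\big]\le F(x)$ when $Y$ has the law with linear predictor $v^Tx$. **Claim.** Under $H_0:\beta=\beta_0$, $$\sqrt n\,\bar S_n\xrightarrow{d}\mathrm{MVN}_{p+1}(0,V(\theta_0)).$$ For every $\delta\in\mathbb R^{p+1}$, under the local alternatives $H_1:\beta=\beta_0+\delta/\sqrt n$ (the samples of size $n$ having this parameter, for all large $n$), $$\sqrt n\left(\bar S_n-I^{(1)}(\theta_0)(\beta-\beta_0)\right)\xrightarrow{d}\mathrm{MVN}_{p+1}(0,V(\theta_0)).$$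 -/

import Mathlib

open MeasureTheory ProbabilityTheory Filter Topology
open scoped ENNReal RealInnerProductSpace

noncomputable section

namespace SeqScore

/-- Vectors with `p + 1` real coordinates (covariates and regression coefficients),
with the Euclidean norm. -/
abbrev Vec (p : ℕ) := EuclideanSpace ℝ (Fin (p + 1))

/-- A one-parameter exponential (dispersion) family on `ℝ` at a fixed known dispersion:
the densities `exp ((y γ - b γ) / a + c y)` with respect to the reference measure `ν`
(for instance Lebesgue or counting measure), for canonical parameters `γ` in the open
interval `Γ`. -/
structure ExpFamily where
  ν : Measure ℝ
  sigmaFinite : SigmaFinite ν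
  a : ℝ
  a_pos : 0 < a
  b : ℝ → ℝ
  c : ℝ → ℝ
  c_measurable : Measurable c
  Γ : Set ℝ
  isOpen_Γ : IsOpen Γ
  ordConnected_Γ : Γ.OrdConnected
  lintegral_density : ∀ γ ∈ Γ, ∫⁻ y, ENNReal.ofReal (Real.exp ((y * γ - b γ) / a + c y)) ∂ν = 1

namespace ExpFamily

variable (M : ExpFamily)

def logDensity (γ y : ℝ) : ℝ := (y * γ - M.b γ) / M.a + M.c y

def density (γ y : ℝ) : ℝ := Real.exp (M.logDensity γ y)

/-- The law of a response with canonical parameter `γ`. -/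
def law (γ : ℝ) : Measure ℝ := M.ν.withDensity fun y => ENNReal.ofReal (M.density γ y)

/-- The mean of a response with canonical parameter `γ`. -/
def mean (γ : ℝ) : ℝ := ∫ y, y ∂(M.law γ)

/-- The variance of a response with canonical parameter `γ` (that is, `a * V`). -/
def var (γ : ℝ) : ℝ := Var[fun y => y; M.law γ]

end ExpFamily

/-- A generalized linear model: an exponential family with a twice continuously differentiable
link function `g` on the set of means, whose derivative does not vanish there. -/
structure GLM extends ExpFamily where
  g : ℝ → ℝ
  contDiffAt_g : ∀ γ ∈ Γ, ContDiffAt ℝ 2 g (toExpFamily.mean γ)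
  deriv_g_ne_zero : ∀ γ ∈ Γ, deriv g (toExpFamily.mean γ) ≠ 0

namespace GLM

variable (M : GLM) {p : ℕ}

/-- The values `g μ`, `μ` a mean of the family: the admissible values of the linear predictor. -/
def predictorRange : Set ℝ := (fun γ => M.g (M.mean γ)) '' M.Γ

/-- The canonical parameter `γ ∈ Γ` that solves `g (mean γ) = η`. -/
def canon (η : ℝ) : ℝ := Function.invFunOn (fun γ => M.g (M.mean γ)) M.Γ η

/-- The mean response at linear predictor `η`. -/
def meanAt (η : ℝ) : ℝ := M.mean (M.canon η)

/-- The response variance at linear predictor `η`. -/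
def varAt (η : ℝ) : ℝ := M.var (M.canon η)

/-- Linear predictor of the control group (`A = 0`). -/
def eta0 (θ x : Vec p) : ℝ := ⟪θ, x⟫

/-- Linear predictor of the treatment group (`A = 1`). -/
def eta1 (β θ x : Vec p) : ℝ := ⟪θ, x⟫ + ⟪β, x⟫

def mu0 (θ x : Vec p) : ℝ := M.meanAt (eta0 θ x)

def mu1 (β θ x : Vec p) : ℝ := M.meanAt (eta1 β θ x)

/-- The law of `(X, Y)`, when `X` has law `P` and, given `X = x`, the response `Y` has the density
of the family with linear predictor `η x`. -/
def armLaw (P : Measure (Vec p)) (η : Vec p → ℝ) : Measure (Vec p × ℝ) :=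
  (P.prod M.ν).withDensity fun z => ENNReal.ofReal (M.density (M.canon (η z.1)) z.2)

/-- Score for `θ` of one control observation `(x, y)`. -/
def score0 (θ x : Vec p) (y : ℝ) : Vec p :=
  ((y - M.mu0 θ x) / M.varAt (eta0 θ x)) • gradient (fun t => M.mu0 t x) θ

/-- Score for `β` of one treatment observation `(x, y)`. -/
def score1 (β θ x : Vec p) (y : ℝ) : Vec p :=
  ((y - M.mu1 β θ x) / M.varAt (eta1 β θ x)) • gradient (fun t => M.mu1 t θ x) β

/-- Information matrix of the control group. -/
def info0 (P : Measure (Vec p)) (θ : Vec p) : Matrix (Fin (p + 1)) (Fin (p + 1)) ℝ :=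
  Matrix.of fun i j =>
    ∫ x, gradient (fun t => M.mu0 t x) θ i * gradient (fun t => M.mu0 t x) θ j
      / M.varAt (eta0 θ x) ∂P

/-- Information matrix of the treatment group. -/
def info1 (P : Measure (Vec p)) (β θ : Vec p) : Matrix (Fin (p + 1)) (Fin (p + 1)) ℝ :=
  Matrix.of fun i j =>
    ∫ x, gradient (fun t => M.mu1 β t x) θ i * gradient (fun t => M.mu1 t θ x) β j
      / M.varAt (eta1 β θ x) ∂P

/-- The matrix `V(θ) = I1 + I1 I0⁻¹ I1`. -/
def asympVar (P₀ P₁ : Measure (Vec p)) (β₀ θ : Vec p) : Matrix (Fin (p + 1)) (Fin (p + 1)) ℝ :=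
  M.info1 P₁ β₀ θ + M.info1 P₁ β₀ θ * (M.info0 P₀ θ)⁻¹ * M.info1 P₁ β₀ θ

/-- `θ` is a maximum likelihood estimate from the control data `d`: it maximizes the
log-likelihood over all coefficient vectors whose linear predictors at the observed covariates
are admissible (all coefficient vectors, if the link maps the set of means onto `ℝ`). -/
def IsMLE {n : ℕ} (d : Fin n → Vec p × ℝ) (θ : Vec p) : Prop :=
  (∀ i, eta0 θ (d i).1 ∈ M.predictorRange) ∧
  ∀ t : Vec p, (∀ i, eta0 t (d i).1 ∈ M.predictorRange) →
    ∑ i, M.logDensity (M.canon (eta0 t (d i).1)) (d i).2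
      ≤ ∑ i, M.logDensity (M.canon (eta0 θ (d i).1)) (d i).2

/-- The average treatment score for `β` at `β₀` computed from the treatment data `d₁`, at the
value `θ` of the nuisance parameter. -/
def avgScore {n : ℕ} (β₀ θ : Vec p) (d₁ : Fin n → Vec p × ℝ) : Vec p :=
  (n : ℝ)⁻¹ • ∑ i, M.score1 β₀ θ (d₁ i).1 (d₁ i).2

/-- Local regularity of the regression model with linear predictor `⟪v, x⟫` and covariate law `P`
at the coefficient vector `v₀`: for coefficient vectors near `v₀`, the linear predictor is
admissible and the derivative of the score is dominated in mean. -/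
def LocallyRegular (P : Measure (Vec p)) (v₀ : Vec p) : Prop :=
  ∃ ε > 0, ∃ F : Vec p → ℝ, Integrable F P ∧
    ∀ᵐ x ∂P, ∀ v ∈ Metric.ball v₀ ε,
      eta0 v x ∈ M.predictorRange ∧
      ∫⁻ y, (⨆ u ∈ Metric.ball v₀ ε, ‖fderiv ℝ (fun t => M.score0 t x y) u‖ₑ)
        ∂(M.law (M.canon (eta0 v x))) ≤ ENNReal.ofReal (F x)

/-- Under `Pr`, the `2 n` observations are independent, the control observations `D₀ i` and the
treatment observations `D₁ i` following the model with parameters `θ` and `β`. -/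
structure IsSample (P₀ P₁ : Measure (Vec p)) (β θ : Vec p) {Ω : Type*} [MeasurableSpace Ω]
    (Pr : Measure Ω) {n : ℕ} (D₀ D₁ : Fin n → Ω → Vec p × ℝ) : Prop where
  indep : iIndepFun (fun k : Fin n ⊕ Fin n => Sum.elim D₀ D₁ k) Pr
  law0 : ∀ i, HasLaw (D₀ i) (M.armLaw P₀ (eta0 θ)) Pr
  law1 : ∀ i, HasLaw (D₁ i) (M.armLaw P₁ (eta1 β θ)) Pr

end GLM

end SeqScore

end

/-! Write A₀ and A₁ for the two informations at θ₀, and Z₀, Z₁ for the score sums, divided by √n, of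
the control sample at θ₀ and of the treatment sample at its true coefficient θ₀ + β. Since θ and β
enter the treatment group only through θ + β, A₁ is the information of a single regression at θ₀ +
β₀ (`info1_eq`), so one theory of a regression near a vector v₀ serves both groups.

The average score near v₀ is linear with slope minus the information. In the control group the
likelihood equation then reads A₀ √n(θ̂ - θ₀) ≈ Z₀. In the treatment group the score is expanded
about θ₀ + β₀ at two points, θ̂ + β₀ and θ₀ + β; the difference of the expansions shows that the
centred statistic is close to Z₁ - A₁ √n(θ̂ - θ₀), hence to Z₁ - A₁A₀⁻¹Z₀
(`tendsto_measure_norm_sub_gt`). The two samples are independent, with Gaussian limits of covariance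
A₀ and A₁, so the limit has covariance A₁ + A₁A₀⁻¹A₁. All limit theorems are proved for laws with
coefficients v n → v₀, which covers the local alternatives directly, without contiguity; the null
hypothesis is the case δ = 0.

Consistency of θ̂ is the hard part: the coefficient space is not compact and the likelihood need not
be concave. Wald's argument is run with square roots of likelihood ratios, whose mean under the
truth is the Hellinger affinity, at most one. Their suprema are integrable because each ratio is
monotone in the response (`lintegral_biSup_rootRatio_le`). Ultrafilters replace compactness: along a
suitable filter every linear predictor converges in the extended reals, the likelihood ratios
converge, possibly at an end of the parameter interval, and the limiting affinity is below one
unless the coefficients tend to θ₀ (`exists_mem_lintegral_envelope_lt_one`). The product of n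
independent envelopes then has geometrically small mean. This also gives existence of the estimate
with probability tending to one.

The linearization combines a law of large numbers for the Hessian at v₀ with a small mean
oscillation of the Hessian over a small ball. It is relative to ‖θ̂ - θ₀‖, so consistency suffices
and the √n rate comes out by absorption (`norm_sub_le_of_linearization`). Limit laws go through
characteristic functions, which need no moments beyond those supplied by the regularity assumption.
-/

noncomputable section

namespace SeqScore

/-! ### Exponential families: cumulants, moments and domination. -/

namespace ExpFamily

variable (M : ExpFamily)

instance : SigmaFinite M.ν := M.sigmaFinite

lemma measurable_density (γ : ℝ) : Measurable (M.density γ) := by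
  have := M.c_measurable
  unfold density logDensity
  fun_prop

lemma density_pos (γ y : ℝ) : 0 < M.density γ y := Real.exp_pos _

lemma integrable_density {γ : ℝ} (hγ : γ ∈ M.Γ) : Integrable (M.density γ) M.ν := by
  refine ⟨(M.measurable_density γ).aestronglyMeasurable, ?_⟩
  rw [hasFiniteIntegral_iff_ofReal (ae_of_all _ fun y => (M.density_pos γ y).le)]
  have := M.lintegral_density γ hγ
  simp only [density, logDensity]
  rw [this]
  exact ENNReal.one_lt_top

lemma integral_density {γ : ℝ} (hγ : γ ∈ M.Γ) : ∫ y, M.density γ y ∂M.ν = 1 := by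
  rw [integral_eq_lintegral_of_nonneg_ae (ae_of_all _ fun y => (M.density_pos γ y).le)
    (M.measurable_density γ).aestronglyMeasurable]
  have := M.lintegral_density γ hγ
  simp only [density, logDensity]
  rw [this]
  simp

lemma isProbabilityMeasure_law {γ : ℝ} (hγ : γ ∈ M.Γ) : IsProbabilityMeasure (M.law γ) :=
  ⟨by rw [law, withDensity_apply _ MeasurableSet.univ, Measure.restrict_univ]
      exact M.lintegral_density γ hγ⟩

lemma lintegral_law (γ : ℝ) (f : ℝ → ℝ≥0∞) :
    ∫⁻ y, f y ∂(M.law γ) = ∫⁻ y, ENNReal.ofReal (M.density γ y) * f y ∂M.ν := by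
  rw [law, lintegral_withDensity_eq_lintegral_mul_non_measurable _
    (M.measurable_density γ).ennreal_ofReal (ae_of_all _ fun _ => ENNReal.ofReal_lt_top)]
  rfl

lemma integral_law {E : Type*} [NormedAddCommGroup E] [NormedSpace ℝ E] (γ : ℝ) (f : ℝ → E) :
    ∫ y, f y ∂(M.law γ) = ∫ y, M.density γ y • f y ∂M.ν := by
  rw [law, integral_withDensity_eq_integral_toReal_smul (M.measurable_density γ).ennreal_ofReal
    (ae_of_all _ fun _ => ENNReal.ofReal_lt_top)]
  simp_rw [ENNReal.toReal_ofReal (M.density_pos γ _).le]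

lemma integrable_law_iff {E : Type*} [NormedAddCommGroup E] [NormedSpace ℝ E] (γ : ℝ) (f : ℝ → E) :
    Integrable f (M.law γ) ↔ Integrable (fun y => M.density γ y • f y) M.ν := by
  rw [law, integrable_withDensity_iff_integrable_smul' (M.measurable_density γ).ennreal_ofReal
    (ae_of_all _ fun _ => ENNReal.ofReal_lt_top)]
  simp_rw [ENNReal.toReal_ofReal (M.density_pos γ _).le]

lemma ae_law_iff (γ : ℝ) {q : ℝ → Prop} : (∀ᵐ y ∂(M.law γ), q y) ↔ ∀ᵐ y ∂M.ν, q y := by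
  rw [law, ae_withDensity_iff (M.measurable_density γ).ennreal_ofReal]
  simp [M.density_pos]

/-- The carrier measure `exp (c y) ν (dy)`, of which the family is an exponential tilting. -/
def carrier : Measure ℝ := M.ν.withDensity fun y => ENNReal.ofReal (Real.exp (M.c y))

lemma measurable_ofReal_exp_c : Measurable fun y => ENNReal.ofReal (Real.exp (M.c y)) :=
  (Real.measurable_exp.comp M.c_measurable).ennreal_ofReal

lemma integrable_carrier_iff (f : ℝ → ℝ) :
    Integrable f M.carrier ↔ Integrable (fun y => Real.exp (M.c y) * f y) M.ν := by
  rw [carrier, integrable_withDensity_iff_integrable_smul' M.measurable_ofReal_exp_c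
    (ae_of_all _ fun _ => ENNReal.ofReal_lt_top)]
  simp_rw [ENNReal.toReal_ofReal (Real.exp_pos _).le, smul_eq_mul]

lemma integral_carrier (f : ℝ → ℝ) :
    ∫ y, f y ∂M.carrier = ∫ y, Real.exp (M.c y) * f y ∂M.ν := by
  rw [carrier, integral_withDensity_eq_integral_toReal_smul M.measurable_ofReal_exp_c
    (ae_of_all _ fun _ => ENNReal.ofReal_lt_top)]
  simp_rw [ENNReal.toReal_ofReal (Real.exp_pos _).le, smul_eq_mul]

lemma exp_c_mul (γ y : ℝ) : Real.exp (M.c y) * Real.exp (γ / M.a * y)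
    = Real.exp (M.b γ / M.a) * M.density γ y := by
  rw [density, logDensity, ← Real.exp_add, ← Real.exp_add]
  congr 1
  ring

lemma mem_integrableExpSet {γ : ℝ} (hγ : γ ∈ M.Γ) :
    γ / M.a ∈ integrableExpSet (fun y => y) M.carrier := by
  change Integrable (fun y => Real.exp (γ / M.a * y)) M.carrier
  rw [integrable_carrier_iff]
  simp_rw [exp_c_mul]
  exact (M.integrable_density hγ).const_mul _

/-- Because `Γ` is open, exponential moments are finite on a neighbourhood of `γ / a`; being an
interior point is what gives analytic cumulants and moments of every order. -/
lemma mem_interior_integrableExpSet {γ : ℝ} (hγ : γ ∈ M.Γ) :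
    γ / M.a ∈ interior (integrableExpSet (fun y => y) M.carrier) := by
  have h : Tendsto (fun t => t * M.a) (𝓝 (γ / M.a)) (𝓝 γ) := by
    have : Continuous fun t : ℝ => t * M.a := by fun_prop
    simpa [div_mul_cancel₀ _ M.a_pos.ne'] using this.tendsto (γ / M.a)
  rw [mem_interior_iff_mem_nhds]
  filter_upwards [h (M.isOpen_Γ.mem_nhds hγ)] with t ht
  simpa [M.a_pos.ne'] using M.mem_integrableExpSet ht

lemma mgf_carrier {γ : ℝ} (hγ : γ ∈ M.Γ) :
    mgf (fun y => y) M.carrier (γ / M.a) = Real.exp (M.b γ / M.a) := by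
  rw [mgf, integral_carrier]
  simp_rw [exp_c_mul]
  rw [integral_const_mul, M.integral_density hγ, mul_one]

lemma cgf_carrier {γ : ℝ} (hγ : γ ∈ M.Γ) :
    cgf (fun y => y) M.carrier (γ / M.a) = M.b γ / M.a := by
  rw [cgf, M.mgf_carrier hγ, Real.log_exp]

/-- The normalizer of the tilt is `exp (b γ / a)`. Mean and variance thereby become derivatives of a
cumulant generating function. -/
lemma law_eq_tilted {γ : ℝ} (hγ : γ ∈ M.Γ) :
    M.law γ = M.carrier.tilted (fun y => γ / M.a * y) := by
  have h1 : ∫ y, Real.exp (γ / M.a * y) ∂M.carrier = Real.exp (M.b γ / M.a) := M.mgf_carrier hγ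
  rw [Measure.tilted, h1, carrier, ← withDensity_mul _ M.measurable_ofReal_exp_c (by fun_prop), law]
  congr 1
  ext y
  rw [Pi.mul_apply, ← ENNReal.ofReal_mul (Real.exp_pos _).le, ← mul_div_assoc, exp_c_mul,
    mul_div_cancel_left₀ _ (Real.exp_pos _).ne']

lemma mean_eq {γ : ℝ} (hγ : γ ∈ M.Γ) : M.mean γ = deriv (cgf (fun y => y) M.carrier) (γ / M.a) := by
  rw [mean, M.law_eq_tilted hγ]
  exact integral_tilted_mul_self (M.mem_interior_integrableExpSet hγ)

lemma var_eq {γ : ℝ} (hγ : γ ∈ M.Γ) :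
    M.var γ = iteratedDeriv 2 (cgf (fun y => y) M.carrier) (γ / M.a) := by
  rw [var, M.law_eq_tilted hγ]
  exact variance_tilted_mul (M.mem_interior_integrableExpSet hγ)

lemma eventually_mem {γ : ℝ} (hγ : γ ∈ M.Γ) : ∀ᶠ t in 𝓝 γ, t ∈ M.Γ := M.isOpen_Γ.mem_nhds hγ

lemma hasDerivAt_div_a (γ : ℝ) : HasDerivAt (fun t => t / M.a) (1 / M.a) γ :=
  (hasDerivAt_id γ).div_const M.a

lemma analyticAt_div_a (γ : ℝ) : AnalyticAt ℝ (fun t => t / M.a) γ := by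
  fun_prop

lemma hasDerivAt_b {γ : ℝ} (hγ : γ ∈ M.Γ) : HasDerivAt M.b (M.mean γ) γ := by
  have h := ((analyticAt_cgf (M.mem_interior_integrableExpSet hγ)).differentiableAt.hasDerivAt.comp γ
    (M.hasDerivAt_div_a γ)).const_mul M.a
  rw [← M.mean_eq hγ] at h
  have h2 : M.a * (M.mean γ * (1 / M.a)) = M.mean γ := by
    field_simp [M.a_pos.ne']
  rw [h2] at h
  refine h.congr_of_eventuallyEq ?_
  filter_upwards [M.eventually_mem hγ] with t ht
  simp only [Function.comp_apply]
  rw [M.cgf_carrier ht, mul_div_cancel₀ _ M.a_pos.ne']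

lemma analyticAt_mean {γ : ℝ} (hγ : γ ∈ M.Γ) : AnalyticAt ℝ M.mean γ := by
  have h := ((analyticAt_cgf (M.mem_interior_integrableExpSet hγ)).deriv).fun_comp
    (f := fun t => t / M.a) (M.analyticAt_div_a γ)
  refine h.congr ?_
  filter_upwards [M.eventually_mem hγ] with t ht
  exact (M.mean_eq ht).symm

lemma analyticAt_var {γ : ℝ} (hγ : γ ∈ M.Γ) : AnalyticAt ℝ M.var γ := by
  have h := (((analyticAt_cgf (M.mem_interior_integrableExpSet hγ)).deriv).deriv).fun_comp
    (f := fun t => t / M.a) (M.analyticAt_div_a γ)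
  refine h.congr ?_
  filter_upwards [M.eventually_mem hγ] with t ht
  rw [M.var_eq ht, iteratedDeriv_succ, iteratedDeriv_one]

lemma hasDerivAt_mean {γ : ℝ} (hγ : γ ∈ M.Γ) : HasDerivAt M.mean (M.var γ / M.a) γ := by
  have h := ((analyticAt_cgf (M.mem_interior_integrableExpSet hγ)).deriv).differentiableAt.hasDerivAt.comp
    γ (M.hasDerivAt_div_a γ)
  have h3 : deriv (deriv (cgf (fun y => y) M.carrier)) (γ / M.a) = M.var γ := by
    rw [M.var_eq hγ, iteratedDeriv_succ, iteratedDeriv_one]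
  rw [h3, mul_one_div] at h
  refine h.congr_of_eventuallyEq ?_
  filter_upwards [M.eventually_mem hγ] with t ht
  exact M.mean_eq ht

lemma memLp_law {γ : ℝ} (hγ : γ ∈ M.Γ) (p : NNReal) : MemLp (fun y => y) p (M.law γ) := by
  rw [M.law_eq_tilted hγ]
  exact memLp_tilted_mul (M.mem_interior_integrableExpSet hγ) p

lemma var_nonneg (γ : ℝ) : 0 ≤ M.var γ := variance_nonneg _ _

/-- The family is not concentrated on a single point. -/
def Nondegenerate : Prop := ∀ c : ℝ, ¬ ∀ᵐ y ∂M.ν, y = c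

lemma var_pos (hM : M.Nondegenerate) {γ : ℝ} (hγ : γ ∈ M.Γ) : 0 < M.var γ := by
  refine lt_of_le_of_ne (M.var_nonneg γ) fun h => ?_
  have := M.isProbabilityMeasure_law hγ
  have h1 := ae_eq_integral_of_variance_eq_zero (M.memLp_law hγ 2) h.symm
  exact hM _ ((M.ae_law_iff γ).1 h1)

lemma strictMonoOn_mean (hM : M.Nondegenerate) : StrictMonoOn M.mean M.Γ := by
  refine strictMonoOn_of_deriv_pos M.ordConnected_Γ.convex
    (fun γ hγ => (M.hasDerivAt_mean hγ).continuousAt.continuousWithinAt) fun γ hγ => ?_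
  have hγ' := interior_subset hγ
  rw [(M.hasDerivAt_mean hγ').deriv]
  exact div_pos (M.var_pos hM hγ') M.a_pos

lemma one_add_abs_pow_le (k : ℕ) {τ : ℝ} (hτ : 0 < τ) (y : ℝ) :
    (1 + |y|) ^ k ≤ k.factorial * τ⁻¹ ^ k * Real.exp τ * Real.exp (τ * |y|) := by
  have h := Real.pow_div_factorial_le_exp (τ * (1 + |y|)) (by positivity) k
  rw [div_le_iff₀ (by positivity), mul_pow] at h
  calc (1 + |y|) ^ k = τ⁻¹ ^ k * (τ ^ k * (1 + |y|) ^ k) := by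
        rw [← mul_assoc, ← mul_pow, inv_mul_cancel₀ hτ.ne', one_pow, one_mul]
    _ ≤ τ⁻¹ ^ k * (Real.exp (τ * (1 + |y|)) * k.factorial) := by gcongr
    _ = _ := by rw [mul_add, mul_one, Real.exp_add]; ring

/-- Near a parameter of the family, the densities weighted by a power are dominated by an
integrable function. -/
lemma exists_bound_density {γ : ℝ} (hγ : γ ∈ M.Γ) (k : ℕ) :
    ∃ H : ℝ → ℝ, Integrable H M.ν ∧ ∀ᶠ t in 𝓝 γ, ∀ y, M.density t y * (1 + |y|) ^ k ≤ H y := by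
  obtain ⟨d, hd, hball⟩ := Metric.isOpen_iff.1 M.isOpen_Γ γ hγ
  have ha := M.a_pos
  -- For `|t - γ| < e`, the exponent `t y + e |y|` is at most `(γ + 2e) y` or `(γ - 2e) y`,
  -- according to the sign of `y`, and `2e < d` keeps both parameters in `Γ`. The spare `e |y|`
  -- absorbs the power.
  set e := d / 3 with he
  have he0 : 0 < e := by positivity
  have hp : γ + 2 * e ∈ M.Γ := hball (by
    rw [Metric.mem_ball, Real.dist_eq, add_sub_cancel_left, abs_of_pos (by positivity)]; linarith)
  have hm : γ - 2 * e ∈ M.Γ := hball (by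
    rw [Metric.mem_ball, Real.dist_eq, sub_sub_cancel_left, abs_neg, abs_of_pos (by positivity)]
    linarith)
  set K := k.factorial * (e / M.a)⁻¹ ^ k * Real.exp (e / M.a) with hK
  set B := Real.exp ((|M.b γ| + 1) / M.a)
  have hint : ∀ t ∈ M.Γ, Integrable (fun y => Real.exp (M.b t / M.a) * M.density t y) M.ν :=
    fun t ht => (M.integrable_density ht).const_mul _
  refine ⟨fun y => K * B * (Real.exp (M.b (γ + 2 * e) / M.a) * M.density (γ + 2 * e) y
    + Real.exp (M.b (γ - 2 * e) / M.a) * M.density (γ - 2 * e) y),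
    ((hint _ hp).add (hint _ hm)).const_mul _, ?_⟩
  -- Continuity of `b` bounds the normalizer `exp (-b t / a)` near `γ` by the constant `B`.
  have hb : ∀ᶠ t in 𝓝 γ, -M.b t ≤ |M.b γ| + 1 := by
    have := (M.hasDerivAt_b hγ).continuousAt.tendsto.neg.eventually_lt_const
      (u := |M.b γ| + 1) (by linarith [neg_le_abs (M.b γ)])
    exact this.mono fun t ht => ht.le
  filter_upwards [hb, Metric.ball_mem_nhds γ he0] with t ht hte y
  rw [← exp_c_mul, ← exp_c_mul]
  have hkey : M.density t y ≤ B * (Real.exp (M.c y) * Real.exp (t / M.a * y)) := by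
    rw [exp_c_mul, ← mul_assoc, ← Real.exp_add]
    refine le_mul_of_one_le_left (M.density_pos t y).le (Real.one_le_exp ?_)
    rw [← add_div]
    exact div_nonneg (by linarith) ha.le
  have hexp : Real.exp (t / M.a * y) * Real.exp (e / M.a * |y|)
      ≤ Real.exp ((γ + 2 * e) / M.a * y) + Real.exp ((γ - 2 * e) / M.a * y) := by
    rw [← Real.exp_add]
    rw [Metric.mem_ball, Real.dist_eq, abs_lt] at hte
    rcases le_total 0 y with hy | hy
    · rw [abs_of_nonneg hy, ← add_mul, ← add_div]
      refine le_add_of_le_of_nonneg (Real.exp_le_exp.2 ?_) (Real.exp_pos _).le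
      exact mul_le_mul_of_nonneg_right (div_le_div_of_nonneg_right (by linarith) ha.le) hy
    · rw [abs_of_nonpos hy, mul_neg, ← neg_mul, ← add_mul, ← neg_div, ← add_div]
      refine le_add_of_nonneg_of_le (Real.exp_pos _).le (Real.exp_le_exp.2 ?_)
      exact mul_le_mul_of_nonpos_right (div_le_div_of_nonneg_right (by linarith) ha.le) hy
  calc M.density t y * (1 + |y|) ^ k
      ≤ (B * (Real.exp (M.c y) * Real.exp (t / M.a * y))) * (K * Real.exp (e / M.a * |y|)) := by
        gcongr
        exact one_add_abs_pow_le k (by positivity) y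
    _ = K * B * Real.exp (M.c y) * (Real.exp (t / M.a * y) * Real.exp (e / M.a * |y|)) := by ring
    _ ≤ K * B * Real.exp (M.c y) * (Real.exp ((γ + 2 * e) / M.a * y)
          + Real.exp ((γ - 2 * e) / M.a * y)) := by
        gcongr
    _ = _ := by ring

lemma tendsto_density {ι : Type*} {l : Filter ι} {t : ι → ℝ} {γ : ℝ} (hγ : γ ∈ M.Γ)
    (ht : Tendsto t l (𝓝 γ)) (y : ℝ) :
    Tendsto (fun i => M.density (t i) y) l (𝓝 (M.density γ y)) := by
  have hb := (M.hasDerivAt_b hγ).continuousAt.tendsto.comp ht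
  unfold density logDensity
  refine (Real.continuous_exp.tendsto _).comp ?_
  exact (((ht.const_mul y).sub hb).div_const _).add_const _

/-- Moving the density into the integrand turns a limit under changing laws into dominated
convergence under the fixed measure `ν`; `exists_bound_density` supplies the majorant for polynomial
growth. -/
lemma tendsto_integral_law {ι E : Type*} [NormedAddCommGroup E] [NormedSpace ℝ E] {l : Filter ι}
    [l.IsCountablyGenerated] {t : ι → ℝ} {γ : ℝ} (hγ : γ ∈ M.Γ) (ht : Tendsto t l (𝓝 γ))
    {f : ι → ℝ → E} {f₀ : ℝ → E} {C : ℝ} {k : ℕ}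
    (hmeas : ∀ᶠ i in l, AEStronglyMeasurable (f i) M.ν)
    (hbound : ∀ᶠ i in l, ∀ y, ‖f i y‖ ≤ C * (1 + |y|) ^ k)
    (hlim : ∀ y, Tendsto (fun i => f i y) l (𝓝 (f₀ y))) :
    Tendsto (fun i => ∫ y, f i y ∂(M.law (t i))) l (𝓝 (∫ y, f₀ y ∂(M.law γ))) := by
  simp_rw [integral_law]
  obtain ⟨H, hH, hdom⟩ := M.exists_bound_density hγ k
  refine tendsto_integral_filter_of_dominated_convergence (fun y => |C| * H y) ?_ ?_
    (hH.const_mul _) (ae_of_all _ fun y => (M.tendsto_density hγ ht y).smul (hlim y))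
  · filter_upwards [hmeas] with i hi
    exact (M.measurable_density _).aestronglyMeasurable.smul hi
  · filter_upwards [hbound, ht.eventually hdom] with i h1 h2
    refine ae_of_all _ fun y => ?_
    rw [norm_smul, Real.norm_of_nonneg (M.density_pos _ _).le]
    calc M.density (t i) y * ‖f i y‖ ≤ M.density (t i) y * (|C| * (1 + |y|) ^ k) := by
          have := M.density_pos (t i) y
          gcongr
          exact (h1 y).trans (by gcongr; exact le_abs_self C)
      _ = |C| * (M.density (t i) y * (1 + |y|) ^ k) := by ring
      _ ≤ _ := by gcongr; exact h2 y

lemma integrable_law_of_bound {E : Type*} [NormedAddCommGroup E] [NormedSpace ℝ E] {γ : ℝ}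
    (hγ : γ ∈ M.Γ) {f : ℝ → E} {C : ℝ} {k : ℕ} (hmeas : AEStronglyMeasurable f M.ν)
    (hbound : ∀ y, ‖f y‖ ≤ C * (1 + |y|) ^ k) : Integrable f (M.law γ) := by
  rw [integrable_law_iff]
  obtain ⟨H, hH, hdom⟩ := M.exists_bound_density hγ k
  refine (hH.const_mul |C|).mono' ((M.measurable_density _).aestronglyMeasurable.smul hmeas) ?_
  refine ae_of_all _ fun y => ?_
  rw [norm_smul, Real.norm_of_nonneg (M.density_pos _ _).le]
  have := M.density_pos γ y
  calc M.density γ y * ‖f y‖ ≤ M.density γ y * (|C| * (1 + |y|) ^ k) := by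
        gcongr
        exact (hbound y).trans (by gcongr; exact le_abs_self C)
    _ = |C| * (M.density γ y * (1 + |y|) ^ k) := by ring
    _ ≤ _ := by gcongr; exact hdom.self_of_nhds y

lemma integrable_id_law {γ : ℝ} (hγ : γ ∈ M.Γ) : Integrable (fun y => y) (M.law γ) :=
  M.integrable_law_of_bound hγ (C := 1) (k := 1) measurable_id.aestronglyMeasurable fun y => by
    rw [Real.norm_eq_abs]; linarith

lemma integral_sub_mean {γ : ℝ} (hγ : γ ∈ M.Γ) : ∫ y, (y - M.mean γ) ∂(M.law γ) = 0 := by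
  have := M.isProbabilityMeasure_law hγ
  rw [integral_sub (M.integrable_id_law hγ) (integrable_const _)]
  simp [mean]

lemma integral_sub_mean_sq {γ : ℝ} : ∫ y, (y - M.mean γ) ^ 2 ∂(M.law γ) = M.var γ := by
  rw [var, variance_eq_integral aemeasurable_id']
  rfl

end ExpFamily

/-! ### The canonical parameter, mean, variance and score as functions of the linear predictor. -/

namespace GLM

variable (M : GLM)

/-- The linear predictor as a function of the canonical parameter. -/
def predictor (γ : ℝ) : ℝ := M.g (M.mean γ)

lemma contDiffAt_predictor {γ : ℝ} (hγ : γ ∈ M.Γ) : ContDiffAt ℝ 2 M.predictor γ :=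
  (M.contDiffAt_g γ hγ).comp γ (M.analyticAt_mean hγ).contDiffAt

lemma hasDerivAt_predictor {γ : ℝ} (hγ : γ ∈ M.Γ) :
    HasDerivAt M.predictor (deriv M.g (M.mean γ) * (M.var γ / M.a)) γ :=
  ((M.contDiffAt_g γ hγ).differentiableAt (by norm_num)).hasDerivAt.comp γ (M.hasDerivAt_mean hγ)

lemma deriv_predictor_ne_zero (hM : M.Nondegenerate) {γ : ℝ} (hγ : γ ∈ M.Γ) :
    deriv M.g (M.mean γ) * (M.var γ / M.a) ≠ 0 :=
  mul_ne_zero (M.deriv_g_ne_zero γ hγ) (div_pos (M.var_pos hM hγ) M.a_pos).ne'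

lemma hasStrictDerivAt_predictor {γ : ℝ} (hγ : γ ∈ M.Γ) :
    HasStrictDerivAt M.predictor (deriv M.g (M.mean γ) * (M.var γ / M.a)) γ := by
  have h := (M.contDiffAt_predictor hγ).hasStrictDerivAt (by norm_num)
  rwa [(M.hasDerivAt_predictor hγ).deriv] at h

/-- A derivative without zeros on an interval has constant sign (Darboux). This gives global
injectivity, which the inverse function theorem alone would not. -/
lemma strictMonoOn_or_strictAntiOn_predictor (hM : M.Nondegenerate) :
    StrictMonoOn M.predictor M.Γ ∨ StrictAntiOn M.predictor M.Γ := by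
  have hconv : Convex ℝ M.Γ := M.ordConnected_Γ.convex
  have hcont : ContinuousOn M.predictor M.Γ := fun γ hγ =>
    (M.hasDerivAt_predictor hγ).continuousAt.continuousWithinAt
  rcases hasDerivWithinAt_forall_lt_or_forall_gt_of_forall_ne hconv
    (fun γ hγ => (M.hasDerivAt_predictor hγ).hasDerivWithinAt)
    (fun γ hγ => M.deriv_predictor_ne_zero hM hγ) with h | h
  · refine Or.inr (strictAntiOn_of_deriv_neg hconv hcont fun γ hγ => ?_)
    rw [(M.hasDerivAt_predictor (interior_subset hγ)).deriv]
    exact h γ (interior_subset hγ)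
  · refine Or.inl (strictMonoOn_of_deriv_pos hconv hcont fun γ hγ => ?_)
    rw [(M.hasDerivAt_predictor (interior_subset hγ)).deriv]
    exact h γ (interior_subset hγ)

lemma injOn_predictor (hM : M.Nondegenerate) : Set.InjOn M.predictor M.Γ := by
  rcases M.strictMonoOn_or_strictAntiOn_predictor hM with h | h
  · exact h.injOn
  · exact h.injOn

lemma predictor_mem {γ : ℝ} (hγ : γ ∈ M.Γ) : M.predictor γ ∈ M.predictorRange :=
  Set.mem_image_of_mem _ hγ

lemma canon_mem {η : ℝ} (hη : η ∈ M.predictorRange) : M.canon η ∈ M.Γ :=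
  Function.invFunOn_mem hη

lemma predictor_canon {η : ℝ} (hη : η ∈ M.predictorRange) : M.predictor (M.canon η) = η :=
  Function.invFunOn_eq (f := fun γ => M.g (M.mean γ)) hη

lemma canon_predictor (hM : M.Nondegenerate) {γ : ℝ} (hγ : γ ∈ M.Γ) :
    M.canon (M.predictor γ) = γ :=
  M.injOn_predictor hM (M.canon_mem (M.predictor_mem hγ)) hγ (M.predictor_canon (M.predictor_mem hγ))

lemma map_predictor_nhds (hM : M.Nondegenerate) {γ : ℝ} (hγ : γ ∈ M.Γ) :
    map M.predictor (𝓝 γ) = 𝓝 (M.predictor γ) :=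
  (M.hasStrictDerivAt_predictor hγ).map_nhds_eq (M.deriv_predictor_ne_zero hM hγ)

lemma isOpen_predictorRange (hM : M.Nondegenerate) : IsOpen M.predictorRange := by
  rw [isOpen_iff_mem_nhds]
  rintro _ ⟨γ, hγ, rfl⟩
  change M.predictorRange ∈ 𝓝 (M.predictor γ)
  rw [← M.map_predictor_nhds hM hγ]
  exact mem_map.2 (Filter.mem_of_superset (M.eventually_mem hγ) fun t ht => M.predictor_mem ht)

lemma ordConnected_predictorRange : M.predictorRange.OrdConnected := by
  have h : IsPreconnected (M.predictor '' M.Γ) :=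
    M.ordConnected_Γ.isPreconnected.image _ fun γ hγ =>
      (M.hasDerivAt_predictor hγ).continuousAt.continuousWithinAt
  exact h.ordConnected

/-- The inverse function theorem gives a `C²` local inverse of `predictor`; global injectivity
identifies it with `canon`. -/
lemma contDiffAt_canon (hM : M.Nondegenerate) {η : ℝ} (hη : η ∈ M.predictorRange) :
    ContDiffAt ℝ 2 M.canon η := by
  obtain ⟨γ, hγ, rfl⟩ := hη
  change ContDiffAt ℝ 2 M.canon (M.predictor γ)
  have hd := M.deriv_predictor_ne_zero hM hγ
  have hf := M.contDiffAt_predictor hγ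
  have hf' := (M.hasStrictDerivAt_predictor hγ).hasStrictFDerivAt_equiv hd
  have h2 : (2 : WithTop ℕ∞) ≠ 0 := by norm_num
  refine (hf.to_localInverse hf'.hasFDerivAt h2).congr_of_eventuallyEq ?_
  rw [← M.map_predictor_nhds hM hγ]
  refine eventually_map.2 ?_
  filter_upwards [(hf.hasStrictFDerivAt' hf'.hasFDerivAt h2).eventually_left_inverse,
    M.eventually_mem hγ] with t h1 ht
  rw [M.canon_predictor hM ht]
  exact h1.symm

lemma hasDerivAt_canon (hM : M.Nondegenerate) {η : ℝ} (hη : η ∈ M.predictorRange) :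
    HasDerivAt M.canon (deriv M.canon η) η :=
  ((M.contDiffAt_canon hM hη).differentiableAt (by norm_num)).hasDerivAt

lemma continuousAt_canon (hM : M.Nondegenerate) {η : ℝ} (hη : η ∈ M.predictorRange) :
    ContinuousAt M.canon η := (M.contDiffAt_canon hM hη).continuousAt

lemma contDiffAt_meanAt (hM : M.Nondegenerate) {η : ℝ} (hη : η ∈ M.predictorRange) :
    ContDiffAt ℝ 2 M.meanAt η :=
  (M.analyticAt_mean (M.canon_mem hη)).contDiffAt.comp η (M.contDiffAt_canon hM hη)

lemma contDiffAt_varAt (hM : M.Nondegenerate) {η : ℝ} (hη : η ∈ M.predictorRange) :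
    ContDiffAt ℝ 2 M.varAt η :=
  (M.analyticAt_var (M.canon_mem hη)).contDiffAt.comp η (M.contDiffAt_canon hM hη)

lemma varAt_pos (hM : M.Nondegenerate) {η : ℝ} (hη : η ∈ M.predictorRange) : 0 < M.varAt η :=
  M.var_pos hM (M.canon_mem hη)

lemma eventually_mem_predictorRange (hM : M.Nondegenerate) {η : ℝ} (hη : η ∈ M.predictorRange) :
    ∀ᶠ t in 𝓝 η, t ∈ M.predictorRange := (M.isOpen_predictorRange hM).mem_nhds hη

lemma hasDerivAt_meanAt (hM : M.Nondegenerate) {η : ℝ} (hη : η ∈ M.predictorRange) :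
    HasDerivAt M.meanAt (deriv M.meanAt η) η :=
  ((M.contDiffAt_meanAt hM hη).differentiableAt (by norm_num)).hasDerivAt

lemma deriv_meanAt (hM : M.Nondegenerate) {η : ℝ} (hη : η ∈ M.predictorRange) :
    deriv M.meanAt η = M.varAt η / M.a * deriv M.canon η :=
  ((M.hasDerivAt_mean (M.canon_mem hη)).comp η (M.hasDerivAt_canon hM hη)).deriv

/-- Differentiate `g (meanAt t) = t`. -/
lemma deriv_meanAt_ne_zero (hM : M.Nondegenerate) {η : ℝ} (hη : η ∈ M.predictorRange) :
    deriv M.meanAt η ≠ 0 := by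
  have h1 : HasDerivAt (fun t => M.g (M.meanAt t)) (deriv M.g (M.meanAt η) * deriv M.meanAt η) η :=
    ((M.contDiffAt_g _ (M.canon_mem hη)).differentiableAt (by norm_num)).hasDerivAt.comp η
      (M.hasDerivAt_meanAt hM hη)
  have h2 : HasDerivAt (fun t => M.g (M.meanAt t)) 1 η := by
    refine (hasDerivAt_id η).congr_of_eventuallyEq ?_
    filter_upwards [M.eventually_mem_predictorRange hM hη] with t ht
    exact M.predictor_canon ht
  intro h0
  rw [h0, mul_zero] at h1
  exact one_ne_zero (h2.unique h1)

lemma contDiffAt_deriv_meanAt (hM : M.Nondegenerate) {η : ℝ} (hη : η ∈ M.predictorRange) :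
    ContDiffAt ℝ 1 (deriv M.meanAt) η := by
  have h : ContDiffOn ℝ 2 M.meanAt M.predictorRange := fun t ht =>
    (M.contDiffAt_meanAt hM ht).contDiffWithinAt
  exact (h.deriv_of_isOpen (m := 1) (M.isOpen_predictorRange hM) (by norm_num)).contDiffAt
    ((M.isOpen_predictorRange hM).mem_nhds hη)

/-- The score of one response with respect to its linear predictor. -/
def etaScore (η y : ℝ) : ℝ := (y - M.meanAt η) / M.varAt η * deriv M.meanAt η

/-- The factor of the residual in the score of the linear predictor. -/
def sensitivity (η : ℝ) : ℝ := deriv M.meanAt η / M.varAt η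

/-- The derivative of the score with respect to the linear predictor. -/
def etaHess (η y : ℝ) : ℝ :=
  (y - M.meanAt η) * deriv M.sensitivity η - deriv M.meanAt η * M.sensitivity η

/-- The Fisher information of one response about its linear predictor. -/
def etaInfo (η : ℝ) : ℝ := deriv M.meanAt η * M.sensitivity η

lemma etaScore_eq (η y : ℝ) : M.etaScore η y = (y - M.meanAt η) * M.sensitivity η := by
  rw [etaScore, sensitivity]; ring

lemma contDiffAt_sensitivity (hM : M.Nondegenerate) {η : ℝ} (hη : η ∈ M.predictorRange) :
    ContDiffAt ℝ 1 M.sensitivity η :=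
  (M.contDiffAt_deriv_meanAt hM hη).div ((M.contDiffAt_varAt hM hη).of_le (by norm_num))
    (M.varAt_pos hM hη).ne'

lemma continuousAt_deriv_sensitivity (hM : M.Nondegenerate) {η : ℝ} (hη : η ∈ M.predictorRange) :
    ContinuousAt (deriv M.sensitivity) η := by
  have h : ContDiffOn ℝ 1 M.sensitivity M.predictorRange := fun t ht =>
    (M.contDiffAt_sensitivity hM ht).contDiffWithinAt
  exact ((h.continuousOn_deriv_of_isOpen (M.isOpen_predictorRange hM) le_rfl)).continuousAt
    ((M.isOpen_predictorRange hM).mem_nhds hη)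

lemma hasDerivAt_etaScore (hM : M.Nondegenerate) {η : ℝ} (hη : η ∈ M.predictorRange) (y : ℝ) :
    HasDerivAt (fun t => M.etaScore t y) (M.etaHess η y) η := by
  simp_rw [etaScore_eq]
  have h1 := (M.hasDerivAt_meanAt hM hη).const_sub y
  have h2 := ((M.contDiffAt_sensitivity hM hη).differentiableAt (by norm_num)).hasDerivAt
  refine (h1.mul h2).congr_deriv ?_
  rw [etaHess]; ring

lemma etaInfo_pos (hM : M.Nondegenerate) {η : ℝ} (hη : η ∈ M.predictorRange) :
    0 < M.etaInfo η := by
  rw [etaInfo, sensitivity, ← mul_div_assoc, ← pow_two]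
  have := M.deriv_meanAt_ne_zero hM hη
  have := M.varAt_pos hM hη
  positivity

lemma continuousAt_etaInfo (hM : M.Nondegenerate) {η : ℝ} (hη : η ∈ M.predictorRange) :
    ContinuousAt M.etaInfo η :=
  (M.contDiffAt_deriv_meanAt hM hη).continuousAt.mul (M.contDiffAt_sensitivity hM hη).continuousAt

/-- Since `b' = mean`, the derivative is `(y - meanAt η) * canon' / a`, and `meanAt' = (varAt / a) *
canon'` turns it into the score. -/
lemma hasDerivAt_logDensity_canon (hM : M.Nondegenerate) {η : ℝ} (hη : η ∈ M.predictorRange)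
    (y : ℝ) : HasDerivAt (fun t => M.logDensity (M.canon t) y) (M.etaScore η y) η := by
  have hc := M.hasDerivAt_canon hM hη
  have hb := (M.hasDerivAt_b (M.canon_mem hη)).comp η hc
  have h := (((hc.const_mul y).sub hb).div_const M.a).add_const (M.c y)
  refine h.congr_deriv ?_
  rw [etaScore, M.deriv_meanAt hM hη, meanAt]
  have := (M.varAt_pos hM hη).ne'
  have := M.a_pos.ne'
  field_simp

lemma measurableSet_predictorRange : MeasurableSet M.predictorRange :=
  M.ordConnected_predictorRange.measurableSet

/-- `invFunOn` has one default value off the range, so a continuous function of `canon` is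
continuous on the range and constant off it, hence measurable on all of `ℝ`. -/
lemma exists_canon_eq_of_notMem : ∃ γ₀, ∀ η ∉ M.predictorRange, M.canon η = γ₀ :=
  ⟨Classical.choice ⟨0⟩, fun _ hη => dif_neg hη⟩

lemma measurable_comp_canon (hM : M.Nondegenerate) {f : ℝ → ℝ} (hf : ContinuousOn f M.Γ) :
    Measurable fun η => f (M.canon η) := by
  classical
  obtain ⟨γ₀, hγ₀⟩ := M.exists_canon_eq_of_notMem
  have h1 : ContinuousOn (fun η => f (M.canon η)) M.predictorRange := fun η hη =>
    ((hf.continuousAt (M.isOpen_Γ.mem_nhds (M.canon_mem hη))).comp (f := M.canon)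
      (M.continuousAt_canon hM hη)).continuousWithinAt
  have h2 : ContinuousOn (fun _ : ℝ => f γ₀) M.predictorRangeᶜ := continuousOn_const
  convert ContinuousOn.measurable_piecewise h1 h2 M.measurableSet_predictorRange using 1
  ext η
  by_cases hη : η ∈ M.predictorRange
  · simp [hη]
  · simp [hη, hγ₀ η hη]

lemma measurable_canon (hM : M.Nondegenerate) : Measurable M.canon :=
  M.measurable_comp_canon hM (f := fun t => t) continuousOn_id

lemma measurable_meanAt (hM : M.Nondegenerate) : Measurable M.meanAt :=
  M.measurable_comp_canon hM fun _ hγ => (M.analyticAt_mean hγ).continuousAt.continuousWithinAt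

lemma measurable_varAt (hM : M.Nondegenerate) : Measurable M.varAt :=
  M.measurable_comp_canon hM fun _ hγ => (M.analyticAt_var hγ).continuousAt.continuousWithinAt

lemma measurable_sensitivity (hM : M.Nondegenerate) : Measurable M.sensitivity :=
  (measurable_deriv _).div (M.measurable_varAt hM)

lemma measurable_etaScore (hM : M.Nondegenerate) :
    Measurable fun z : ℝ × ℝ => M.etaScore z.1 z.2 := by
  simp_rw [etaScore_eq]
  exact (measurable_snd.sub ((M.measurable_meanAt hM).comp measurable_fst)).mul
    ((M.measurable_sensitivity hM).comp measurable_fst)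

lemma measurable_etaInfo (hM : M.Nondegenerate) : Measurable M.etaInfo :=
  (measurable_deriv _).mul (M.measurable_sensitivity hM)

lemma measurable_etaHess (hM : M.Nondegenerate) :
    Measurable fun z : ℝ × ℝ => M.etaHess z.1 z.2 := by
  have h1 : Measurable fun z : ℝ × ℝ => (z.2 - M.meanAt z.1) * deriv M.sensitivity z.1 :=
    (measurable_snd.sub ((M.measurable_meanAt hM).comp measurable_fst)).mul
      ((measurable_deriv _).comp measurable_fst)
  exact h1.sub ((M.measurable_etaInfo hM).comp measurable_fst)

lemma measurable_density_canon (hM : M.Nondegenerate) :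
    Measurable fun z : ℝ × ℝ => M.density (M.canon z.1) z.2 := by
  have hb : Measurable fun η => M.b (M.canon η) := M.measurable_comp_canon hM fun γ hγ =>
    (M.hasDerivAt_b hγ).continuousAt.continuousWithinAt
  have hc := M.measurable_canon hM
  have := M.c_measurable
  exact Real.measurable_exp.comp ((((measurable_snd.mul (hc.comp measurable_fst)).sub
    (hb.comp measurable_fst)).div_const _).add (this.comp measurable_snd))

lemma etaHess_eq (η y : ℝ) :
    M.etaHess η y = (y - M.meanAt η) * deriv M.sensitivity η - M.etaInfo η := rfl

lemma integral_etaScore {η : ℝ} (hη : η ∈ M.predictorRange) :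
    ∫ y, M.etaScore η y ∂(M.law (M.canon η)) = 0 := by
  simp_rw [etaScore_eq]
  rw [integral_mul_const, meanAt, M.integral_sub_mean (M.canon_mem hη), zero_mul]

lemma integral_etaScore_sq (hM : M.Nondegenerate) {η : ℝ} (hη : η ∈ M.predictorRange) :
    ∫ y, M.etaScore η y ^ 2 ∂(M.law (M.canon η)) = M.etaInfo η := by
  simp_rw [etaScore_eq, mul_pow]
  rw [integral_mul_const, meanAt, M.integral_sub_mean_sq, etaInfo, sensitivity]
  have := (M.varAt_pos hM hη).ne'
  change M.varAt η * _ = _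
  field_simp

lemma integrable_etaHess {η t : ℝ} (hη : η ∈ M.predictorRange) :
    Integrable (M.etaHess t) (M.law (M.canon η)) := by
  have := M.isProbabilityMeasure_law (M.canon_mem hη)
  exact ((((M.integrable_id_law (M.canon_mem hη)).sub (integrable_const _)).mul_const _).sub
    (integrable_const _))

/-- The residual has mean zero, so only the deterministic part of the Hessian survives. -/
lemma integral_etaHess {η : ℝ} (hη : η ∈ M.predictorRange) :
    ∫ y, M.etaHess η y ∂(M.law (M.canon η)) = -M.etaInfo η := by
  have := M.isProbabilityMeasure_law (M.canon_mem hη)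
  simp_rw [etaHess_eq]
  have hi : Integrable (fun y => (y - M.meanAt η) * deriv M.sensitivity η) (M.law (M.canon η)) :=
    ((M.integrable_id_law (M.canon_mem hη)).sub (integrable_const _)).mul_const _
  rw [integral_sub hi (integrable_const _), integral_mul_const, meanAt, M.integral_sub_mean (M.canon_mem hη)]
  simp

lemma continuousAt_etaHess (hM : M.Nondegenerate) {η : ℝ} (hη : η ∈ M.predictorRange) (y : ℝ) :
    ContinuousAt (fun t => M.etaHess t y) η :=
  (((continuousAt_const.sub (M.contDiffAt_meanAt hM hη).continuousAt)).mul
    (M.continuousAt_deriv_sensitivity hM hη)).sub (M.continuousAt_etaInfo hM hη)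

end GLM

/-! ### Scores and information of the vector regression. -/

lemma gradient_comp_add_inner {E : Type*} [NormedAddCommGroup E] [InnerProductSpace ℝ E]
    [CompleteSpace E] (f : ℝ → ℝ) (c : ℝ) (x v : E) :
    gradient (fun t => f (c + ⟪t, x⟫)) v = deriv f (c + ⟪v, x⟫) • x := by
  rcases eq_or_ne x 0 with rfl | hx
  · simp
  have hL : HasFDerivAt (fun t : E => c + ⟪t, x⟫) (innerSL ℝ x) v := by
    have := (innerSL ℝ x).hasFDerivAt (x := v) |>.const_add c
    simpa [real_inner_comm] using this
  by_cases hf : DifferentiableAt ℝ f (c + ⟪v, x⟫)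
  · have h := hf.hasDerivAt.comp_hasFDerivAt v hL
    have h2 : gradient (fun t => f (c + ⟪t, x⟫)) v =
        (InnerProductSpace.toDual ℝ E).symm (deriv f (c + ⟪v, x⟫) • innerSL ℝ x) := by
      rw [gradient]
      congr 1
      exact h.fderiv
    rw [h2, map_smul]
    congr 1
    exact (InnerProductSpace.toDual ℝ E).symm_apply_apply x
  -- Both sides take the default value zero: the line through `v` in the direction `x ≠ 0` recovers
  -- `f`, so differentiability of the composite would pass to `f`. Thanks to this case the score
  -- formulas need no admissibility.
  · rw [deriv_zero_of_not_differentiableAt hf, zero_smul]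
    refine gradient_eq_zero_of_not_differentiableAt fun hd => hf ?_
    have hxx : ⟪x, x⟫ ≠ 0 := inner_self_ne_zero.2 hx
    have hk : HasDerivAt (fun s : ℝ => v + ((s - (c + ⟪v, x⟫)) / ⟪x, x⟫) • x) ((1 / ⟪x, x⟫) • x)
        (c + ⟪v, x⟫) :=
      ((((hasDerivAt_id _).sub_const _).div_const _).smul_const x).const_add v
    have hd' : DifferentiableAt ℝ (fun t => f (c + ⟪t, x⟫))
        (v + ((c + ⟪v, x⟫ - (c + ⟪v, x⟫)) / ⟪x, x⟫) • x) := by simpa using hd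
    have h := hd'.comp (c + ⟪v, x⟫) hk.differentiableAt
    refine h.congr_of_eventuallyEq (Eventually.of_forall fun s => ?_)
    simp only [Function.comp_apply, inner_add_left, real_inner_smul_left]
    congr 1
    field_simp
    ring

namespace GLM

variable (M : GLM) {p : ℕ}

lemma gradient_mu0 (v x : Vec p) :
    gradient (fun t => M.mu0 t x) v = deriv M.meanAt (eta0 v x) • x := by
  have := gradient_comp_add_inner M.meanAt 0 x v
  simpa [mu0, eta0] using this

lemma eta1_eq (β θ x : Vec p) : eta1 β θ x = eta0 (θ + β) x := by
  rw [eta1, eta0, inner_add_left]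

lemma gradient_mu1_left (β θ x : Vec p) :
    gradient (fun t => M.mu1 t θ x) β = deriv M.meanAt (eta0 (θ + β) x) • x := by
  have := gradient_comp_add_inner M.meanAt ⟪θ, x⟫ x β
  simpa [mu1, eta0, eta1, inner_add_left] using this

lemma gradient_mu1_right (β θ x : Vec p) :
    gradient (fun t => M.mu1 β t x) θ = deriv M.meanAt (eta0 (θ + β) x) • x := by
  have := gradient_comp_add_inner M.meanAt ⟪β, x⟫ x θ
  simpa [mu1, eta0, eta1, inner_add_left, add_comm] using this

lemma score0_eq (v x : Vec p) (y : ℝ) : M.score0 v x y = M.etaScore (eta0 v x) y • x := by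
  rw [score0, gradient_mu0, smul_smul]
  rfl

lemma score1_eq (β θ x : Vec p) (y : ℝ) :
    M.score1 β θ x y = M.etaScore (eta0 (θ + β) x) y • x := by
  rw [score1, gradient_mu1_left, smul_smul, mu1, eta1_eq]
  rfl

lemma info0_apply (P : Measure (Vec p)) (v : Vec p) (i j : Fin (p + 1)) :
    M.info0 P v i j = ∫ x, M.etaInfo (eta0 v x) * (x i * x j) ∂P := by
  simp only [info0, Matrix.of_apply, gradient_mu0, PiLp.smul_apply, smul_eq_mul]
  congr 1
  ext x
  rw [etaInfo, sensitivity]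
  ring

/-- Both gradients equal `meanAt'` times `x`, because `θ` and `β` enter only through `θ + β`. -/
lemma info1_eq (P : Measure (Vec p)) (β θ : Vec p) : M.info1 P β θ = M.info0 P (θ + β) := by
  ext i j
  simp only [info0_apply, info1, Matrix.of_apply, gradient_mu1_left, gradient_mu1_right,
    PiLp.smul_apply, smul_eq_mul]
  congr 1
  ext x
  rw [etaInfo, sensitivity, eta1_eq]
  ring

lemma continuous_eta0 (x : Vec p) : Continuous fun v => eta0 v x := by
  unfold eta0; fun_prop

lemma measurable_eta0 (v : Vec p) : Measurable fun x => eta0 v x := by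
  unfold eta0; fun_prop

lemma abs_eta0_le (v x : Vec p) : |eta0 v x| ≤ ‖v‖ * ‖x‖ := abs_real_inner_le_norm v x

lemma eta0_add (v u x : Vec p) : eta0 (v + u) x = eta0 v x + eta0 u x := inner_add_left v u x

lemma eta0_sub (v u x : Vec p) : eta0 (v - u) x = eta0 v x - eta0 u x := inner_sub_left v u x

lemma eta0_smul (c : ℝ) (v x : Vec p) : eta0 (c • v) x = c * eta0 v x :=
  real_inner_smul_left v x c

lemma hasFDerivAt_score0 (hM : M.Nondegenerate) {v x : Vec p}
    (hη : eta0 v x ∈ M.predictorRange) (y : ℝ) :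
    HasFDerivAt (fun t => M.score0 t x y)
      ((M.etaHess (eta0 v x) y • innerSL ℝ x).smulRight x) v := by
  simp_rw [score0_eq]
  have hL : HasFDerivAt (fun t : Vec p => eta0 t x) (innerSL ℝ x) v := by
    have := (innerSL ℝ x).hasFDerivAt (x := v)
    simpa [real_inner_comm, eta0] using this
  exact ((M.hasDerivAt_etaScore hM hη y).comp_hasFDerivAt v hL).smul_const x

lemma enorm_fderiv_score0 (hM : M.Nondegenerate) {v x : Vec p}
    (hη : eta0 v x ∈ M.predictorRange) (y : ℝ) :
    ‖fderiv ℝ (fun t => M.score0 t x y) v‖ₑ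
      = ENNReal.ofReal (|M.etaHess (eta0 v x) y| * ‖x‖ ^ 2) := by
  rw [(M.hasFDerivAt_score0 hM hη y).fderiv, ← ofReal_norm, ContinuousLinearMap.norm_smulRight_apply,
    norm_smul, innerSL_apply_norm, Real.norm_eq_abs]
  congr 1
  ring

/-- If `ν` sits at one point, all variances vanish, division by zero makes every entry of the
information zero, and a zero matrix of size `p + 1 ≥ 1` is singular. -/
lemma nondegenerate_of_info0 {P : Measure (Vec p)} [IsProbabilityMeasure P] {v : Vec p}
    (hv : ∀ᵐ x ∂P, eta0 v x ∈ M.predictorRange) (hI : (M.info0 P v).det ≠ 0) :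
    M.Nondegenerate := by
  intro c hc
  refine hI ?_
  have h0 : M.info0 P v = 0 := by
    ext i j
    rw [info0_apply, Matrix.zero_apply]
    refine integral_eq_zero_of_ae ?_
    filter_upwards [hv] with x hx
    have := M.isProbabilityMeasure_law (M.canon_mem hx)
    have h1 : (fun y : ℝ => y) =ᵐ[M.law (M.canon (eta0 v x))] fun _ => c := (M.ae_law_iff _).2 hc
    have h2 : M.varAt (eta0 v x) = 0 := by
      rw [varAt, ExpFamily.var, variance_congr h1, variance_eq_integral aemeasurable_const]
      simp
    simp [etaInfo, sensitivity, h2]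
  rw [h0]
  exact Matrix.det_zero

/-! ### The joint law of one covariate and response. -/

section ArmLaw

variable (P : Measure (Vec p))

lemma measurable_armDensity (hM : M.Nondegenerate) (v : Vec p) :
    Measurable fun z : Vec p × ℝ => M.density (M.canon (eta0 v z.1)) z.2 :=
  (M.measurable_density_canon hM).comp (((measurable_eta0 v).comp measurable_fst).prodMk
    measurable_snd)

lemma lintegral_armLaw [SFinite P] (hM : M.Nondegenerate) (v : Vec p) {f : Vec p × ℝ → ℝ≥0∞}
    (hf : Measurable f) :
    ∫⁻ z, f z ∂(M.armLaw P (eta0 v))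
      = ∫⁻ x, ∫⁻ y, f (x, y) ∂(M.law (M.canon (eta0 v x))) ∂P := by
  have hd := (M.measurable_armDensity hM v).ennreal_ofReal
  rw [armLaw, lintegral_withDensity_eq_lintegral_mul _ hd hf,
    lintegral_prod _ (hd.mul hf).aemeasurable]
  simp_rw [ExpFamily.lintegral_law]
  rfl

lemma integral_armLaw [SFinite P] {E : Type*} [NormedAddCommGroup E] [NormedSpace ℝ E]
    (hM : M.Nondegenerate) (v : Vec p) {f : Vec p × ℝ → E}
    (hf : Integrable f (M.armLaw P (eta0 v))) :
    ∫ z, f z ∂(M.armLaw P (eta0 v))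
      = ∫ x, ∫ y, f (x, y) ∂(M.law (M.canon (eta0 v x))) ∂P := by
  have hd := (M.measurable_armDensity hM v).ennreal_ofReal
  have hlt : ∀ᵐ z ∂(P.prod M.ν), ENNReal.ofReal (M.density (M.canon (eta0 v z.1)) z.2) < ⊤ :=
    ae_of_all _ fun _ => ENNReal.ofReal_lt_top
  rw [armLaw, integrable_withDensity_iff_integrable_smul' hd hlt] at hf
  rw [armLaw, integral_withDensity_eq_integral_toReal_smul hd hlt, integral_prod _ hf]
  simp_rw [ExpFamily.integral_law, ENNReal.toReal_ofReal (M.density_pos _ _).le]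

lemma isProbabilityMeasure_armLaw [IsProbabilityMeasure P] (hM : M.Nondegenerate) {v : Vec p}
    (hv : ∀ᵐ x ∂P, eta0 v x ∈ M.predictorRange) :
    IsProbabilityMeasure (M.armLaw P (eta0 v)) := by
  refine ⟨?_⟩
  rw [← setLIntegral_one, Measure.restrict_univ, M.lintegral_armLaw P hM v measurable_const]
  have : ∀ᵐ x ∂P, ∫⁻ _, 1 ∂(M.law (M.canon (eta0 v x))) = 1 := by
    filter_upwards [hv] with x hx
    have := M.isProbabilityMeasure_law (M.canon_mem hx)
    simp
  rw [lintegral_congr_ae this]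
  simp

lemma ae_armLaw_fst (v : Vec p) {q : Vec p → Prop} (hq : ∀ᵐ x ∂P, q x) :
    ∀ᵐ z ∂(M.armLaw P (eta0 v)), q z.1 :=
  (withDensity_absolutelyContinuous _ _).ae_le (Measure.quasiMeasurePreserving_fst.ae hq)

end ArmLaw

/-- What is used of the local regularity of a regression model at `v₀`. -/
structure RegularOn (P : Measure (Vec p)) (v₀ : Vec p) (ε : ℝ) (F : Vec p → ℝ) : Prop where
  pos : 0 < ε
  integrable : Integrable F P
  mem : ∀ᵐ x ∂P, ∀ v ∈ Metric.ball v₀ ε, eta0 v x ∈ M.predictorRange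
  info_le : ∀ᵐ x ∂P, ∀ v ∈ Metric.ball v₀ ε, M.etaInfo (eta0 v x) * ‖x‖ ^ 2 ≤ F x
  hess_le : ∀ᵐ x ∂P, ∀ v ∈ Metric.ball v₀ ε,
    ∫⁻ y, (⨆ u ∈ Metric.ball v₀ ε, ENNReal.ofReal (|M.etaHess (eta0 u x) y| * ‖x‖ ^ 2))
      ∂(M.law (M.canon (eta0 v x))) ≤ ENNReal.ofReal (F x)

/-- The bound on the derivative of the score also controls the information, since `etaInfo` is minus
the mean of `etaHess`. Taking `|F|` as the majorant handles the points where `F` is negative and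
`ENNReal.ofReal` truncates it. -/
lemma LocallyRegular.exists_regularOn {M : GLM} (hM : M.Nondegenerate) {P : Measure (Vec p)}
    {v₀ : Vec p} (h : M.LocallyRegular P v₀) : ∃ ε F, M.RegularOn P v₀ ε F := by
  obtain ⟨ε, hε, F, hF, hae⟩ := h
  have key : ∀ᵐ x ∂P, ∀ v ∈ Metric.ball v₀ ε,
    ∫⁻ y, (⨆ u ∈ Metric.ball v₀ ε, ENNReal.ofReal (|M.etaHess (eta0 u x) y| * ‖x‖ ^ 2))
      ∂(M.law (M.canon (eta0 v x))) ≤ ENNReal.ofReal (F x) := by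
    filter_upwards [hae] with x hx v hv
    refine le_trans (lintegral_mono fun y => ?_) (hx v hv).2
    refine iSup₂_mono fun u hu => ?_
    rw [M.enorm_fderiv_score0 hM (hx u hu).1]
  refine ⟨ε, fun x => |F x|, hε, hF.abs, ?_, ?_, ?_⟩
  · filter_upwards [hae] with x hx v hv using (hx v hv).1
  · filter_upwards [hae, key] with x hx hk v hv
    have hm := (hx v hv).1
    have h1 : ENNReal.ofReal (M.etaInfo (eta0 v x) * ‖x‖ ^ 2) ≤ ENNReal.ofReal (F x) := by
      refine le_trans ?_ (hk v hv)
      have h2 : ENNReal.ofReal (M.etaInfo (eta0 v x) * ‖x‖ ^ 2)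
          = ‖∫ y, M.etaHess (eta0 v x) y * ‖x‖ ^ 2 ∂(M.law (M.canon (eta0 v x)))‖ₑ := by
        rw [integral_mul_const, M.integral_etaHess hm, ← ofReal_norm, Real.norm_eq_abs, abs_mul,
          abs_neg, abs_of_pos (M.etaInfo_pos hM hm), abs_of_nonneg (by positivity)]
      rw [h2]
      refine (enorm_integral_le_lintegral_enorm _).trans (lintegral_mono fun y => ?_)
      refine le_trans (le_of_eq ?_) (le_iSup₂_of_le v hv le_rfl)
      rw [← ofReal_norm, Real.norm_eq_abs, abs_mul, abs_of_nonneg (sq_nonneg ‖x‖)]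
    rcases le_total 0 (F x) with h0 | h0
    · exact ((ENNReal.ofReal_le_ofReal_iff h0).1 h1).trans (le_abs_self _)
    · rw [ENNReal.ofReal_of_nonpos h0, nonpos_iff_eq_zero, ENNReal.ofReal_eq_zero] at h1
      exact h1.trans (abs_nonneg _)
  · filter_upwards [key] with x hk v hv
    exact (hk v hv).trans (ENNReal.ofReal_le_ofReal (le_abs_self _))

end GLM

/-! ### Filters along which inner products converge in the extended reals. -/

section InnerLimits

variable {E : Type*} [NormedAddCommGroup E] [InnerProductSpace ℝ E] [FiniteDimensional ℝ E]

/-- Every ultrafilter on a Euclidean space is finer than a countably generated filter along which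
the inner products with all vectors of a given subspace converge in the extended reals. -/
lemma exists_filter_tendsto_inner_of_mem (U : Ultrafilter E) (n : ℕ) (W : Submodule ℝ E)
    (hn : Module.finrank ℝ W ≤ n) :
    ∃ L : Filter E, L.IsCountablyGenerated ∧ ↑U ≤ L ∧
      ∀ x ∈ W, ∃ l : EReal, Tendsto (fun θ => ((⟪θ, x⟫ : ℝ) : EReal)) L (𝓝 l) := by
  induction n generalizing W with
  | zero =>
    refine ⟨⊤, inferInstance, le_top, fun x hx => ⟨0, ?_⟩⟩
    have hW : W = ⊥ := Submodule.finrank_eq_zero.1 (Nat.le_zero.1 hn)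
    rw [hW, Submodule.mem_bot] at hx
    simp [hx]
  | succ n ih =>
    -- Polar coordinates on `W`: directions live in a compact set and lengths in the compact space
    -- `EReal`. Where the projection vanishes, so does `dir`, as `0⁻¹ = 0`.
    set dir : E → E := fun θ => ‖W.starProjection θ‖⁻¹ • W.starProjection θ with hdir
    have hinner : ∀ θ, ∀ x ∈ W, ((⟪θ, x⟫ : ℝ) : EReal)
        = ((‖W.starProjection θ‖ : ℝ) : EReal) * ((⟪dir θ, x⟫ : ℝ) : EReal) := by
      intro θ x hx
      have h1 : ⟪θ, x⟫ = ⟪W.starProjection θ, x⟫ := by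
        have := W.starProjection_inner_eq_zero θ x hx
        rwa [inner_sub_left, sub_eq_zero] at this
      rw [h1, ← EReal.coe_mul, hdir]
      congr 1
      rcases eq_or_ne (W.starProjection θ) 0 with h0 | h0
      · simp [h0]
      · rw [real_inner_smul_left, ← mul_assoc, mul_inv_cancel₀ (norm_ne_zero_iff.2 h0), one_mul]
    have hcpt : IsCompact (Metric.closedBall (0 : E) 1 ∩ (W : Set E)) :=
      (isCompact_closedBall 0 1).inter_right W.closed_of_finiteDimensional
    obtain ⟨u, hu, hUu⟩ := hcpt.ultrafilter_le_nhds (U.map dir) (by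
      rw [le_principal_iff, Ultrafilter.mem_coe, Ultrafilter.mem_map]
      refine Filter.univ_mem' fun θ => ⟨?_, W.smul_mem _ (W.starProjection_apply_mem θ)⟩
      rw [mem_closedBall_zero_iff, hdir, norm_smul, norm_inv, norm_norm]
      exact inv_mul_le_one)
    obtain ⟨r, -, hUr⟩ := (isCompact_univ : IsCompact (Set.univ : Set EReal)).ultrafilter_le_nhds
      (U.map fun θ => ((‖W.starProjection θ‖ : ℝ) : EReal)) (by simp)
    have hUu' : ↑U ≤ comap dir (𝓝 u) := map_le_iff_le_comap.1 hUu
    have hUr' : ↑U ≤ comap (fun θ => ((‖W.starProjection θ‖ : ℝ) : EReal)) (𝓝 r) :=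
      map_le_iff_le_comap.1 hUr
    have hdirx : ∀ x, Tendsto (fun θ => ((⟪dir θ, x⟫ : ℝ) : EReal)) (comap dir (𝓝 u))
        (𝓝 ((⟪u, x⟫ : ℝ) : EReal)) := fun x =>
      (continuous_coe_real_ereal.tendsto _).comp
        (((by fun_prop : Continuous fun t : E => ⟪t, x⟫).tendsto u).comp tendsto_comap)
    have hne : ∀ x ∈ W, ⟪u, x⟫ ≠ 0 → ∃ l : EReal, Tendsto (fun θ => ((⟪θ, x⟫ : ℝ) : EReal))
        (comap dir (𝓝 u) ⊓ comap (fun θ => ((‖W.starProjection θ‖ : ℝ) : EReal)) (𝓝 r)) (𝓝 l) := by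
      intro x hx hux
      -- Multiplication in `EReal` is continuous here even for `r = ⊤`, because the other factor is
      -- finite and non-zero.
      refine ⟨r * ((⟪u, x⟫ : ℝ) : EReal), ?_⟩
      have hcont : ContinuousAt (fun q : EReal × EReal => q.1 * q.2)
          (r, ((⟪u, x⟫ : ℝ) : EReal)) := by
        refine EReal.continuousAt_mul ?_ ?_ ?_ ?_
        · exact Or.inr (EReal.coe_ne_bot _)
        · exact Or.inr (EReal.coe_ne_top _)
        · exact Or.inr (by simpa using hux)
        · exact Or.inr (by simpa using hux)
      refine (hcont.tendsto.comp (((tendsto_comap (f := fun θ =>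
        ((‖W.starProjection θ‖ : ℝ) : EReal))).mono_left inf_le_right).prodMk_nhds
        ((hdirx x).mono_left inf_le_left))).congr fun θ => ?_
      exact (hinner θ x hx).symm
    -- A direction has norm one or zero, so the limit zero means that the projections eventually
    -- vanish.
    by_cases hu0 : u = 0
    · refine ⟨comap dir (𝓝 u), inferInstance, hUu', fun x hx => ⟨0, ?_⟩⟩
      refine Tendsto.congr' ?_ tendsto_const_nhds
      have hev : ∀ᶠ θ in comap dir (𝓝 u), ‖dir θ‖ < 1 := by
        have : Tendsto (fun θ => ‖dir θ‖) (comap dir (𝓝 u)) (𝓝 ‖u‖) :=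
          (continuous_norm.tendsto u).comp tendsto_comap
        refine this.eventually_lt_const ?_
        simp [hu0]
      filter_upwards [hev] with θ hθ
      rw [hinner θ x hx]
      rcases eq_or_ne (W.starProjection θ) 0 with h0 | h0
      · simp [h0]
      · rw [hdir, norm_smul, norm_inv, norm_norm, inv_mul_cancel₀ (norm_ne_zero_iff.2 h0)] at hθ
        exact absurd hθ (lt_irrefl _)
    -- Only vectors of `W` orthogonal to the limit direction remain undecided; they form a smaller
    -- subspace, left to the induction.
    · set W' := W ⊓ (Submodule.span ℝ {u})ᗮ with hW'
      have hlt : W' < W := by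
        refine lt_of_le_of_ne inf_le_left fun h => ?_
        have h1 : u ∈ W' := by rw [h]; exact hu.2
        have h2 := (Submodule.mem_orthogonal_singleton_iff_inner_right.1 h1.2)
        exact hu0 (inner_self_eq_zero.1 h2)
      have hfin : Module.finrank ℝ W' ≤ n := by
        have := Submodule.finrank_lt_finrank_of_lt hlt
        omega
      obtain ⟨L, hLc, hUL, hL⟩ := ih W' hfin
      refine ⟨L ⊓ (comap dir (𝓝 u) ⊓
        comap (fun θ => ((‖W.starProjection θ‖ : ℝ) : EReal)) (𝓝 r)), inferInstance,
        le_inf hUL (le_inf hUu' hUr'), fun x hx => ?_⟩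
      by_cases hux : ⟪u, x⟫ = 0
      · obtain ⟨l, hl⟩ := hL x ⟨hx, Submodule.mem_orthogonal_singleton_iff_inner_right.2 hux⟩
        exact ⟨l, hl.mono_left inf_le_left⟩
      · obtain ⟨l, hl⟩ := hne x hx hux
        exact ⟨l, hl.mono_left inf_le_right⟩

lemma exists_filter_tendsto_inner (U : Ultrafilter E) :
    ∃ L : Filter E, L.IsCountablyGenerated ∧ ↑U ≤ L ∧
      ∀ x, ∃ l : EReal, Tendsto (fun θ => ((⟪θ, x⟫ : ℝ) : EReal)) L (𝓝 l) := by
  obtain ⟨L, h1, h2, h3⟩ := exists_filter_tendsto_inner_of_mem U _ ⊤ le_rfl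
  exact ⟨L, h1, h2, fun x => h3 x trivial⟩

end InnerLimits

/-! ### Limits of eventually monotone functions. -/

section EventuallyMonotone

variable {α : Type*} [LinearOrder α]

lemma exists_tendsto_atTop_of_monotoneOn [Nonempty α] {f : α → ℝ≥0∞} {a : α}
    (hf : MonotoneOn f (Set.Ici a)) : ∃ l, Tendsto f atTop (𝓝 l) := by
  have hm : Monotone fun x => f (max a x) := fun x y hxy =>
    hf (le_max_left a x) (le_max_left a y) (max_le_max le_rfl hxy)
  refine ⟨_, (tendsto_atTop_iSup hm).congr' ?_⟩
  filter_upwards [eventually_ge_atTop a] with x hx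
  rw [max_eq_right hx]

lemma exists_tendsto_atTop_of_antitoneOn [Nonempty α] {f : α → ℝ≥0∞} {a : α}
    (hf : AntitoneOn f (Set.Ici a)) : ∃ l, Tendsto f atTop (𝓝 l) := by
  have hm : Antitone fun x => f (max a x) := fun x y hxy =>
    hf (le_max_left a x) (le_max_left a y) (max_le_max le_rfl hxy)
  refine ⟨_, (tendsto_atTop_iInf hm).congr' ?_⟩
  filter_upwards [eventually_ge_atTop a] with x hx
  rw [max_eq_right hx]

lemma exists_tendsto_atBot_of_monotoneOn [Nonempty α] {f : α → ℝ≥0∞} {a : α}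
    (hf : MonotoneOn f (Set.Iic a)) : ∃ l, Tendsto f atBot (𝓝 l) := by
  have hm : Monotone fun x => f (min a x) := fun x y hxy =>
    hf (min_le_left a x) (min_le_left a y) (min_le_min le_rfl hxy)
  refine ⟨_, (tendsto_atBot_iInf hm).congr' ?_⟩
  filter_upwards [eventually_le_atBot a] with x hx
  rw [min_eq_right hx]

lemma exists_tendsto_atBot_of_antitoneOn [Nonempty α] {f : α → ℝ≥0∞} {a : α}
    (hf : AntitoneOn f (Set.Iic a)) : ∃ l, Tendsto f atBot (𝓝 l) := by
  have hm : Antitone fun x => f (min a x) := fun x y hxy =>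
    hf (min_le_left a x) (min_le_left a y) (min_le_min le_rfl hxy)
  refine ⟨_, (tendsto_atBot_iSup hm).congr' ?_⟩
  filter_upwards [eventually_le_atBot a] with x hx
  rw [min_eq_right hx]

end EventuallyMonotone

/-! ### Root likelihood ratios and the Hellinger affinity. -/

namespace ExpFamily

variable (M : ExpFamily)

/-- The square root of the likelihood ratio of `γ` to `γ₀`. -/
def rootRatio (γ₀ γ y : ℝ) : ℝ :=
  Real.exp ((y * (γ - γ₀) - (M.b γ - M.b γ₀)) / (2 * M.a))

lemma rootRatio_pos (γ₀ γ y : ℝ) : 0 < M.rootRatio γ₀ γ y := Real.exp_pos _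

lemma rootRatio_eq (γ₀ γ y : ℝ) :
    M.rootRatio γ₀ γ y = Real.exp ((M.logDensity γ y - M.logDensity γ₀ y) / 2) := by
  rw [rootRatio, logDensity, logDensity]
  congr 1
  have := M.a_pos.ne'
  field_simp
  ring

lemma density_mul_rootRatio_sq (γ₀ γ y : ℝ) :
    M.density γ₀ y * M.rootRatio γ₀ γ y ^ 2 = M.density γ y := by
  rw [rootRatio_eq, density, density, ← Real.exp_nat_mul, ← Real.exp_add]
  congr 1
  push_cast
  ring

lemma measurable_rootRatio (γ₀ γ : ℝ) : Measurable (M.rootRatio γ₀ γ) := by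
  unfold rootRatio; fun_prop

lemma lintegral_rootRatio_sq {γ₀ γ : ℝ} (hγ : γ ∈ M.Γ) :
    ∫⁻ y, ENNReal.ofReal (M.rootRatio γ₀ γ y) ^ 2 ∂(M.law γ₀) = 1 := by
  rw [lintegral_law]
  simp_rw [← ENNReal.ofReal_pow (M.rootRatio_pos γ₀ γ _).le,
    ← ENNReal.ofReal_mul (M.density_pos γ₀ _).le, density_mul_rootRatio_sq]
  exact M.lintegral_density γ hγ

lemma two_mul_le_one_add_sq (s : ℝ≥0∞) : 2 * s ≤ 1 + s ^ 2 := by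
  induction s with
  | top => simp
  | coe s =>
    have h : 2 * s ≤ 1 + s ^ 2 := by
      have := two_mul_le_add_sq (1 : ℝ) (s : ℝ)
      exact_mod_cast (by simpa using this : 2 * (s : ℝ) ≤ 1 + (s : ℝ) ^ 2)
    exact_mod_cast h

lemma eq_one_of_one_add_sq_le {s : ℝ≥0∞} (hs : 1 + s ^ 2 ≤ 2 * s) (htop : s ≠ ⊤) : s = 1 := by
  lift s to NNReal using htop
  have h : 1 + s ^ 2 ≤ 2 * s := by exact_mod_cast hs
  have h' : 1 + (s : ℝ) ^ 2 ≤ 2 * s := by exact_mod_cast h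
  have : (s : ℝ) = 1 := by nlinarith [sq_nonneg ((s : ℝ) - 1)]
  exact_mod_cast this

/-- The Hellinger affinity with a limit of members of the family is at most one. -/
lemma lintegral_limit_rootRatio_le_one {𝓖 : Filter ℝ} [𝓖.NeBot] [𝓖.IsCountablyGenerated]
    (h𝓖 : ∀ᶠ γ in 𝓖, γ ∈ M.Γ) {γ₀ : ℝ} (hγ₀ : γ₀ ∈ M.Γ) {H : ℝ → ℝ≥0∞}
    (hH : ∀ y, Tendsto (fun γ => ENNReal.ofReal (M.rootRatio γ₀ γ y)) 𝓖 (𝓝 (H y))) :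
    ∫⁻ y, H y ∂(M.law γ₀) ≤ 1 ∧ (M.Nondegenerate → ∫⁻ y, H y ∂(M.law γ₀) = 1 → 𝓖 ≤ 𝓝 γ₀) := by
  have hprob := M.isProbabilityMeasure_law hγ₀
  -- A sequence along `𝓖` makes `H` measurable and lets Fatou's lemma give `∫ H² ≤ 1`; the bound on
  -- `∫ H` follows from `2 H ≤ 1 + H²`.
  obtain ⟨t, ht⟩ := exists_seq_tendsto 𝓖
  have hHt : ∀ y, Tendsto (fun n => ENNReal.ofReal (M.rootRatio γ₀ (t n) y)) atTop (𝓝 (H y)) :=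
    fun y => (hH y).comp ht
  have hHm : Measurable H := measurable_of_tendsto_metrizable
    (fun n => (M.measurable_rootRatio γ₀ (t n)).ennreal_ofReal) (tendsto_pi_nhds.2 hHt)
  have hsq : ∫⁻ y, H y ^ 2 ∂(M.law γ₀) ≤ 1 := by
    have h1 : ∀ y, H y ^ 2 = liminf (fun n => ENNReal.ofReal (M.rootRatio γ₀ (t n) y) ^ 2) atTop :=
      fun y => ((ENNReal.continuous_pow 2).tendsto _ |>.comp (hHt y)).liminf_eq.symm
    simp_rw [h1]
    refine (lintegral_liminf_le fun n =>
      ((M.measurable_rootRatio γ₀ (t n)).ennreal_ofReal.pow_const 2)).trans ?_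
    refine liminf_le_of_frequently_le' (Eventually.frequently ?_)
    filter_upwards [ht.eventually h𝓖] with n hn
    rw [M.lintegral_rootRatio_sq hn]
  have htwo : ∫⁻ y, 2 * H y ∂(M.law γ₀) = 2 * ∫⁻ y, H y ∂(M.law γ₀) :=
    lintegral_const_mul _ hHm
  have hone : ∫⁻ y, (1 + H y ^ 2) ∂(M.law γ₀) ≤ 2 := by
    rw [lintegral_add_left measurable_const]
    simp only [lintegral_const, measure_univ, mul_one]
    calc 1 + ∫⁻ y, H y ^ 2 ∂(M.law γ₀) ≤ 1 + 1 := by gcongr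
      _ = 2 := one_add_one_eq_two
  have hle : ∫⁻ y, H y ∂(M.law γ₀) ≤ 1 := by
    have h2 : 2 * ∫⁻ y, H y ∂(M.law γ₀) ≤ 2 * 1 := by
      rw [← htwo, mul_one]
      exact (lintegral_mono fun y => two_mul_le_one_add_sq _).trans hone
    exact (ENNReal.mul_le_mul_iff_right (by norm_num) (by norm_num)).1 h2
  refine ⟨hle, fun hM h1 => ?_⟩
  -- Equality of the integrals forces equality almost everywhere in `2 H ≤ 1 + H²`, hence `H = 1`.
  have hae : (fun y => 2 * H y) =ᵐ[M.law γ₀] fun y => 1 + H y ^ 2 := by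
    refine ae_eq_of_ae_le_of_lintegral_le (ae_of_all _ fun y => two_mul_le_one_add_sq _) ?_
      (measurable_const.add (hHm.pow_const 2)).aemeasurable ?_
    · rw [htwo, h1]; norm_num
    · rw [htwo, h1, mul_one]; exact hone
  have hfin : ∀ᵐ y ∂(M.law γ₀), H y < ⊤ := ae_lt_top hHm (by rw [h1]; norm_num)
  have hH1 : ∀ᵐ y ∂M.ν, H y = 1 := by
    rw [← M.ae_law_iff γ₀]
    filter_upwards [hae, hfin] with y h2 h3
    exact eq_one_of_one_add_sq_le h2.symm.le h3.ne
  -- The log ratio is `y (γ - γ₀)` minus a term free of `y`, up to a factor. Two distinct responses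
  -- with `H = 1`, available by nondegeneracy, eliminate that term and give `γ → γ₀`.
  obtain ⟨y₁, hy₁⟩ : ∃ y, H y = 1 := by
    by_contra! hcon
    refine hM 0 ?_
    filter_upwards [hH1] with y hy using absurd hy (hcon y)
  obtain ⟨y₂, hy₂, hne⟩ : ∃ y, H y = 1 ∧ y ≠ y₁ := by
    by_contra! hcon
    refine hM y₁ ?_
    filter_upwards [hH1] with y hy using hcon y hy
  have hlog : ∀ y, H y = 1 →
      Tendsto (fun γ => (y * (γ - γ₀) - (M.b γ - M.b γ₀)) / (2 * M.a)) 𝓖 (𝓝 0) := by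
    intro y hy
    have h2 := (ENNReal.tendsto_toReal (by rw [hy]; norm_num)).comp (hH y)
    rw [hy, ENNReal.toReal_one] at h2
    have h3 := (Real.continuousAt_log one_ne_zero).tendsto.comp h2
    rw [Real.log_one] at h3
    refine h3.congr fun γ => ?_
    simp only [Function.comp_apply]
    rw [ENNReal.toReal_ofReal (M.rootRatio_pos _ _ _).le, rootRatio, Real.log_exp]
  have h4 := ((hlog y₂ hy₂).sub (hlog y₁ hy₁)).mul_const (2 * M.a / (y₂ - y₁))
  rw [sub_zero, zero_mul] at h4
  have h5 : Tendsto (fun γ => γ - γ₀) 𝓖 (𝓝 0) := by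
    refine h4.congr fun γ => ?_
    have := M.a_pos.ne'
    have := sub_ne_zero.2 hne
    field_simp
    ring
  have h6 : Tendsto (fun γ => γ) 𝓖 (𝓝 γ₀) := by simpa using h5.add_const γ₀
  exact h6

end ExpFamily

/-! ### A maximal inequality for families of monotone functions. -/

lemma lintegral_ne_top_of_tail {α : Type*} [MeasurableSpace α] {μ : Measure α}
    [IsProbabilityMeasure μ] {S : α → ℝ≥0∞} (hS : Measurable S)
    (htail : ∀ s : ℝ≥0∞, s ≠ 0 → s ≠ ⊤ → μ {y | s < S y} ≤ (s ^ 2)⁻¹) : ∫⁻ y, S y ∂μ ≤ 17 := by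
  -- Dyadic levels, halved so that `2 ^ k ≤ S y` gives a strict inequality. Level `k` contributes at
  -- most `2 ^ (k + 1) * 4 * 4⁻¹ ^ k = 8 * 2⁻¹ ^ k`; the series sums to 16, and 1 covers the region
  -- `S y ≤ 1`.
  set A : ℕ → Set α := fun k => {y | 2 ^ k / 2 < S y} with hA
  have hAm : ∀ k, MeasurableSet (A k) := fun k => measurableSet_lt measurable_const hS
  have hpt : ∀ y, S y ≤ 1 + ∑' k, (A k).indicator (fun _ => (2 : ℝ≥0∞) ^ (k + 1)) y := by
    intro y
    rcases le_or_gt (S y) 1 with h1 | h1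
    · exact h1.trans le_self_add
    · refine le_trans ?_ le_add_self
      rcases eq_or_ne (S y) ⊤ with htop | htop
      · have hin : ∀ k, y ∈ A k := fun k => by
          change 2 ^ k / 2 < S y
          rw [htop]
          exact ENNReal.div_lt_top (by simp) (by norm_num)
        simp only [Set.indicator_of_mem (hin _)]
        rw [htop, top_le_iff]
        refine top_le_iff.1 ((ENNReal.tsum_const_eq_top_of_ne_zero (α := ℕ) one_ne_zero).symm.le.trans
          (ENNReal.tsum_le_tsum fun k => one_le_pow₀ (by norm_num)))
      · have h1' : 1 ≤ (S y).toReal := by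
          rw [← ENNReal.toReal_one]
          exact ENNReal.toReal_mono htop h1.le
        obtain ⟨k, hk1, hk2⟩ := exists_nat_pow_near h1' (one_lt_two)
        have hk1' : (2 : ℝ≥0∞) ^ k ≤ S y := by
          rw [← ENNReal.ofReal_toReal htop, ← ENNReal.ofReal_ofNat,
            ← ENNReal.ofReal_pow (by norm_num)]
          exact ENNReal.ofReal_le_ofReal hk1
        have hk2' : S y ≤ (2 : ℝ≥0∞) ^ (k + 1) := by
          rw [← ENNReal.ofReal_toReal htop, ← ENNReal.ofReal_ofNat,
            ← ENNReal.ofReal_pow (by norm_num)]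
          exact ENNReal.ofReal_le_ofReal hk2.le
        refine le_trans ?_ (ENNReal.le_tsum k)
        rw [Set.indicator_of_mem]
        · exact hk2'
        · exact (ENNReal.half_lt_self (by simp) (by simp)).trans_le hk1'
  have hmu : ∀ k, 2 ^ (k + 1) * μ (A k) ≤ 8 * (2⁻¹ : ℝ≥0∞) ^ k := by
    intro k
    have h2 : (2 : ℝ≥0∞) ≠ 0 := by norm_num
    have h2' : (2 : ℝ≥0∞) ≠ ⊤ := by norm_num
    have hk0 : (2 : ℝ≥0∞) ^ k ≠ 0 := pow_ne_zero _ h2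
    have hkt : (2 : ℝ≥0∞) ^ k ≠ ⊤ := ENNReal.pow_ne_top h2'
    have h := htail (2 ^ k / 2) (ENNReal.div_ne_zero.2 ⟨hk0, h2'⟩) (ENNReal.div_ne_top hkt h2)
    have heq : ((2 : ℝ≥0∞) ^ k / 2)⁻¹ = 2 * 2⁻¹ ^ k := by
      rw [ENNReal.inv_div (Or.inl h2') (Or.inl h2), div_eq_mul_inv, ENNReal.inv_pow]
    calc 2 ^ (k + 1) * μ (A k) ≤ 2 ^ (k + 1) * (((2 : ℝ≥0∞) ^ k / 2) ^ 2)⁻¹ := by gcongr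
      _ = 2 ^ (k + 1) * (2 * 2⁻¹ ^ k) ^ 2 := by rw [← heq, ENNReal.inv_pow]
      _ = 8 * (2 ^ k * 2⁻¹ ^ k) * 2⁻¹ ^ k := by ring
      _ = 8 * 2⁻¹ ^ k := by
        rw [← mul_pow, ENNReal.mul_inv_cancel h2 h2', one_pow, mul_one]
  calc ∫⁻ y, S y ∂μ
      ≤ ∫⁻ y, (1 + ∑' k, (A k).indicator (fun _ => (2 : ℝ≥0∞) ^ (k + 1)) y) ∂μ :=
        lintegral_mono hpt
    _ = 1 + ∑' k, 2 ^ (k + 1) * μ (A k) := by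
        rw [lintegral_add_left measurable_const, lintegral_tsum fun k =>
          (measurable_const.indicator (hAm k)).aemeasurable]
        simp only [lintegral_const, measure_univ, mul_one, lintegral_indicator_const (hAm _)]
    _ ≤ 1 + ∑' k, 8 * (2⁻¹ : ℝ≥0∞) ^ k := add_le_add_right (ENNReal.tsum_le_tsum hmu) 1
    _ = 17 := by
        rw [ENNReal.tsum_mul_left, ENNReal.tsum_geometric, ENNReal.one_sub_inv_two, inv_inv]
        norm_num

/-- Superlevel sets of functions monotone in the same direction are nested, so the measure of their
union is the supremum of their measures. Chebyshev's bound for one function thus holds for the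
supremum without loss, and a tail `s⁻²` is integrable. -/
lemma lintegral_biSup_le_of_monotone {α ι : Type*} [MeasurableSpace α] [LinearOrder α]
    {μ : Measure α} [IsProbabilityMeasure μ] {T : Set ι} (hT : T.Countable) {f : ι → α → ℝ≥0∞}
    (hf : ∀ i ∈ T, Measurable (f i)) (hmono : (∀ i ∈ T, Monotone (f i)) ∨ (∀ i ∈ T, Antitone (f i)))
    (hint : ∀ i ∈ T, ∫⁻ y, f i y ^ 2 ∂μ ≤ 1) : ∫⁻ y, ⨆ i ∈ T, f i y ∂μ ≤ 17 := by
  refine lintegral_ne_top_of_tail (Measurable.biSup T hT hf) fun s hs0 hst => ?_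
  have hset : {y | s < ⨆ i ∈ T, f i y} = ⋃ i ∈ T, {y | s < f i y} := by
    ext y
    simp [lt_iSup_iff]
  have hdir : DirectedOn (Function.onFun (· ⊆ ·) fun i => {y | s < f i y}) T := by
    intro i hi j hj
    have htot : {y | s < f i y} ⊆ {y | s < f j y} ∨ {y | s < f j y} ⊆ {y | s < f i y} := by
      rcases hmono with hm | hm
      · have h1 : IsUpperSet {y | s < f i y} := fun a b hab ha => lt_of_lt_of_le ha (hm i hi hab)
        have h2 : IsUpperSet {y | s < f j y} := fun a b hab ha => lt_of_lt_of_le ha (hm j hj hab)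
        exact h1.total h2
      · have h1 : IsLowerSet {y | s < f i y} := fun a b hab ha => lt_of_lt_of_le ha (hm i hi hab)
        have h2 : IsLowerSet {y | s < f j y} := fun a b hab ha => lt_of_lt_of_le ha (hm j hj hab)
        exact h1.total h2
    rcases htot with h | h
    · exact ⟨j, hj, h, subset_rfl⟩
    · exact ⟨i, hi, subset_rfl, h⟩
  rw [hset, measure_biUnion_eq_iSup hT hdir]
  refine iSup₂_le fun i hi => ?_
  have hmk := mul_meas_ge_le_lintegral (μ := μ) ((hf i hi).pow_const 2) (s ^ 2)
  have hle : μ {y | s < f i y} ≤ μ {y | s ^ 2 ≤ f i y ^ 2} :=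
    measure_mono fun y hy => show s ^ 2 ≤ f i y ^ 2 from pow_le_pow_left' (le_of_lt hy) 2
  rw [ENNReal.le_inv_iff_mul_le, mul_comm]
  exact (mul_le_mul_right hle _).trans (hmk.trans (hint i hi))

/-! ### Envelopes of likelihood ratios and their limits at the ends of the parameter interval. -/

namespace ExpFamily

variable (M : ExpFamily)

/-- The ratio increases in `y` for parameters above `γ₀` and decreases for those below; each side
contributes 17. No compactness of the set of parameters is involved. -/
lemma lintegral_biSup_rootRatio_le {γ₀ : ℝ} (hγ₀ : γ₀ ∈ M.Γ) {ι : Type*} {T : Set ι}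
    (hT : T.Countable) {t : ι → ℝ} (ht : ∀ i ∈ T, t i ∈ M.Γ) :
    ∫⁻ y, ⨆ i ∈ T, ENNReal.ofReal (M.rootRatio γ₀ (t i) y) ∂(M.law γ₀) ≤ 34 := by
  have := M.isProbabilityMeasure_law hγ₀
  have hm : ∀ i, Measurable fun y => ENNReal.ofReal (M.rootRatio γ₀ (t i) y) := fun i =>
    (M.measurable_rootRatio γ₀ (t i)).ennreal_ofReal
  have hc1 : (T ∩ {i | γ₀ ≤ t i}).Countable := hT.mono Set.inter_subset_left
  have hc2 : (T ∩ {i | t i ≤ γ₀}).Countable := hT.mono Set.inter_subset_left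
  have hsplit : ∀ y, ⨆ i ∈ T, ENNReal.ofReal (M.rootRatio γ₀ (t i) y)
      ≤ (⨆ i ∈ T ∩ {i | γ₀ ≤ t i}, ENNReal.ofReal (M.rootRatio γ₀ (t i) y))
        + ⨆ i ∈ T ∩ {i | t i ≤ γ₀}, ENNReal.ofReal (M.rootRatio γ₀ (t i) y) := by
    intro y
    refine iSup₂_le fun i hi => ?_
    rcases le_total γ₀ (t i) with h | h
    · exact le_add_right (le_iSup₂_of_le i ⟨hi, h⟩ le_rfl)
    · exact le_add_left (le_iSup₂_of_le i ⟨hi, h⟩ le_rfl)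
  have ha := M.a_pos
  refine (lintegral_mono hsplit).trans ?_
  rw [lintegral_add_left (Measurable.biSup _ hc1 fun i _ => hm i)]
  have h1 := lintegral_biSup_le_of_monotone (μ := M.law γ₀) hc1 (fun i _ => hm i)
    (Or.inl fun i hi y z hyz => ENNReal.ofReal_le_ofReal (Real.exp_le_exp.2 (by
      have := sub_nonneg.2 (show γ₀ ≤ t i from hi.2)
      gcongr))) (fun i hi => (M.lintegral_rootRatio_sq (ht i hi.1)).le)
  have h2 := lintegral_biSup_le_of_monotone (μ := M.law γ₀) hc2 (fun i _ => hm i)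
    (Or.inr fun i hi y z hyz => ENNReal.ofReal_le_ofReal (Real.exp_le_exp.2 (by
      have := mul_le_mul_of_nonpos_right hyz (sub_nonpos.2 (show t i ≤ γ₀ from hi.2))
      gcongr))) (fun i hi => (M.lintegral_rootRatio_sq (ht i hi.1)).le)
  calc _ ≤ (17 : ℝ≥0∞) + 17 := add_le_add h1 h2
    _ = 34 := by norm_num

/-- The derivative in `γ` is `y - mean γ`. -/
lemma monotoneOn_exponent {y : ℝ} {s : Set ℝ} (hs : s.OrdConnected) (hsΓ : s ⊆ M.Γ)
    (h : ∀ γ ∈ s, M.mean γ ≤ y) : MonotoneOn (fun γ => y * γ - M.b γ) s := by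
  have hd : ∀ γ ∈ s, HasDerivAt (fun γ => y * γ - M.b γ) (y - M.mean γ) γ := fun γ hγ => by
    simpa only [id, mul_one] using ((hasDerivAt_id γ).const_mul y).fun_sub (M.hasDerivAt_b (hsΓ hγ))
  refine monotoneOn_of_deriv_nonneg hs.convex
    (fun γ hγ => (hd γ hγ).continuousAt.continuousWithinAt)
    (fun γ hγ => (hd γ (interior_subset hγ)).differentiableAt.differentiableWithinAt) fun γ hγ => ?_
  rw [(hd γ (interior_subset hγ)).deriv]
  exact sub_nonneg.2 (h γ (interior_subset hγ))

lemma antitoneOn_exponent {y : ℝ} {s : Set ℝ} (hs : s.OrdConnected) (hsΓ : s ⊆ M.Γ)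
    (h : ∀ γ ∈ s, y ≤ M.mean γ) : AntitoneOn (fun γ => y * γ - M.b γ) s := by
  have hd : ∀ γ ∈ s, HasDerivAt (fun γ => y * γ - M.b γ) (y - M.mean γ) γ := fun γ hγ => by
    simpa only [id, mul_one] using ((hasDerivAt_id γ).const_mul y).fun_sub (M.hasDerivAt_b (hsΓ hγ))
  refine antitoneOn_of_deriv_nonpos hs.convex
    (fun γ hγ => (hd γ hγ).continuousAt.continuousWithinAt)
    (fun γ hγ => (hd γ (interior_subset hγ)).differentiableAt.differentiableWithinAt) fun γ hγ => ?_
  rw [(hd γ (interior_subset hγ)).deriv]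
  exact sub_nonpos.2 (h γ (interior_subset hγ))

lemma rootRatio_le_rootRatio {γ₀ γ γ' y : ℝ} (h : y * γ - M.b γ ≤ y * γ' - M.b γ') :
    ENNReal.ofReal (M.rootRatio γ₀ γ y) ≤ ENNReal.ofReal (M.rootRatio γ₀ γ' y) := by
  have := M.a_pos
  refine ENNReal.ofReal_le_ofReal (Real.exp_le_exp.2 ?_)
  refine div_le_div_of_nonneg_right ?_ (by positivity)
  linarith

/-- A filter of canonical parameters along which the likelihood ratios at every response
converge. -/
structure IsLimitFilter (𝓖 : Filter ℝ) : Prop where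
  neBot : 𝓖.NeBot
  isCountablyGenerated : 𝓖.IsCountablyGenerated
  mem : ∀ᶠ γ in 𝓖, γ ∈ M.Γ
  exists_tendsto : ∀ γ₀ y, ∃ h, Tendsto (fun γ => ENNReal.ofReal (M.rootRatio γ₀ γ y)) 𝓖 (𝓝 h)

lemma isLimitFilter_nhds {γ : ℝ} (hγ : γ ∈ M.Γ) : M.IsLimitFilter (𝓝 γ) where
  neBot := inferInstance
  isCountablyGenerated := inferInstance
  mem := M.eventually_mem hγ
  exists_tendsto γ₀ y := ⟨ENNReal.ofReal (M.rootRatio γ₀ γ y), by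
    have hb := (M.hasDerivAt_b hγ).continuousAt
    have : ContinuousAt (fun γ => M.rootRatio γ₀ γ y) γ := by
      unfold rootRatio
      fun_prop
    exact (ENNReal.continuous_ofReal.tendsto _).comp this.tendsto⟩

/-- Convergence to the upper end of the parameter interval. -/
def upperEnd : Filter ℝ := map Subtype.val (atTop : Filter M.Γ)

/-- Convergence to the lower end of the parameter interval. -/
def lowerEnd : Filter ℝ := map Subtype.val (atBot : Filter M.Γ)

/-- If `y` is at least every mean, the ratio increases throughout; otherwise it decreases once the
mean has passed `y`. Eventual monotonicity gives a limit in `ℝ≥0∞`. -/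
lemma isLimitFilter_upperEnd (hM : M.Nondegenerate) (hne : M.Γ.Nonempty) :
    M.IsLimitFilter M.upperEnd := by
  have := hne.to_subtype
  have := M.ordConnected_Γ
  refine ⟨by unfold upperEnd; infer_instance, by unfold upperEnd; infer_instance,
    eventually_map.2 (Eventually.of_forall fun γ => γ.2), fun γ₀ y => ?_⟩
  simp only [upperEnd, tendsto_map'_iff]
  by_cases h : ∀ γ ∈ M.Γ, M.mean γ ≤ y
  · have hm := M.monotoneOn_exponent M.ordConnected_Γ subset_rfl h
    exact exists_tendsto_atTop_of_monotoneOn (a := ⟨hne.some, hne.some_mem⟩) fun s _ t _ hst =>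
      M.rootRatio_le_rootRatio (hm s.2 t.2 hst)
  · push Not at h
    obtain ⟨γ₁, hγ₁, hy⟩ := h
    have hm := M.antitoneOn_exponent (y := y) (s := M.Γ ∩ Set.Ici γ₁)
      (M.ordConnected_Γ.inter Set.ordConnected_Ici) Set.inter_subset_left fun γ hγ =>
        hy.le.trans ((M.strictMonoOn_mean hM).monotoneOn hγ₁ hγ.1 hγ.2)
    exact exists_tendsto_atTop_of_antitoneOn (a := ⟨γ₁, hγ₁⟩) fun s hs t ht hst =>
      M.rootRatio_le_rootRatio (hm ⟨s.2, hs⟩ ⟨t.2, ht⟩ hst)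

lemma isLimitFilter_lowerEnd (hM : M.Nondegenerate) (hne : M.Γ.Nonempty) :
    M.IsLimitFilter M.lowerEnd := by
  have := hne.to_subtype
  have := M.ordConnected_Γ
  refine ⟨by unfold lowerEnd; infer_instance, by unfold lowerEnd; infer_instance,
    eventually_map.2 (Eventually.of_forall fun γ => γ.2), fun γ₀ y => ?_⟩
  simp only [lowerEnd, tendsto_map'_iff]
  by_cases h : ∀ γ ∈ M.Γ, y ≤ M.mean γ
  · have hm := M.antitoneOn_exponent M.ordConnected_Γ subset_rfl h
    exact exists_tendsto_atBot_of_antitoneOn (a := ⟨hne.some, hne.some_mem⟩) fun s _ t _ hst =>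
      M.rootRatio_le_rootRatio (hm s.2 t.2 hst)
  · push Not at h
    obtain ⟨γ₁, hγ₁, hy⟩ := h
    have hm := M.monotoneOn_exponent (y := y) (s := M.Γ ∩ Set.Iic γ₁)
      (M.ordConnected_Γ.inter Set.ordConnected_Iic) Set.inter_subset_left fun γ hγ =>
        ((M.strictMonoOn_mean hM).monotoneOn hγ.1 hγ₁ hγ.2).trans hy.le
    exact exists_tendsto_atBot_of_monotoneOn (a := ⟨γ₁, hγ₁⟩) fun s hs t ht hst =>
      M.rootRatio_le_rootRatio (hm ⟨s.2, hs⟩ ⟨t.2, ht⟩ hst)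

lemma tendsto_upperEnd {α : Type*} {L : Filter α} {f : α → ℝ} (hne : M.Γ.Nonempty)
    (hf : ∀ᶠ i in L, f i ∈ M.Γ) (h : ∀ γ ∈ M.Γ, ∀ᶠ i in L, γ ≤ f i) :
    Tendsto f L M.upperEnd := by
  have := hne.to_subtype
  refine tendsto_def.2 fun s hs => ?_
  obtain ⟨γ, hγ⟩ := mem_atTop_sets.1 (mem_map.1 hs)
  filter_upwards [hf, h γ γ.2] with i h1 h2
  exact hγ ⟨f i, h1⟩ h2

lemma tendsto_lowerEnd {α : Type*} {L : Filter α} {f : α → ℝ} (hne : M.Γ.Nonempty)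
    (hf : ∀ᶠ i in L, f i ∈ M.Γ) (h : ∀ γ ∈ M.Γ, ∀ᶠ i in L, f i ≤ γ) :
    Tendsto f L M.lowerEnd := by
  have := hne.to_subtype
  refine tendsto_def.2 fun s hs => ?_
  obtain ⟨γ, hγ⟩ := mem_atBot_sets.1 (mem_map.1 hs)
  filter_upwards [hf, h γ γ.2] with i h1 h2
  exact hγ ⟨f i, h1⟩ h2

/-- As `Γ` is open, it contains a parameter above `γ`, which the upper end eventually exceeds. -/
lemma not_upperEnd_le_nhds {γ : ℝ} (hγ : γ ∈ M.Γ) : ¬ M.upperEnd ≤ 𝓝 γ := by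
  intro h
  have hne : Nonempty M.Γ := ⟨⟨γ, hγ⟩⟩
  have : M.upperEnd.NeBot := by unfold upperEnd; infer_instance
  obtain ⟨γ', h1, h2⟩ := ((M.eventually_mem hγ).filter_mono nhdsWithin_le_nhds |>.and
    (self_mem_nhdsWithin : Set.Ioi γ ∈ 𝓝[>] γ)).exists
  have h3 : ∀ᶠ t in M.upperEnd, γ' ≤ t :=
    eventually_map.2 ((eventually_ge_atTop (⟨γ', h1⟩ : M.Γ)).mono fun t ht => ht)
  obtain ⟨t, h4, h5⟩ := (h3.and (h (Iio_mem_nhds h2))).exists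
  exact absurd h5 (not_lt.2 h4)

lemma not_lowerEnd_le_nhds {γ : ℝ} (hγ : γ ∈ M.Γ) : ¬ M.lowerEnd ≤ 𝓝 γ := by
  intro h
  have hne : Nonempty M.Γ := ⟨⟨γ, hγ⟩⟩
  have : M.lowerEnd.NeBot := by unfold lowerEnd; infer_instance
  obtain ⟨γ', h1, h2⟩ := ((M.eventually_mem hγ).filter_mono nhdsWithin_le_nhds |>.and
    (self_mem_nhdsWithin : Set.Iio γ ∈ 𝓝[<] γ)).exists
  have h3 : ∀ᶠ t in M.lowerEnd, t ≤ γ' :=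
    eventually_map.2 ((eventually_le_atBot (⟨γ', h1⟩ : M.Γ)).mono fun t ht => ht)
  obtain ⟨t, h4, h5⟩ := (h3.and (h (Ioi_mem_nhds h2))).exists
  exact absurd h5 (not_lt.2 h4)

end ExpFamily

/-! ### Limits of the canonical parameter when the linear predictor converges in the extended reals.
-/

namespace GLM

variable (M : GLM)

lemma strictMonoOn_or_strictAntiOn_canon (hM : M.Nondegenerate) :
    StrictMonoOn M.canon M.predictorRange ∨ StrictAntiOn M.canon M.predictorRange := by
  rcases M.strictMonoOn_or_strictAntiOn_predictor hM with h | h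
  · refine Or.inl fun s hs t ht hst => ?_
    rwa [← h.lt_iff_lt (M.canon_mem hs) (M.canon_mem ht), M.predictor_canon hs,
      M.predictor_canon ht]
  · refine Or.inr fun s hs t ht hst => ?_
    rwa [← h.lt_iff_gt (M.canon_mem hs) (M.canon_mem ht), M.predictor_canon hs,
      M.predictor_canon ht]

/-- When the linear predictor converges in the extended reals while staying admissible, the
canonical parameter converges along a limit filter of the family. -/
lemma exists_isLimitFilter (hM : M.Nondegenerate) (hne : M.Γ.Nonempty) (l : EReal) :
    ∃ 𝓖, M.IsLimitFilter 𝓖 ∧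
      Tendsto M.canon (comap ((↑) : ℝ → EReal) (𝓝 l) ⊓ 𝓟 M.predictorRange) 𝓖 ∧
      ∀ η ∈ M.predictorRange, 𝓖 ≤ 𝓝 (M.canon η) → l = η := by
  by_cases hl : ∃ η ∈ M.predictorRange, (η : EReal) = l
  · obtain ⟨η, hη, rfl⟩ := hl
    refine ⟨𝓝 (M.canon η), M.isLimitFilter_nhds (M.canon_mem hη), ?_, fun η' hη' h => ?_⟩
    · rw [← EReal.isOpenEmbedding_coe.isInducing.nhds_eq_comap]
      exact (M.continuousAt_canon hM hη).tendsto.mono_left inf_le_left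
    · have h1 : M.canon η = M.canon η' := pure_le_nhds_iff.1 ((pure_le_nhds _).trans h)
      rw [← M.predictor_canon hη, h1, M.predictor_canon hη']
  · push Not at hl
    have hmem : ∀ᶠ η in comap ((↑) : ℝ → EReal) (𝓝 l) ⊓ 𝓟 M.predictorRange,
        η ∈ M.predictorRange := Filter.mem_inf_of_right (mem_principal_self _)
    have hcan := hmem.mono fun η hη => M.canon_mem hη
    -- The admissible range is an interval missing `l`, so it lies on one side of `l`; the monotone
    -- `canon` is then driven to an end of `Γ`.
    have hside : (∀ η ∈ M.predictorRange, (η : EReal) < l) ∨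
        (∀ η ∈ M.predictorRange, l < (η : EReal)) := by
      by_contra! hcon
      obtain ⟨⟨η₁, h1, h1'⟩, η₂, h2, h2'⟩ := hcon
      have h3 := lt_of_le_of_ne h1' (hl η₁ h1).symm
      have h4 := lt_of_le_of_ne h2' (hl η₂ h2)
      lift l to ℝ using ⟨(h3.trans_le le_top).ne, (bot_le.trans_lt h4).ne'⟩
      exact hl l (M.ordConnected_predictorRange.out h2 h1
        ⟨EReal.coe_le_coe_iff.1 h4.le, EReal.coe_le_coe_iff.1 h3.le⟩) rfl
    have htop := fun (h : ∀ γ ∈ M.Γ, ∀ᶠ i in comap ((↑) : ℝ → EReal) (𝓝 l) ⊓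
        𝓟 M.predictorRange, γ ≤ M.canon i) => M.tendsto_upperEnd hne hcan h
    have hbot := fun (h : ∀ γ ∈ M.Γ, ∀ᶠ i in comap ((↑) : ℝ → EReal) (𝓝 l) ⊓
        𝓟 M.predictorRange, M.canon i ≤ γ) => M.tendsto_lowerEnd hne hcan h
    have hend : Tendsto M.canon (comap ((↑) : ℝ → EReal) (𝓝 l) ⊓ 𝓟 M.predictorRange) M.upperEnd ∨
        Tendsto M.canon (comap ((↑) : ℝ → EReal) (𝓝 l) ⊓ 𝓟 M.predictorRange) M.lowerEnd := by
      rcases hside with hs | hs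
      · have hev : ∀ γ ∈ M.Γ, ∀ᶠ i in comap ((↑) : ℝ → EReal) (𝓝 l) ⊓ 𝓟 M.predictorRange,
            M.predictor γ ≤ i := fun γ hγ => by
          have h1 : ∀ᶠ i : ℝ in comap ((↑) : ℝ → EReal) (𝓝 l), (M.predictor γ : EReal) < i :=
            tendsto_comap.eventually (lt_mem_nhds (hs _ (M.predictor_mem hγ)))
          exact (h1.filter_mono inf_le_left).mono fun i hi => EReal.coe_le_coe_iff.1 hi.le
        rcases M.strictMonoOn_or_strictAntiOn_canon hM with h | h
        · refine Or.inl (htop fun γ hγ => ?_)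
          filter_upwards [hev γ hγ, hmem] with i h1 h2
          rw [← M.canon_predictor hM hγ]
          exact h.monotoneOn (M.predictor_mem hγ) h2 h1
        · refine Or.inr (hbot fun γ hγ => ?_)
          filter_upwards [hev γ hγ, hmem] with i h1 h2
          rw [← M.canon_predictor hM hγ]
          exact h.antitoneOn (M.predictor_mem hγ) h2 h1
      · have hev : ∀ γ ∈ M.Γ, ∀ᶠ i in comap ((↑) : ℝ → EReal) (𝓝 l) ⊓ 𝓟 M.predictorRange,
            i ≤ M.predictor γ := fun γ hγ => by
          have h1 : ∀ᶠ i : ℝ in comap ((↑) : ℝ → EReal) (𝓝 l), (i : EReal) < M.predictor γ :=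
            tendsto_comap.eventually (gt_mem_nhds (hs _ (M.predictor_mem hγ)))
          exact (h1.filter_mono inf_le_left).mono fun i hi => EReal.coe_le_coe_iff.1 hi.le
        rcases M.strictMonoOn_or_strictAntiOn_canon hM with h | h
        · refine Or.inr (hbot fun γ hγ => ?_)
          filter_upwards [hev γ hγ, hmem] with i h1 h2
          rw [← M.canon_predictor hM hγ]
          exact h.monotoneOn h2 (M.predictor_mem hγ) h1
        · refine Or.inl (htop fun γ hγ => ?_)
          filter_upwards [hev γ hγ, hmem] with i h1 h2
          rw [← M.canon_predictor hM hγ]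
          exact h.antitoneOn h2 (M.predictor_mem hγ) h1
    -- An end of the open interval `Γ` does not converge to a member, so the last clause is vacuous.
    rcases hend with h | h
    · exact ⟨_, M.isLimitFilter_upperEnd hM hne, h, fun η hη hle =>
        absurd hle (M.not_upperEnd_le_nhds (M.canon_mem hη))⟩
    · exact ⟨_, M.isLimitFilter_lowerEnd hM hne, h, fun η hη hle =>
        absurd hle (M.not_lowerEnd_le_nhds (M.canon_mem hη))⟩

end GLM

/-! ### The information as a quadratic form, and identifiability. -/

namespace GLM

variable {M : GLM} {p : ℕ} {P : Measure (Vec p)} {v₀ : Vec p} {ε : ℝ} {F : Vec p → ℝ}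

lemma abs_eta0_mul_eta0_le (t u x : Vec p) :
    |eta0 t x * eta0 u x| ≤ ‖t‖ * ‖u‖ * ‖x‖ ^ 2 := by
  rw [abs_mul]
  calc |eta0 t x| * |eta0 u x| ≤ (‖t‖ * ‖x‖) * (‖u‖ * ‖x‖) := by
        gcongr
        · exact abs_eta0_le t x
        · exact abs_eta0_le u x
    _ = _ := by ring

lemma RegularOn.integrable_info (hM : M.Nondegenerate) (h : M.RegularOn P v₀ ε F) {v : Vec p}
    (hv : v ∈ Metric.ball v₀ ε) (t u : Vec p) :
    Integrable (fun x => M.etaInfo (eta0 v x) * (eta0 t x * eta0 u x)) P := by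
  refine (h.integrable.const_mul (‖t‖ * ‖u‖)).mono' ?_ ?_
  · exact (((M.measurable_etaInfo hM).comp (measurable_eta0 v)).mul
      ((measurable_eta0 t).mul (measurable_eta0 u))).aestronglyMeasurable
  · filter_upwards [h.mem, h.info_le] with x h1 h2
    rw [Real.norm_eq_abs, abs_mul, abs_of_pos (M.etaInfo_pos hM (h1 v hv))]
    have := (M.etaInfo_pos hM (h1 v hv)).le
    calc M.etaInfo (eta0 v x) * |eta0 t x * eta0 u x|
        ≤ M.etaInfo (eta0 v x) * (‖t‖ * ‖u‖ * ‖x‖ ^ 2) := by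
          gcongr; exact abs_eta0_mul_eta0_le t u x
      _ = ‖t‖ * ‖u‖ * (M.etaInfo (eta0 v x) * ‖x‖ ^ 2) := by ring
      _ ≤ _ := by gcongr; exact h2 v hv

lemma eta0_single (i : Fin (p + 1)) (x : Vec p) : eta0 (EuclideanSpace.single i 1) x = x i := by
  simp [eta0, EuclideanSpace.inner_single_left]

lemma eta0_eq_sum (u x : Vec p) : eta0 u x = ∑ j, x j * u j := by
  simp [eta0, PiLp.inner_apply]

lemma RegularOn.inner_info0 (hM : M.Nondegenerate) (h : M.RegularOn P v₀ ε F) (t u : Vec p) :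
    ⟪t, Matrix.toEuclideanLin (M.info0 P v₀) u⟫
      = ∫ x, M.etaInfo (eta0 v₀ x) * (eta0 t x * eta0 u x) ∂P := by
  have hv : v₀ ∈ Metric.ball v₀ ε := Metric.mem_ball_self h.pos
  have h1 : ∀ x : Vec p, M.etaInfo (eta0 v₀ x) * (eta0 t x * eta0 u x)
      = ∑ i, ∑ j, (M.etaInfo (eta0 v₀ x) * (x i * x j)) * (t i * u j) := by
    intro x
    rw [eta0_eq_sum t, eta0_eq_sum u, Finset.sum_mul_sum, Finset.mul_sum]
    refine Finset.sum_congr rfl fun i _ => ?_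
    rw [Finset.mul_sum]
    exact Finset.sum_congr rfl fun j _ => by ring
  have hint : ∀ i j, Integrable (fun x : Vec p =>
      M.etaInfo (eta0 v₀ x) * (x i * x j) * (t i * u j)) P := fun i j => by
    have := h.integrable_info hM hv (EuclideanSpace.single i 1) (EuclideanSpace.single j 1)
    simp_rw [eta0_single] at this
    exact this.mul_const _
  simp_rw [h1]
  rw [integral_finsetSum _ fun i _ => integrable_finsetSum _ fun j _ => hint i j]
  simp_rw [integral_finsetSum _ fun j _ => hint _ j, integral_mul_const, ← info0_apply]
  simp only [PiLp.inner_apply, Matrix.toEuclideanLin, RCLike.inner_apply, conj_trivial]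
  refine Finset.sum_congr rfl fun i _ => ?_
  simp [Finset.sum_mul, Matrix.mulVec, dotProduct]
  exact Finset.sum_congr rfl fun j _ => by ring

/-- A predictor vanishing almost surely puts `u` in the kernel of the information. This is the
identifiability used for consistency. -/
lemma RegularOn.eq_zero_of_ae_eta0_eq_zero (hM : M.Nondegenerate) (h : M.RegularOn P v₀ ε F)
    (hI : (M.info0 P v₀).det ≠ 0) {u : Vec p} (hu : ∀ᵐ x ∂P, eta0 u x = 0) : u = 0 := by
  have h1 : Matrix.toEuclideanLin (M.info0 P v₀) u = 0 := by
    refine ext_inner_left ℝ fun t => ?_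
    rw [h.inner_info0 hM, inner_zero_right]
    refine integral_eq_zero_of_ae ?_
    filter_upwards [hu] with x hx
    simp [hx]
  have h2 : (M.info0 P v₀).mulVec u.ofLp = 0 := by
    have := congrArg WithLp.ofLp h1
    simpa using this
  have h3 := Matrix.eq_zero_of_mulVec_eq_zero hI h2
  ext i
  exact congrFun h3 i

end GLM

/-! ### Existence and consistency of the maximum likelihood estimate. -/

namespace GLM

variable (M : GLM) {p : ℕ} {P : Measure (Vec p)}

/-- The square root of the likelihood ratio of `θ` to `θ₀` at one observation, and zero where `θ`
is not admissible. -/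
def rootLik (θ₀ θ : Vec p) (z : Vec p × ℝ) : ℝ≥0∞ :=
  {z : Vec p × ℝ | eta0 θ z.1 ∈ M.predictorRange}.indicator (fun z =>
    ENNReal.ofReal (M.rootRatio (M.canon (eta0 θ₀ z.1)) (M.canon (eta0 θ z.1)) z.2)) z

lemma rootLik_of_mem {θ₀ θ : Vec p} {z : Vec p × ℝ} (h : eta0 θ z.1 ∈ M.predictorRange) :
    M.rootLik θ₀ θ z
      = ENNReal.ofReal (M.rootRatio (M.canon (eta0 θ₀ z.1)) (M.canon (eta0 θ z.1)) z.2) :=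
  Set.indicator_of_mem (s := {z : Vec p × ℝ | eta0 θ z.1 ∈ M.predictorRange}) h _

lemma rootLik_of_notMem {θ₀ θ : Vec p} {z : Vec p × ℝ} (h : eta0 θ z.1 ∉ M.predictorRange) :
    M.rootLik θ₀ θ z = 0 :=
  Set.indicator_of_notMem (s := {z : Vec p × ℝ | eta0 θ z.1 ∈ M.predictorRange}) h _

lemma measurable_rootLik (hM : M.Nondegenerate) (θ₀ θ : Vec p) : Measurable (M.rootLik θ₀ θ) := by
  have hc := M.measurable_canon hM
  have hb : Measurable fun η => M.b (M.canon η) := M.measurable_comp_canon hM fun γ hγ =>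
    (M.hasDerivAt_b hγ).continuousAt.continuousWithinAt
  have h0 : Measurable fun z : Vec p × ℝ => eta0 θ₀ z.1 := (measurable_eta0 θ₀).comp measurable_fst
  have h1 : Measurable fun z : Vec p × ℝ => eta0 θ z.1 := (measurable_eta0 θ).comp measurable_fst
  refine Measurable.indicator ?_ (h1 M.measurableSet_predictorRange)
  refine (Real.measurable_exp.comp (Measurable.div_const ?_ _)).ennreal_ofReal
  exact (measurable_snd.mul ((hc.comp h1).sub (hc.comp h0))).sub ((hb.comp h1).sub (hb.comp h0))

lemma tendsto_inner_of_span_eq_top {E : Type*} [NormedAddCommGroup E] [InnerProductSpace ℝ E]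
    {α : Type*} {L : Filter α} {f : α → E} {A : Set E} (hA : Submodule.span ℝ A = ⊤)
    (h : ∀ x ∈ A, Tendsto (fun i => ⟪f i, x⟫) L (𝓝 0)) (x : E) :
    Tendsto (fun i => ⟪f i, x⟫) L (𝓝 0) := by
  have hx : x ∈ Submodule.span ℝ A := by rw [hA]; trivial
  induction hx using Submodule.span_induction with
  | mem x hx => exact h x hx
  | zero => simp [tendsto_const_nhds]
  | add x y _ _ hx hy => simpa [inner_add_right] using hx.add hy
  | smul c x _ hx => simpa [inner_smul_right] using hx.const_mul c

lemma tendsto_zero_of_inner {α : Type*} {L : Filter α} {f : α → Vec p}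
    (h : ∀ x, Tendsto (fun i => ⟪f i, x⟫) L (𝓝 0)) : Tendsto (fun i => ‖f i‖) L (𝓝 0) := by
  have h1 : ∀ i, ‖f i‖ = √(∑ j, (f i j) ^ 2) := fun i => by
    rw [EuclideanSpace.norm_eq]
    simp
  simp_rw [h1]
  have h2 : Tendsto (fun i => ∑ j, (f i j) ^ 2) L (𝓝 (∑ _j : Fin (p + 1), (0 : ℝ) ^ 2)) := by
    refine tendsto_finsetSum _ fun j _ => ?_
    have := (h (EuclideanSpace.single j 1)).pow 2
    simpa [EuclideanSpace.inner_single_right] using this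
  have h3 := (Real.continuous_sqrt.tendsto _).comp h2
  simpa [Function.comp_def] using h3

/-- Every ultrafilter of coefficient vectors that stay away from `θ₀` contains a bracket on which
the envelope of the root likelihood ratios has mean less than one. -/
lemma exists_mem_lintegral_envelope_lt_one [IsProbabilityMeasure P] (hM : M.Nondegenerate)
    {θ₀ : Vec p} (hv : ∀ᵐ x ∂P, eta0 θ₀ x ∈ M.predictorRange)
    (hspan : ∀ u : Vec p, (∀ᵐ x ∂P, eta0 u x = 0) → u = 0) {Θ : Set (Vec p)} (hΘ : Θ.Countable)
    {r : ℝ} (hr : 0 < r) (U : Ultrafilter (Vec p)) (hU : ∀ᶠ θ in (U : Filter (Vec p)), r ≤ ‖θ - θ₀‖) :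
    ∃ C ∈ U, ∫⁻ z, ⨆ θ ∈ C ∩ Θ, M.rootLik θ₀ θ z ∂(M.armLaw P (eta0 θ₀)) < 1 := by
  -- An ultrafilter need not have a countable base; `L` has one, so the envelopes over its basis
  -- sets form a decreasing sequence to which monotone convergence applies.
  obtain ⟨L, hLc, hUL, hlim⟩ := exists_filter_tendsto_inner U
  choose l hl using hlim
  obtain ⟨C, hC⟩ := L.exists_antitone_basis
  have hcount : ∀ m, (C m ∩ Θ).Countable := fun m => hΘ.mono Set.inter_subset_right
  set S : ℕ → Vec p × ℝ → ℝ≥0∞ := fun m z => ⨆ θ ∈ C m ∩ Θ, M.rootLik θ₀ θ z with hS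
  have hSm : ∀ m, Measurable (S m) := fun m =>
    Measurable.biSup _ (hcount m) fun θ _ => M.measurable_rootLik hM θ₀ θ
  have hSanti : Antitone S := fun m n hmn z =>
    biSup_mono fun θ hθ => ⟨hC.antitone hmn hθ.1, hθ.2⟩
  -- A finite integral at `m = 0` is what monotone convergence from above requires.
  have hS0 : ∫⁻ z, S 0 z ∂(M.armLaw P (eta0 θ₀)) ≤ 34 := by
    rw [M.lintegral_armLaw P hM θ₀ (hSm 0)]
    calc _ ≤ ∫⁻ _, 34 ∂P := by
          refine lintegral_mono_ae ?_
          filter_upwards [hv] with x hx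
          refine le_trans (lintegral_mono fun y => ?_) (M.lintegral_biSup_rootRatio_le
            (M.canon_mem hx) (T := C 0 ∩ Θ ∩ {θ | eta0 θ x ∈ M.predictorRange})
            ((hcount 0).mono Set.inter_subset_left) (t := fun θ => M.canon (eta0 θ x))
            fun θ hθ => M.canon_mem hθ.2)
          refine iSup₂_le fun θ hθ => ?_
          by_cases hm : eta0 θ x ∈ M.predictorRange
          · rw [M.rootLik_of_mem (z := (x, y)) hm]
            exact le_iSup₂_of_le θ ⟨hθ, hm⟩ le_rfl
          · rw [M.rootLik_of_notMem (z := (x, y)) hm]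
            exact zero_le
      _ = 34 := by simp
  suffices h : ∫⁻ z, ⨅ m, S m z ∂(M.armLaw P (eta0 θ₀)) < 1 by
    rw [lintegral_iInf hSm hSanti (ne_top_of_le_ne_top (by norm_num) hS0)] at h
    obtain ⟨m, hm⟩ := iInf_lt_iff.1 h
    exact ⟨C m, hUL (hC.mem m), hm⟩
  have hIm : Measurable fun z => ⨅ m, S m z := Measurable.iInf hSm
  rw [M.lintegral_armLaw P hM θ₀ hIm]
  have hT : ∀ᵐ x ∂P, ∫⁻ y, ⨅ m, S m (x, y) ∂(M.law (M.canon (eta0 θ₀ x))) ≤ 1 ∧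
      (∫⁻ y, ⨅ m, S m (x, y) ∂(M.law (M.canon (eta0 θ₀ x))) = 1 → l x = eta0 θ₀ x) := by
    filter_upwards [hv] with x hx
    obtain ⟨𝓖, h𝓖, htend, hid⟩ := M.exists_isLimitFilter hM ⟨_, M.canon_mem hx⟩ (l x)
    have := h𝓖.neBot
    have := h𝓖.isCountablyGenerated
    choose H hH using h𝓖.exists_tendsto (M.canon (eta0 θ₀ x))
    -- Vectors inadmissible at `x` contribute zero, and along the admissible ones the root ratio
    -- tends to `H y`.
    have hle : ∀ y, ⨅ m, S m (x, y) ≤ H y := by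
      intro y
      refine le_of_forall_gt fun c hc => ?_
      obtain ⟨c', hc1, hc2⟩ := exists_between hc
      refine lt_of_le_of_lt ?_ hc2
      have h1 : Tendsto (fun θ => eta0 θ x) (L ⊓ 𝓟 {θ | eta0 θ x ∈ M.predictorRange})
          (comap ((↑) : ℝ → EReal) (𝓝 (l x)) ⊓ 𝓟 M.predictorRange) := by
        refine tendsto_inf.2 ⟨tendsto_comap_iff.2 ((hl x).mono_left inf_le_left), ?_⟩
        exact tendsto_principal.2 (Filter.mem_inf_of_right (mem_principal_self _))
      have h2 := ((hH y).comp (htend.comp h1)).eventually (gt_mem_nhds hc1)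
      rw [eventually_inf_principal] at h2
      obtain ⟨m, hm⟩ := hC.mem_iff.1 h2
      refine (iInf_le _ m).trans (iSup₂_le fun θ hθ => ?_)
      by_cases hmem : eta0 θ x ∈ M.predictorRange
      · rw [M.rootLik_of_mem (z := (x, y)) hmem]
        exact (hm hθ.1 hmem).le
      · rw [M.rootLik_of_notMem (z := (x, y)) hmem]
        exact zero_le
    obtain ⟨hH1, hH2⟩ := M.lintegral_limit_rootRatio_le_one h𝓖.mem (M.canon_mem hx) hH
    have hmono := lintegral_mono (μ := M.law (M.canon (eta0 θ₀ x))) hle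
    refine ⟨hmono.trans hH1, fun h1 => hid _ hx (hH2 hM (le_antisymm hH1 ?_))⟩
    rwa [h1] at hmono
  -- If the mean were one, the affinity would be one at almost every `x`, so the predictors at such
  -- `x` would tend to those of `θ₀`. These `x` span the space by identifiability, which forces `θ →
  -- θ₀` along `U`, against the distance `r`.
  by_contra! hcon
  have hTm : Measurable fun x => ∫⁻ y, ⨅ m, S m (x, y) ∂(M.law (M.canon (eta0 θ₀ x))) := by
    have hd := (M.measurable_armDensity hM θ₀).ennreal_ofReal
    simp_rw [ExpFamily.lintegral_law]
    exact (hd.mul hIm).lintegral_prod_right' (ν := M.ν)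
  have hae : (fun x => ∫⁻ y, ⨅ m, S m (x, y) ∂(M.law (M.canon (eta0 θ₀ x)))) =ᵐ[P] fun _ => 1 := by
    refine ae_eq_of_ae_le_of_lintegral_le (hT.mono fun x hx => hx.1) ?_ aemeasurable_const ?_
    · refine ne_top_of_le_ne_top (b := 1) (by norm_num) ?_
      calc _ ≤ ∫⁻ _, 1 ∂P := lintegral_mono_ae (hT.mono fun x hx => hx.1)
        _ = 1 := by simp
    · simpa using hcon
  have hlx : ∀ᵐ x ∂P, l x = eta0 θ₀ x := by
    filter_upwards [hT, hae] with x h1 h2 using h1.2 h2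
  set A : Set (Vec p) := {x | l x = eta0 θ₀ x} with hA
  have hAspan : Submodule.span ℝ A = ⊤ := by
    rw [← Submodule.orthogonal_eq_bot_iff, Submodule.eq_bot_iff]
    intro u hu
    refine hspan u ?_
    filter_upwards [hlx] with x hx
    have := (Submodule.mem_orthogonal _ u).1 hu x (Submodule.subset_span hx)
    rwa [real_inner_comm] at this
  have hconv : ∀ x, Tendsto (fun θ => ⟪θ - θ₀, x⟫) (U : Filter (Vec p)) (𝓝 0) := by
    refine tendsto_inner_of_span_eq_top hAspan fun x hx => ?_
    have h1 := (hl x).mono_left hUL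
    rw [show l x = eta0 θ₀ x from hx, EReal.tendsto_coe] at h1
    have h2 := h1.sub_const (eta0 θ₀ x)
    simpa [inner_sub_left, eta0] using h2
  have hzero := tendsto_zero_of_inner hconv
  obtain ⟨θ, h1, h2⟩ := (hU.and (hzero.eventually (gt_mem_nhds hr))).exists
  exact absurd h1 (not_le.2 h2)

/-- A bracket whose envelope has mean less than one contains, with probability tending to one, no
coefficient vector whose likelihood is comparable to that of the true one. -/
lemma measure_exists_rootLik_le {Ω : Type*} [MeasurableSpace Ω] {Pr : Measure Ω}
    (hM : M.Nondegenerate) {θ₀ : Vec p} {n : ℕ} {D : Fin n → Ω → Vec p × ℝ}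
    (hD : ∀ i, Measurable (D i)) (hind : iIndepFun D Pr)
    (hlaw : ∀ i, HasLaw (D i) (M.armLaw P (eta0 θ₀)) Pr) {C : Set (Vec p)} (hC : C.Countable) :
    Pr {ω | ∃ θ ∈ C, 1 / 2 < ∏ i, M.rootLik θ₀ θ (D i ω)}
      ≤ 2 * (∫⁻ z, ⨆ θ ∈ C, M.rootLik θ₀ θ z ∂(M.armLaw P (eta0 θ₀))) ^ n := by
  set S : Vec p × ℝ → ℝ≥0∞ := fun z => ⨆ θ ∈ C, M.rootLik θ₀ θ z with hS
  have hSm : Measurable S := Measurable.biSup _ hC fun θ _ => M.measurable_rootLik hM θ₀ θ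
  have hprod : ∫⁻ ω, ∏ i, S (D i ω) ∂Pr = (∫⁻ z, S z ∂(M.armLaw P (eta0 θ₀))) ^ n := by
    have h1 := lintegral_prod_eq_prod_lintegral_of_indepFun Finset.univ (fun i ω => S (D i ω))
      (hind.comp (fun _ => S) fun _ => hSm) fun i => hSm.comp (hD i)
    rw [h1]
    simp_rw [fun i => (hlaw i).lintegral_comp hSm.aemeasurable]
    simp
  have hmk := mul_meas_ge_le_lintegral (μ := Pr) (f := fun ω => ∏ i, S (D i ω))
    (Finset.measurable_prod _ fun i _ => hSm.comp (hD i)) (1 / 2)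
  rw [hprod] at hmk
  have hsub : {ω | ∃ θ ∈ C, 1 / 2 < ∏ i, M.rootLik θ₀ θ (D i ω)}
      ⊆ {ω | 1 / 2 ≤ ∏ i, S (D i ω)} := by
    rintro ω ⟨θ, hθ, hlt⟩
    refine hlt.le.trans (Finset.prod_le_prod' fun i _ => ?_)
    exact le_iSup₂_of_le θ hθ le_rfl
  calc _ ≤ Pr {ω | 1 / 2 ≤ ∏ i, S (D i ω)} := measure_mono hsub
    _ = 2 * (1 / 2 * Pr {ω | 1 / 2 ≤ ∏ i, S (D i ω)}) := by
        rw [← mul_assoc, one_div, ENNReal.mul_inv_cancel (by norm_num) (by norm_num), one_mul]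
    _ ≤ _ := by gcongr

section Consistency

variable {Ω : ℕ → Type*} [∀ n, MeasurableSpace (Ω n)] {Pr : ∀ n, Measure (Ω n)}
  {D : ∀ n, Fin n → Ω n → Vec p × ℝ} {θ₀ : Vec p}

/-- The sets of vectors for which the probability vanishes form an ideal. Were the far set outside
it, some ultrafilter would contain the far set and avoid the ideal; but it contains a bracket whose
probability decays geometrically. This replaces a finite subcover. -/
lemma tendsto_measure_exists_rootLik [IsProbabilityMeasure P] (hM : M.Nondegenerate)
    (hv : ∀ᵐ x ∂P, eta0 θ₀ x ∈ M.predictorRange)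
    (hspan : ∀ u : Vec p, (∀ᵐ x ∂P, eta0 u x = 0) → u = 0) {Θ : Set (Vec p)} (hΘ : Θ.Countable)
    (hD : ∀ n i, Measurable (D n i)) (hind : ∀ᶠ n in atTop, iIndepFun (D n) (Pr n))
    (hlaw : ∀ᶠ n in atTop, ∀ i, HasLaw (D n i) (M.armLaw P (eta0 θ₀)) (Pr n))
    {r : ℝ} (hr : 0 < r) :
    Tendsto (fun n => Pr n {ω | ∃ θ ∈ {θ | r ≤ ‖θ - θ₀‖} ∩ Θ,
      1 / 2 < ∏ i, M.rootLik θ₀ θ (D n i ω)}) atTop (𝓝 0) := by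
  set q : Set (Vec p) → Prop := fun s => Tendsto (fun n => Pr n {ω | ∃ θ ∈ s ∩ Θ,
      1 / 2 < ∏ i, M.rootLik θ₀ θ (D n i ω)}) atTop (𝓝 0) with hq
  have he : q ∅ := by simp [hq]
  have hmono : ∀ t, q t → ∀ s ⊆ t, q s := fun t ht s hst =>
    tendsto_of_tendsto_of_tendsto_of_le_of_le tendsto_const_nhds ht (fun _ => zero_le)
      fun n => measure_mono fun ω ⟨θ, hθ, h⟩ => ⟨θ, ⟨hst hθ.1, hθ.2⟩, h⟩
  have hunion : ∀ s, q s → ∀ t, q t → q (s ∪ t) := by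
    intro s hs t ht
    have h := hs.add ht
    rw [add_zero] at h
    refine tendsto_of_tendsto_of_tendsto_of_le_of_le tendsto_const_nhds h (fun _ => zero_le)
      fun n => ?_
    refine le_trans (measure_mono ?_) (measure_union_le _ _)
    rintro ω ⟨θ, ⟨hθ | hθ, hθ'⟩, h⟩
    · exact Or.inl ⟨θ, ⟨hθ, hθ'⟩, h⟩
    · exact Or.inr ⟨θ, ⟨hθ, hθ'⟩, h⟩
  by_contra hcon
  set B : Filter (Vec p) := comk q he hmono hunion with hB
  have hne : (B ⊓ 𝓟 {θ | r ≤ ‖θ - θ₀‖}).NeBot := by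
    rw [neBot_iff, Ne, ← empty_mem_iff_bot, mem_inf_principal]
    intro h
    refine hcon ?_
    have h' : q {x | x ∈ {θ | r ≤ ‖θ - θ₀‖} → x ∈ (∅ : Set (Vec p))}ᶜ := h
    refine hmono _ h' _ fun θ hθ => ?_
    simpa using hθ
  set U := Ultrafilter.of (B ⊓ 𝓟 {θ | r ≤ ‖θ - θ₀‖}) with hUdef
  have hUle : (U : Filter (Vec p)) ≤ B ⊓ 𝓟 {θ | r ≤ ‖θ - θ₀‖} := Ultrafilter.of_le _
  obtain ⟨C, hCU, hC⟩ := M.exists_mem_lintegral_envelope_lt_one hM hv hspan hΘ hr U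
    (hUle (Filter.mem_inf_of_right (mem_principal_self _)))
  have hqC : q C := by
    have hpow := ENNReal.Tendsto.const_mul (a := 2)
      (ENNReal.tendsto_pow_atTop_nhds_zero_of_lt_one hC) (Or.inr (by norm_num))
    rw [mul_zero] at hpow
    refine tendsto_of_tendsto_of_tendsto_of_le_of_le' tendsto_const_nhds hpow
      (Eventually.of_forall fun _ => zero_le) ?_
    filter_upwards [hind, hlaw] with n h1 h2
    exact M.measure_exists_rootLik_le hM (hD n) h1 h2 (hΘ.mono Set.inter_subset_right)
  have hCB : Cᶜ ∈ B := by
    change q Cᶜᶜ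
    rwa [compl_compl]
  have hCU' : Cᶜ ∈ (U : Filter (Vec p)) := hUle (Filter.mem_inf_of_left hCB)
  exact Ultrafilter.compl_notMem_iff.2 hCU hCU'

/-- With probability tending to one, no admissible coefficient vector away from `θ₀` has a
likelihood as large as that of `θ₀`. -/
lemma tendsto_measure_exists_far [IsProbabilityMeasure P] (hM : M.Nondegenerate)
    (hv : ∀ᵐ x ∂P, eta0 θ₀ x ∈ M.predictorRange)
    (hspan : ∀ u : Vec p, (∀ᵐ x ∂P, eta0 u x = 0) → u = 0)
    (hD : ∀ n i, Measurable (D n i)) (hind : ∀ᶠ n in atTop, iIndepFun (D n) (Pr n))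
    (hlaw : ∀ᶠ n in atTop, ∀ i, HasLaw (D n i) (M.armLaw P (eta0 θ₀)) (Pr n))
    {r : ℝ} (hr : 0 < r) :
    Tendsto (fun n => Pr n {ω | ∃ θ, r ≤ ‖θ - θ₀‖ ∧
      (∀ i, eta0 θ (D n i ω).1 ∈ M.predictorRange) ∧
      ∑ i, M.logDensity (M.canon (eta0 θ₀ (D n i ω).1)) (D n i ω).2
        ≤ ∑ i, M.logDensity (M.canon (eta0 θ (D n i ω).1)) (D n i ω).2}) atTop (𝓝 0) := by
  -- Approximation from a countable dense set uses slack: distance `r / 2` in place of `r`, and root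
  -- likelihood ratio above `1 / 2` in place of at least `1`.
  obtain ⟨Θ, hΘc, hΘd⟩ := TopologicalSpace.exists_countable_dense (Vec p)
  refine tendsto_of_tendsto_of_tendsto_of_le_of_le tendsto_const_nhds
    (M.tendsto_measure_exists_rootLik hM hv hspan hΘc hD hind hlaw (half_pos hr))
    (fun _ => zero_le) fun n => measure_mono ?_
  rintro ω ⟨θ, hfar, hadm, hle⟩
  have hval : ∀ t, (∀ i, eta0 t (D n i ω).1 ∈ M.predictorRange) →
      ∏ i, M.rootLik θ₀ t (D n i ω) = ENNReal.ofReal (Real.exp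
        (∑ i, (M.logDensity (M.canon (eta0 t (D n i ω).1)) (D n i ω).2
          - M.logDensity (M.canon (eta0 θ₀ (D n i ω).1)) (D n i ω).2) / 2)) := by
    intro t ht
    rw [Real.exp_sum, ENNReal.ofReal_prod_of_nonneg fun i _ => (Real.exp_pos _).le]
    refine Finset.prod_congr rfl fun i _ => ?_
    rw [M.rootLik_of_mem (ht i), M.rootRatio_eq]
  have hadm' : ∀ᶠ t in 𝓝 θ, ∀ i, eta0 t (D n i ω).1 ∈ M.predictorRange :=
    eventually_all.2 fun i => (continuous_eta0 (D n i ω).1).continuousAt.eventually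
      (M.eventually_mem_predictorRange hM (hadm i))
  have hcont : ContinuousAt (fun t => ENNReal.ofReal (Real.exp
        (∑ i, (M.logDensity (M.canon (eta0 t (D n i ω).1)) (D n i ω).2
          - M.logDensity (M.canon (eta0 θ₀ (D n i ω).1)) (D n i ω).2) / 2))) θ := by
    refine ENNReal.continuous_ofReal.continuousAt.comp (Real.continuous_exp.continuousAt.comp ?_)
    refine tendsto_finsetSum _ fun i _ => ?_
    refine Tendsto.div_const (Tendsto.sub_const ?_ _) _
    exact (M.hasDerivAt_logDensity_canon hM (hadm i) _).continuousAt.tendsto.comp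
      (continuous_eta0 (D n i ω).1).continuousAt.tendsto
  have hgt : (1 / 2 : ℝ≥0∞) < ENNReal.ofReal (Real.exp
        (∑ i, (M.logDensity (M.canon (eta0 θ (D n i ω).1)) (D n i ω).2
          - M.logDensity (M.canon (eta0 θ₀ (D n i ω).1)) (D n i ω).2) / 2)) := by
    refine lt_of_lt_of_le (b := 1) ?_ ?_
    · rw [one_div]; exact ENNReal.inv_lt_one.2 (by norm_num)
    · rw [ENNReal.one_le_ofReal, Real.one_le_exp_iff, ← Finset.sum_div, Finset.sum_sub_distrib]
      linarith
  have hfar' : ∀ᶠ t in 𝓝 θ, r / 2 ≤ ‖t - θ₀‖ := by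
    have h1 : ContinuousAt (fun t : Vec p => ‖t - θ₀‖) θ := by fun_prop
    exact (h1.eventually (lt_mem_nhds (show r / 2 < ‖θ - θ₀‖ by linarith))).mono fun t ht => ht.le
  obtain ⟨t, h4, ⟨h1, h2⟩, h3⟩ := ((mem_closure_iff_frequently.1 (hΘd θ)).and_eventually
    ((hadm'.and (hcont.eventually (lt_mem_nhds hgt))).and hfar')).exists
  refine ⟨t, ⟨h3, h4⟩, ?_⟩
  rw [hval t h1]
  exact h2

/-- With probability tending to one, the maximum likelihood estimate exists and is close to the
true coefficient vector. -/
lemma tendsto_measure_not_isMLE_or_far [IsProbabilityMeasure P] (hM : M.Nondegenerate)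
    {ε : ℝ} {F : Vec p → ℝ} (hreg : M.RegularOn P θ₀ ε F) (hI : (M.info0 P θ₀).det ≠ 0)
    {θhat : ∀ n : ℕ, (Fin n → Vec p × ℝ) → Vec p}
    (hθhat : ∀ (n : ℕ) (d : Fin n → Vec p × ℝ), (∃ θ, M.IsMLE d θ) → M.IsMLE d (θhat n d))
    (hD : ∀ n i, Measurable (D n i)) (hind : ∀ᶠ n in atTop, iIndepFun (D n) (Pr n))
    (hlaw : ∀ᶠ n in atTop, ∀ i, HasLaw (D n i) (M.armLaw P (eta0 θ₀)) (Pr n))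
    {r : ℝ} (hr : 0 < r) :
    Tendsto (fun n => Pr n {ω | ¬ (M.IsMLE (fun i => D n i ω) (θhat n fun i => D n i ω) ∧
      ‖(θhat n fun i => D n i ω) - θ₀‖ < r)}) atTop (𝓝 0) := by
  have hε := hreg.pos
  -- On the closed ball of radius `ρ` every vector is almost surely admissible at the data, so the
  -- likelihood is continuous there and attains its maximum.
  set ρ := min r (ε / 2) with hρ
  have hρ0 : 0 < ρ := lt_min hr (half_pos hε)
  have hv : ∀ᵐ x ∂P, eta0 θ₀ x ∈ M.predictorRange :=
    hreg.mem.mono fun x hx => hx θ₀ (Metric.mem_ball_self hε)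
  refine tendsto_of_tendsto_of_tendsto_of_le_of_le' tendsto_const_nhds
    (M.tendsto_measure_exists_far hM hv (fun u hu => hreg.eq_zero_of_ae_eta0_eq_zero hM hI hu)
      hD hind hlaw hρ0) (Eventually.of_forall fun _ => zero_le) ?_
  filter_upwards [hlaw] with n hn
  refine measure_mono_ae ?_
  have hgood : ∀ᵐ ω ∂(Pr n), ∀ i, ∀ v ∈ Metric.ball θ₀ ε,
      eta0 v (D n i ω).1 ∈ M.predictorRange := by
    refine ae_all_iff.2 fun i => ?_
    have h1 := M.ae_armLaw_fst P θ₀ hreg.mem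
    rw [← (hn i).map_eq] at h1
    exact ae_of_ae_map (hn i).aemeasurable h1
  filter_upwards [hgood] with ω hω hbad
  by_contra hfar
  refine hbad ?_
  have hfar' : ∀ θ, ρ ≤ ‖θ - θ₀‖ → (∀ i, eta0 θ (D n i ω).1 ∈ M.predictorRange) →
      ∑ i, M.logDensity (M.canon (eta0 θ (D n i ω).1)) (D n i ω).2
      < ∑ i, M.logDensity (M.canon (eta0 θ₀ (D n i ω).1)) (D n i ω).2 := by
    intro θ h1 h2
    by_contra! h3
    exact hfar ⟨θ, h1, h2, h3⟩
  have hsub : Metric.closedBall θ₀ ρ ⊆ Metric.ball θ₀ ε :=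
    Metric.closedBall_subset_ball ((min_le_right _ _).trans_lt (half_lt_self hε))
  have hcont : ContinuousOn (fun θ => ∑ i, M.logDensity (M.canon (eta0 θ (D n i ω).1)) (D n i ω).2)
      (Metric.closedBall θ₀ ρ) := by
    intro θ hθ
    refine ContinuousAt.continuousWithinAt ?_
    refine tendsto_finsetSum _ fun i _ => ?_
    exact (M.hasDerivAt_logDensity_canon hM (hω i θ (hsub hθ)) _).continuousAt.tendsto.comp
      (continuous_eta0 (D n i ω).1).continuousAt.tendsto
  have hmem₀ : θ₀ ∈ Metric.closedBall θ₀ ρ := Metric.mem_closedBall_self hρ0.le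
  obtain ⟨θ₁, hθ₁, hmax⟩ := (isCompact_closedBall θ₀ ρ).exists_isMaxOn ⟨θ₀, hmem₀⟩ hcont
  -- Outside the ball every admissible vector is beaten by `θ₀`, so the maximum over the ball is
  -- global.
  have hMLE : M.IsMLE (fun i => D n i ω) θ₁ := by
    refine ⟨fun i => hω i θ₁ (hsub hθ₁), fun t ht => ?_⟩
    by_cases htb : t ∈ Metric.closedBall θ₀ ρ
    · exact hmax htb
    · rw [Metric.mem_closedBall, dist_eq_norm, not_le] at htb
      exact (hfar' t htb.le ht).le.trans (hmax hmem₀)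
  have hhat := hθhat n _ ⟨θ₁, hMLE⟩
  refine ⟨hhat, ?_⟩
  by_contra! hge
  have h1 := hfar' _ ((min_le_left _ _).trans hge) hhat.1
  have h2 := hhat.2 θ₀ fun i => hω i θ₀ (hsub hmem₀)
  exact absurd h1 (not_lt.2 h2)

end Consistency

end GLM

/-! ### Expansions of the complex exponential. -/

lemma norm_cexp_mul_I_sub_one_sub_le (x : ℝ) :
    ‖Complex.exp (x * Complex.I) - 1 - x * Complex.I‖ ≤ 3 * x ^ 2 := by
  have hx : ‖(x : ℂ) * Complex.I‖ = |x| := by simp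
  rcases le_total |x| 1 with h | h
  · refine (Complex.norm_exp_sub_one_sub_id_le (by rwa [hx])).trans ?_
    rw [hx, sq_abs]; nlinarith [sq_nonneg x]
  · calc _ ≤ ‖Complex.exp (x * Complex.I) - 1‖ + ‖(x : ℂ) * Complex.I‖ := norm_sub_le _ _
      _ ≤ (‖Complex.exp (x * Complex.I)‖ + ‖(1 : ℂ)‖) + |x| := by rw [hx]; gcongr; exact norm_sub_le _ _
      _ = 2 + |x| := by rw [Complex.norm_exp_ofReal_mul_I]; norm_num
      _ ≤ 3 * x ^ 2 := by rw [← sq_abs]; nlinarith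

lemma norm_cexp_mul_I_sub_one_le (x : ℝ) : ‖Complex.exp (x * Complex.I) - 1‖ ≤ |x| := by
  have := Real.norm_exp_I_mul_ofReal_sub_one_le (x := x)
  rwa [mul_comm, Real.norm_eq_abs] at this

/-- The cubic Taylor remainder is of order `n |z n / √n| ^ 3 = |z n| ^ 3 / √n`. -/
lemma tendsto_mul_cexp_sub_one_sub {z : ℕ → ℝ} {z₀ : ℝ} (hz : Tendsto z atTop (𝓝 z₀)) :
    Tendsto (fun n : ℕ => (n : ℂ) * (Complex.exp (((√n)⁻¹ * z n : ℝ) * Complex.I) - 1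
      - ((√n)⁻¹ * z n : ℝ) * Complex.I)) atTop (𝓝 (-(z₀ : ℂ) ^ 2 / 2)) := by
  have hs : Tendsto (fun n : ℕ => (√(n : ℝ))⁻¹) atTop (𝓝 0) :=
    tendsto_inv_atTop_zero.comp (Real.tendsto_sqrt_atTop.comp tendsto_natCast_atTop_atTop)
  have hw : Tendsto (fun n : ℕ => (√(n : ℝ))⁻¹ * z n) atTop (𝓝 0) := by
    simpa using hs.mul hz
  have h1 : Tendsto (fun n : ℕ => -(z n : ℂ) ^ 2 / 2) atTop (𝓝 (-(z₀ : ℂ) ^ 2 / 2)) :=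
    (((Complex.continuous_ofReal.tendsto _).comp hz).pow 2).neg.div_const 2
  refine h1.congr_dist ?_
  have h2 : Tendsto (fun n : ℕ => (√(n : ℝ))⁻¹ * |z n| ^ 3) atTop (𝓝 0) := by
    simpa using hs.mul (hz.abs.pow 3)
  refine squeeze_zero' (Eventually.of_forall fun _ => dist_nonneg) ?_ h2
  have hsmall : ∀ᶠ n : ℕ in atTop, |(√(n : ℝ))⁻¹ * z n| < 1 := by
    have := hw.abs
    rw [abs_zero] at this
    exact this.eventually (gt_mem_nhds one_pos)
  filter_upwards [hsmall, eventually_gt_atTop 0] with n hn hn0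
  have hn' : (0 : ℝ) < n := by exact_mod_cast hn0
  have hsq : √(n : ℝ) ^ 2 = n := Real.sq_sqrt hn'.le
  have hsp : 0 < √(n : ℝ) := Real.sqrt_pos.2 hn'
  set w : ℝ := (√(n : ℝ))⁻¹ * z n with hwdef
  have hnw : (n : ℝ) * w ^ 2 = z n ^ 2 := by
    rw [hwdef, mul_pow, inv_pow, hsq]; field_simp
  have hb := Complex.exp_bound (x := (w : ℂ) * Complex.I) (by simpa using hn.le) (n := 3) (by norm_num)
  have hexp : ∑ m ∈ Finset.range 3, ((w : ℂ) * Complex.I) ^ m / (m.factorial : ℂ)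
      = 1 + w * Complex.I - w ^ 2 / 2 := by
    simp [Finset.sum_range_succ, mul_pow, Complex.I_sq]; ring
  rw [hexp] at hb
  have hnwc : (n : ℂ) * (w : ℂ) ^ 2 = (z n : ℂ) ^ 2 := by exact_mod_cast hnw
  rw [dist_comm, dist_eq_norm]
  have heq : (n : ℂ) * (Complex.exp (w * Complex.I) - 1 - w * Complex.I) - -(z n : ℂ) ^ 2 / 2
      = n * (Complex.exp (w * Complex.I) - (1 + w * Complex.I - w ^ 2 / 2)) := by
    rw [← hnwc]; ring
  rw [heq, norm_mul]
  have hn3 : (n : ℝ) * |w| ^ 3 = (√(n : ℝ))⁻¹ * |z n| ^ 3 := by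
    have : (n : ℝ) * |w| ^ 3 = ((n : ℝ) * w ^ 2) * |w| := by rw [← sq_abs]; ring
    rw [this, hnw, hwdef, abs_mul, abs_of_pos (inv_pos.2 hsp), ← sq_abs (z n)]; ring
  rw [← hn3]
  have hnn : ‖(n : ℂ)‖ = n := by simp
  rw [hnn]
  gcongr
  refine hb.trans ?_
  have : ‖(w : ℂ) * Complex.I‖ = |w| := by simp
  rw [this]
  have h0 : 0 ≤ |w| ^ 3 := by positivity
  norm_num [Nat.factorial]
  nlinarith

lemma tendsto_mul_cexp_sub_one (z : ℝ) :
    Tendsto (fun n : ℕ => (n : ℂ) * (Complex.exp (((n : ℝ)⁻¹ * z : ℝ) * Complex.I) - 1))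
      atTop (𝓝 (z * Complex.I)) := by
  refine tendsto_const_nhds.congr_dist ?_
  have h2 : Tendsto (fun n : ℕ => 3 * ((n : ℝ)⁻¹ * z ^ 2)) atTop (𝓝 0) := by
    have := ((tendsto_inv_atTop_zero (𝕜 := ℝ)).comp tendsto_natCast_atTop_atTop).mul_const (z ^ 2)
    simpa using this.const_mul 3
  refine squeeze_zero' (Eventually.of_forall fun _ => dist_nonneg) ?_ h2
  filter_upwards [eventually_gt_atTop 0] with n hn0
  have hn' : (0 : ℝ) < n := by exact_mod_cast hn0
  have hnc : (n : ℂ) ≠ 0 := by exact_mod_cast hn0.ne'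
  rw [dist_comm, dist_eq_norm]
  have heq : (n : ℂ) * (Complex.exp (((n : ℝ)⁻¹ * z : ℝ) * Complex.I) - 1) - z * Complex.I
      = n * (Complex.exp (((n : ℝ)⁻¹ * z : ℝ) * Complex.I) - 1 - ((n : ℝ)⁻¹ * z : ℝ) * Complex.I) := by
    push_cast; field_simp
  rw [heq, norm_mul, Complex.norm_natCast]
  calc (n : ℝ) * _ ≤ n * (3 * ((n : ℝ)⁻¹ * z) ^ 2) := by
        gcongr; exact norm_cexp_mul_I_sub_one_sub_le _
    _ = _ := by field_simp

/-! ### Characteristic functions of the scores. -/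

namespace GLM

variable {M : GLM} {p : ℕ} {P : Measure (Vec p)} {v₀ : Vec p} {ε : ℝ} {F : Vec p → ℝ}

lemma eventually_abs_etaScore_le (hM : M.Nondegenerate) {ι : Type*} {l : Filter ι} {η : ι → ℝ}
    {η₀ : ℝ} (h₀ : η₀ ∈ M.predictorRange) (hη : Tendsto η l (𝓝 η₀)) :
    ∃ C, ∀ᶠ i in l, ∀ y, |M.etaScore (η i) y| ≤ C * (1 + |y|) := by
  have h1 := ((M.contDiffAt_meanAt hM h₀).continuousAt.tendsto.comp hη).abs
  have h2 := ((M.contDiffAt_sensitivity hM h₀).continuousAt.tendsto.comp hη).abs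
  refine ⟨(1 + (|M.meanAt η₀| + 1)) * (|M.sensitivity η₀| + 1), ?_⟩
  filter_upwards [h1.eventually (gt_mem_nhds (lt_add_one _)),
    h2.eventually (gt_mem_nhds (lt_add_one _))] with i h3 h4 y
  simp only [Function.comp_apply] at h3 h4
  rw [etaScore_eq, abs_mul]
  have h5 : |y - M.meanAt (η i)| ≤ (1 + (|M.meanAt η₀| + 1)) * (1 + |y|) := by
    have := abs_sub y (M.meanAt (η i))
    nlinarith [abs_nonneg y, abs_nonneg (M.meanAt η₀)]
  calc _ ≤ (1 + (|M.meanAt η₀| + 1)) * (1 + |y|) * (|M.sensitivity η₀| + 1) := by gcongr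
    _ = _ := by ring

lemma measurable_etaScore_comp (hM : M.Nondegenerate) (v : Vec p) :
    Measurable fun z : Vec p × ℝ => M.etaScore (eta0 v z.1) z.2 :=
  (M.measurable_etaScore hM).comp (((measurable_eta0 v).comp measurable_fst).prodMk measurable_snd)

lemma measurable_etaHess_comp (hM : M.Nondegenerate) (v : Vec p) :
    Measurable fun z : Vec p × ℝ => M.etaHess (eta0 v z.1) z.2 :=
  (M.measurable_etaHess hM).comp (((measurable_eta0 v).comp measurable_fst).prodMk measurable_snd)

lemma measurable_etaScore_right (hM : M.Nondegenerate) (η : ℝ) : Measurable (M.etaScore η) :=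
  (M.measurable_etaScore hM).comp (measurable_const.prodMk measurable_id)

lemma measurable_etaHess_right (hM : M.Nondegenerate) (η : ℝ) : Measurable (M.etaHess η) :=
  (M.measurable_etaHess hM).comp (measurable_const.prodMk measurable_id)

lemma integrable_etaScore (hM : M.Nondegenerate) {η : ℝ} (hη : η ∈ M.predictorRange) :
    Integrable (M.etaScore η) (M.law (M.canon η)) := by
  obtain ⟨C, hC⟩ := eventually_abs_etaScore_le hM hη
    (tendsto_const_nhds (f := (𝓝 (0:ℝ))))
  refine M.integrable_law_of_bound (M.canon_mem hη) (C := C) (k := 1)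
    (measurable_etaScore_right hM η).aestronglyMeasurable ?_
  simpa using hC

lemma integrable_etaScore_sq (hM : M.Nondegenerate) {η : ℝ} (hη : η ∈ M.predictorRange) :
    Integrable (fun y => M.etaScore η y ^ 2) (M.law (M.canon η)) := by
  obtain ⟨C, hC⟩ := eventually_abs_etaScore_le hM hη
    (tendsto_const_nhds (f := (𝓝 (0:ℝ))))
  rw [eventually_const] at hC
  refine M.integrable_law_of_bound (M.canon_mem hη) (C := C ^ 2) (k := 2)
    ((measurable_etaScore_right hM η).pow_const 2).aestronglyMeasurable fun y => ?_
  rw [norm_pow, Real.norm_eq_abs, ← mul_pow]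
  exact pow_le_pow_left₀ (abs_nonneg _) (hC y) 2

/-- The characteristic function of one score at linear predictors tending to `η₀`. -/
lemma tendsto_integral_cexp_etaScore (hM : M.Nondegenerate) {η : ℕ → ℝ} {η₀ : ℝ}
    (h₀ : η₀ ∈ M.predictorRange) (hη : Tendsto η atTop (𝓝 η₀))
    (hmem : ∀ n, η n ∈ M.predictorRange) (c : ℝ) :
    Tendsto (fun n : ℕ => (n : ℂ) * (∫ y, (Complex.exp (((√n)⁻¹ * (M.etaScore (η n) y * c) : ℝ)
      * Complex.I) - 1) ∂(M.law (M.canon (η n))))) atTop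
      (𝓝 (-(M.etaInfo η₀ * c ^ 2 : ℝ) / 2)) := by
  obtain ⟨C, hC⟩ := eventually_abs_etaScore_le hM h₀ hη
  -- Subtracting the linear term is free because the score has mean zero; what remains is bounded by
  -- the squared score, uniformly in `n`.
  have hlim := M.tendsto_integral_law (M.canon_mem h₀) ((M.continuousAt_canon hM h₀).tendsto.comp hη)
    (f := fun (n : ℕ) y => (n : ℂ) * (Complex.exp (((√n)⁻¹ * (M.etaScore (η n) y * c) : ℝ)
      * Complex.I) - 1 - ((√n)⁻¹ * (M.etaScore (η n) y * c) : ℝ) * Complex.I))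
    (f₀ := fun y => -((M.etaScore η₀ y * c : ℝ) : ℂ) ^ 2 / 2) (C := 3 * (C * |c|) ^ 2) (k := 2)
    ?_ ?_ ?_
  · have hval : ∫ y, -((M.etaScore η₀ y * c : ℝ) : ℂ) ^ 2 / 2 ∂(M.law (M.canon η₀))
        = (-(M.etaInfo η₀ * c ^ 2 : ℝ) / 2 : ℂ) := by
      have : ∀ y, -((M.etaScore η₀ y * c : ℝ) : ℂ) ^ 2 / 2
          = ((-(M.etaScore η₀ y ^ 2 * c ^ 2) / 2 : ℝ) : ℂ) := fun y => by push_cast; ring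
      simp_rw [this]
      rw [integral_complex_ofReal, integral_div, integral_neg, integral_mul_const,
        M.integral_etaScore_sq hM h₀]
      push_cast; ring
    rw [hval] at hlim
    refine hlim.congr fun n => ?_
    have := M.isProbabilityMeasure_law (M.canon_mem (hmem n))
    simp only [Function.comp_apply]
    rw [integral_const_mul]
    congr 1
    have hi := (integrable_etaScore hM (hmem n))
    have hi2 : Integrable (fun y => (((√n)⁻¹ * (M.etaScore (η n) y * c) : ℝ) : ℂ) * Complex.I)
        (M.law (M.canon (η n))) := ((hi.mul_const c).const_mul _).ofReal.mul_const _
    rw [integral_sub _ hi2]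
    · rw [integral_mul_const, integral_complex_ofReal, integral_const_mul, integral_mul_const,
        M.integral_etaScore (hmem n)]
      simp
    · refine hi2.norm.mono' ?_ (ae_of_all _ fun y => ?_)
      · have := measurable_etaScore_right hM (η n)
        exact Measurable.aestronglyMeasurable (by fun_prop)
      · refine (norm_cexp_mul_I_sub_one_le _).trans (le_of_eq ?_)
        simp
  · refine Eventually.of_forall fun n => ?_
    have := measurable_etaScore_right hM (η n)
    exact Measurable.aestronglyMeasurable (by fun_prop)
  · filter_upwards [hC, eventually_gt_atTop 0] with n hn hn0 y
    have hn' : (0 : ℝ) < n := by exact_mod_cast hn0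
    rw [norm_mul, Complex.norm_natCast]
    calc _ ≤ (n : ℝ) * (3 * ((√n)⁻¹ * (M.etaScore (η n) y * c)) ^ 2) := by
          gcongr; exact norm_cexp_mul_I_sub_one_sub_le _
      _ = 3 * (|M.etaScore (η n) y| * |c|) ^ 2 := by
          rw [mul_pow, inv_pow, Real.sq_sqrt hn'.le, ← abs_mul, sq_abs]; field_simp
      _ ≤ 3 * ((C * (1 + |y|)) * |c|) ^ 2 := by gcongr; exact hn y
      _ = _ := by ring
  · intro y
    refine tendsto_mul_cexp_sub_one_sub ?_
    exact ((M.hasDerivAt_etaScore hM h₀ y).continuousAt.tendsto.comp hη).mul_const c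

/-- This is the majorant for the integral over covariates: after removal of the mean-zero linear
term, the remainder costs the second moment of the score, which is the information. -/
lemma norm_mul_integral_cexp_etaScore_le (hM : M.Nondegenerate) {η : ℝ}
    (hη : η ∈ M.predictorRange) (c : ℝ) (n : ℕ) :
    ‖(n : ℂ) * (∫ y, (Complex.exp (((√n)⁻¹ * (M.etaScore η y * c) : ℝ)
      * Complex.I) - 1) ∂(M.law (M.canon η)))‖ ≤ 3 * (M.etaInfo η * c ^ 2) := by
  rcases Nat.eq_zero_or_pos n with rfl | hn0
  · have := M.etaInfo_pos hM hη
    simp; positivity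
  have hn' : (0 : ℝ) < n := by exact_mod_cast hn0
  have := M.isProbabilityMeasure_law (M.canon_mem hη)
  have hm := measurable_etaScore_right hM η
  have hi := (integrable_etaScore hM hη)
  have hi2 : Integrable (fun y => (((√n)⁻¹ * (M.etaScore η y * c) : ℝ) : ℂ) * Complex.I)
      (M.law (M.canon η)) := ((hi.mul_const c).const_mul _).ofReal.mul_const _
  have hi3 : Integrable (fun y => Complex.exp (((√n)⁻¹ * (M.etaScore η y * c) : ℝ) * Complex.I) - 1)
      (M.law (M.canon η)) := by
    refine hi2.norm.mono' ?_ (ae_of_all _ fun y => ?_)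
    · exact Measurable.aestronglyMeasurable (by fun_prop)
    · refine (norm_cexp_mul_I_sub_one_le _).trans (le_of_eq ?_)
      simp
  have heq : ∫ y, (Complex.exp (((√n)⁻¹ * (M.etaScore η y * c) : ℝ)
      * Complex.I) - 1) ∂(M.law (M.canon η)) = ∫ y, (Complex.exp (((√n)⁻¹ * (M.etaScore η y * c) : ℝ)
      * Complex.I) - 1 - ((√n)⁻¹ * (M.etaScore η y * c) : ℝ) * Complex.I) ∂(M.law (M.canon η)) := by
    rw [integral_sub hi3 hi2, integral_mul_const, integral_complex_ofReal, integral_const_mul,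
      integral_mul_const, M.integral_etaScore hη]
    simp
  rw [heq, norm_mul, Complex.norm_natCast]
  have hb : ‖∫ y, (Complex.exp (((√n)⁻¹ * (M.etaScore η y * c) : ℝ)
      * Complex.I) - 1 - ((√n)⁻¹ * (M.etaScore η y * c) : ℝ) * Complex.I) ∂(M.law (M.canon η))‖
      ≤ ∫ y, 3 * ((n : ℝ)⁻¹ * (M.etaScore η y ^ 2 * c ^ 2)) ∂(M.law (M.canon η)) := by
    refine norm_integral_le_of_norm_le ?_ (ae_of_all _ fun y => ?_)
    · exact (((integrable_etaScore_sq hM hη).mul_const _).const_mul _).const_mul _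
    · refine (norm_cexp_mul_I_sub_one_sub_le _).trans (le_of_eq ?_)
      rw [mul_pow, inv_pow, Real.sq_sqrt hn'.le, mul_pow]
  refine (mul_le_mul_of_nonneg_left hb hn'.le).trans (le_of_eq ?_)
  rw [integral_const_mul, integral_const_mul, integral_mul_const, M.integral_etaScore_sq hM hη]
  field_simp

lemma RegularOn.ae_mem (h : M.RegularOn P v₀ ε F) {v : Vec p} (hv : v ∈ Metric.ball v₀ ε) :
    ∀ᵐ x ∂P, eta0 v x ∈ M.predictorRange := h.mem.mono fun _ hx => hx v hv

/-- The characteristic function of one score, along coefficient vectors tending to `v₀`. -/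
lemma RegularOn.tendsto_integral_cexp_score [IsProbabilityMeasure P] (hM : M.Nondegenerate)
    (h : M.RegularOn P v₀ ε F) {v : ℕ → Vec p} (hv : Tendsto v atTop (𝓝 v₀)) (t : Vec p) :
    Tendsto (fun n : ℕ => (n : ℂ) * (∫ z, Complex.exp (((√n)⁻¹ *
      (M.etaScore (eta0 (v n) z.1) z.2 * eta0 t z.1) : ℝ) * Complex.I) ∂(M.armLaw P (eta0 (v n))) - 1))
      atTop (𝓝 (-(⟪t, Matrix.toEuclideanLin (M.info0 P v₀) t⟫ : ℝ) / 2)) := by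
  have hball := hv.eventually (Metric.ball_mem_nhds _ h.pos)
  have hval : (-(⟪t, Matrix.toEuclideanLin (M.info0 P v₀) t⟫ : ℝ) / 2 : ℂ)
      = ∫ x, (-(M.etaInfo (eta0 v₀ x) * eta0 t x ^ 2 : ℝ) / 2 : ℂ) ∂P := by
    rw [h.inner_info0 hM, integral_div, integral_neg, integral_complex_ofReal]
    simp_rw [pow_two]
  rw [hval]
  have hlim : Tendsto (fun n : ℕ => ∫ x, (n : ℂ) * (∫ y, (Complex.exp (((√n)⁻¹ *
      (M.etaScore (eta0 (v n) x) y * eta0 t x) : ℝ) * Complex.I) - 1)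
      ∂(M.law (M.canon (eta0 (v n) x)))) ∂P) atTop
      (𝓝 (∫ x, (-(M.etaInfo (eta0 v₀ x) * eta0 t x ^ 2 : ℝ) / 2 : ℂ) ∂P)) := by
    refine tendsto_integral_filter_of_dominated_convergence (fun x => 3 * ‖t‖ ^ 2 * F x) ?_ ?_
      (h.integrable.const_mul _) ?_
    · filter_upwards [hball] with n hn
      have := M.isProbabilityMeasure_armLaw P hM (h.ae_mem hn)
      have hm := measurable_etaScore_comp hM (v n)
      have hm2 : Measurable fun z : Vec p × ℝ => eta0 t z.1 := (measurable_eta0 t).comp measurable_fst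
      have hd := M.measurable_armDensity hM (v n)
      have : StronglyMeasurable fun z : Vec p × ℝ => M.density (M.canon (eta0 (v n) z.1)) z.2 •
          (Complex.exp (((√n)⁻¹ * (M.etaScore (eta0 (v n) z.1) z.2 * eta0 t z.1) : ℝ) * Complex.I) - 1) :=
        Measurable.stronglyMeasurable (by fun_prop)
      simp_rw [ExpFamily.integral_law]
      have hsf := M.sigmaFinite
      exact (this.integral_prod_right (ν := M.ν)).aestronglyMeasurable.const_mul _
    · filter_upwards [hball] with n hn
      filter_upwards [h.mem, h.info_le] with x h1 h2
      refine (norm_mul_integral_cexp_etaScore_le hM (h1 _ hn) _ _).trans ?_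
      have h3 := (M.etaInfo_pos hM (h1 _ hn)).le
      have h4 : eta0 t x ^ 2 ≤ ‖t‖ ^ 2 * ‖x‖ ^ 2 := by
        rw [← sq_abs, ← mul_pow]; exact pow_le_pow_left₀ (abs_nonneg _) (abs_eta0_le t x) 2
      calc 3 * (M.etaInfo (eta0 (v n) x) * eta0 t x ^ 2)
          ≤ 3 * (M.etaInfo (eta0 (v n) x) * (‖t‖ ^ 2 * ‖x‖ ^ 2)) := by gcongr
        _ = 3 * ‖t‖ ^ 2 * (M.etaInfo (eta0 (v n) x) * ‖x‖ ^ 2) := by ring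
        _ ≤ _ := by gcongr; exact h2 _ hn
    · filter_upwards [h.mem] with x h1
      have h0 := h1 v₀ (Metric.mem_ball_self h.pos)
      have hη : Tendsto (fun n => eta0 (v n) x) atTop (𝓝 (eta0 v₀ x)) :=
        ((continuous_eta0 x).tendsto v₀).comp hv
      -- The limit at a fixed covariate asks for admissibility at every index, so terms before `N`
      -- are replaced by the `N`-th.
      obtain ⟨N, hN⟩ := eventually_atTop.1 hball
      have hN' := tendsto_integral_cexp_etaScore hM h0
        (η := fun n => eta0 (v (max n N)) x)
        ((tendsto_congr' (eventually_atTop.2 ⟨N, fun n hn => by simp [max_eq_left hn]⟩)).2 hη)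
        (fun n => h1 _ (hN _ (le_max_right _ _))) (eta0 t x)
      refine hN'.congr' (eventually_atTop.2 ⟨N, fun n hn => ?_⟩)
      simp only [max_eq_left hn]
  refine hlim.congr' ?_
  filter_upwards [hball] with n hn
  have hp := M.isProbabilityMeasure_armLaw P hM (h.ae_mem hn)
  rw [integral_const_mul]
  congr 1
  have hm := measurable_etaScore_comp hM (v n)
  have hm2 : Measurable fun z : Vec p × ℝ => eta0 t z.1 := (measurable_eta0 t).comp measurable_fst
  have hi : Integrable (fun z : Vec p × ℝ => Complex.exp (((√n)⁻¹ *
      (M.etaScore (eta0 (v n) z.1) z.2 * eta0 t z.1) : ℝ) * Complex.I)) (M.armLaw P (eta0 (v n))) := by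
    refine Integrable.of_bound (C := 1) (Measurable.aestronglyMeasurable (by fun_prop))
      (ae_of_all _ fun z => ?_)
    rw [Complex.norm_exp_ofReal_mul_I]
  have h1 : ∫ z, Complex.exp (((√n)⁻¹ *
      (M.etaScore (eta0 (v n) z.1) z.2 * eta0 t z.1) : ℝ) * Complex.I) ∂(M.armLaw P (eta0 (v n))) - 1
      = ∫ z, (Complex.exp (((√n)⁻¹ *
      (M.etaScore (eta0 (v n) z.1) z.2 * eta0 t z.1) : ℝ) * Complex.I) - 1) ∂(M.armLaw P (eta0 (v n))) := by
    rw [integral_sub hi (integrable_const _)]; simp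
  rw [h1]
  exact (M.integral_armLaw P hM (v n) (hi.sub (integrable_const 1))).symm

end GLM

/-- Characteristic functions of row sums of triangular arrays with identically distributed rows. -/
lemma integral_cexp_sum {Ω E : Type*} [MeasurableSpace Ω] [MeasurableSpace E] {Pr : Measure Ω}
    {n : ℕ} {D : Fin n → Ω → E} (hind : iIndepFun D Pr) {μ : Measure E}
    (hlaw : ∀ i, HasLaw (D i) μ Pr) {f : E → ℝ} (hf : Measurable f) :
    ∫ ω, Complex.exp ((∑ i, f (D i ω) : ℝ) * Complex.I) ∂Pr
      = (∫ z, Complex.exp (f z * Complex.I) ∂μ) ^ n := by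
  have hg : Measurable fun z => Complex.exp (f z * Complex.I) := by fun_prop
  have h1 : ∀ ω, Complex.exp ((∑ i, f (D i ω) : ℝ) * Complex.I)
      = ∏ i, Complex.exp (f (D i ω) * Complex.I) := fun ω => by
    rw [← Complex.exp_sum]; push_cast; rw [Finset.sum_mul]
  simp_rw [h1]
  rw [hind.integral_fun_prod_comp (f := fun _ z => Complex.exp (f z * Complex.I))
    (fun i => (hlaw i).aemeasurable) fun i => hg.aestronglyMeasurable]
  have h2 : ∀ i, ∫ ω, Complex.exp (f (D i ω) * Complex.I) ∂Pr
      = ∫ z, Complex.exp (f z * Complex.I) ∂μ := fun i => by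
    rw [← (hlaw i).map_eq, integral_map (hlaw i).aemeasurable hg.aestronglyMeasurable]
  simp_rw [h2]
  simp

/-- Convergence of characteristic functions to that of a constant implies convergence in
probability. -/
lemma tendsto_measure_abs_sub_ge_of_charFun {Ω : ℕ → Type*} [∀ n, MeasurableSpace (Ω n)]
    {Pr : ∀ n, Measure (Ω n)} [∀ n, IsProbabilityMeasure (Pr n)] {X : ∀ n, Ω n → ℝ}
    (hX : ∀ n, Measurable (X n)) {m : ℝ}
    (h : ∀ τ : ℝ, Tendsto (fun n => ∫ ω, Complex.exp ((τ * X n ω : ℝ) * Complex.I) ∂(Pr n)) atTop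
      (𝓝 (Complex.exp ((τ * m : ℝ) * Complex.I)))) {r : ℝ} (hr : 0 < r) :
    Tendsto (fun n => Pr n {ω | r ≤ |X n ω - m|}) atTop (𝓝 0) := by
  let μ : ℕ → ProbabilityMeasure ℝ := fun n =>
    ⟨(Pr n).map (X n), Measure.isProbabilityMeasure_map (hX n).aemeasurable⟩
  let μ₀ : ProbabilityMeasure ℝ := ⟨Measure.dirac m, inferInstance⟩
  have hμ : Tendsto μ atTop (𝓝 μ₀) := by
    refine ProbabilityMeasure.tendsto_iff_tendsto_charFun.2 fun τ => ?_
    have h1 : ∀ n, charFun (μ n : Measure ℝ) τ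
        = ∫ ω, Complex.exp ((τ * X n ω : ℝ) * Complex.I) ∂(Pr n) := fun n => by
      change charFun ((Pr n).map (X n)) τ = _
      rw [charFun_apply_real, integral_map (hX n).aemeasurable
        (Measurable.aestronglyMeasurable (by fun_prop))]
      push_cast; rfl
    have h2 : charFun (μ₀ : Measure ℝ) τ = Complex.exp ((τ * m : ℝ) * Complex.I) := by
      change charFun (Measure.dirac m) τ = _
      rw [charFun_apply_real, integral_dirac]
      push_cast; rfl
    rw [h2]
    simpa only [h1] using h τ
  have hcl : IsClosed {x : ℝ | r ≤ |x - m|} :=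
    isClosed_le continuous_const (by fun_prop)
  have hls := ProbabilityMeasure.limsup_measure_closed_le_of_tendsto hμ hcl
  have h0 : (μ₀ : Measure ℝ) {x : ℝ | r ≤ |x - m|} = 0 := by
    change Measure.dirac m _ = 0
    rw [Measure.dirac_apply' _ hcl.measurableSet]
    simp [hr]
  rw [h0, nonpos_iff_eq_zero] at hls
  have h3 : Tendsto (fun n => (μ n : Measure ℝ) {x : ℝ | r ≤ |x - m|}) atTop (𝓝 0) :=
    tendsto_of_le_liminf_of_limsup_le zero_le hls.le
  refine h3.congr fun n => ?_
  change (Pr n).map (X n) _ = _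
  rw [Measure.map_apply (hX n) hcl.measurableSet]
  rfl

/-! ### A law of large numbers for the Hessian. -/

namespace GLM

variable {M : GLM} {p : ℕ} {P : Measure (Vec p)} {v₀ : Vec p} {ε : ℝ} {F : Vec p → ℝ}

/-- The Hessian is affine in `y`; its coefficients are continuous in `η`, so its variation is small
uniformly relative to `1 + |y|`. -/
lemma abs_etaHess_sub_le (η η' y : ℝ) : |M.etaHess η y - M.etaHess η' y|
    ≤ (|deriv M.sensitivity η - deriv M.sensitivity η'|
      + |(M.meanAt η * deriv M.sensitivity η + M.etaInfo η)
        - (M.meanAt η' * deriv M.sensitivity η' + M.etaInfo η')|) * (1 + |y|) := by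
  have h : M.etaHess η y - M.etaHess η' y = y * (deriv M.sensitivity η - deriv M.sensitivity η')
      - ((M.meanAt η * deriv M.sensitivity η + M.etaInfo η)
        - (M.meanAt η' * deriv M.sensitivity η' + M.etaInfo η')) := by
    rw [etaHess_eq, etaHess_eq]; ring
  rw [h]
  set a := deriv M.sensitivity η - deriv M.sensitivity η'
  set b := (M.meanAt η * deriv M.sensitivity η + M.etaInfo η)
        - (M.meanAt η' * deriv M.sensitivity η' + M.etaInfo η')
  calc |y * a - b| ≤ |y * a| + |b| := abs_sub _ _
    _ = |y| * |a| + |b| := by rw [abs_mul]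
    _ ≤ _ := by nlinarith [abs_nonneg y, abs_nonneg a, abs_nonneg b]

lemma abs_etaHess_le (η y : ℝ) : |M.etaHess η y| ≤ (|deriv M.sensitivity η|
      + |M.meanAt η * deriv M.sensitivity η + M.etaInfo η|) * (1 + |y|) := by
  have h : M.etaHess η y = y * deriv M.sensitivity η
      - (M.meanAt η * deriv M.sensitivity η + M.etaInfo η) := by
    rw [etaHess_eq]; ring
  rw [h]
  set a := deriv M.sensitivity η
  set b := M.meanAt η * a + M.etaInfo η
  calc |y * a - b| ≤ |y * a| + |b| := abs_sub _ _
    _ = |y| * |a| + |b| := by rw [abs_mul]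
    _ ≤ _ := by nlinarith [abs_nonneg y, abs_nonneg a, abs_nonneg b]

lemma tendsto_integral_cexp_etaHess (hM : M.Nondegenerate) {η : ℕ → ℝ} {η₀ : ℝ}
    (h₀ : η₀ ∈ M.predictorRange) (hη : Tendsto η atTop (𝓝 η₀)) (c : ℝ) :
    Tendsto (fun n : ℕ => (n : ℂ) * (∫ y, (Complex.exp (((n : ℝ)⁻¹ * (M.etaHess η₀ y * c) : ℝ)
      * Complex.I) - 1) ∂(M.law (M.canon (η n))))) atTop
      (𝓝 ((-(M.etaInfo η₀ * c) : ℝ) * Complex.I)) := by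
  have hlim := M.tendsto_integral_law (M.canon_mem h₀) ((M.continuousAt_canon hM h₀).tendsto.comp hη)
    (f := fun (n : ℕ) y => (n : ℂ) * (Complex.exp (((n : ℝ)⁻¹ * (M.etaHess η₀ y * c) : ℝ)
      * Complex.I) - 1))
    (f₀ := fun y => (M.etaHess η₀ y * c : ℝ) * Complex.I) (C := (|deriv M.sensitivity η₀|
      + |M.meanAt η₀ * deriv M.sensitivity η₀ + M.etaInfo η₀|) * |c|) (k := 1)
    ?_ ?_ ?_
  · have hval : ∫ y, ((M.etaHess η₀ y * c : ℝ) * Complex.I : ℂ) ∂(M.law (M.canon η₀))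
        = ((-(M.etaInfo η₀ * c) : ℝ) * Complex.I : ℂ) := by
      rw [integral_mul_const, integral_complex_ofReal, integral_mul_const, M.integral_etaHess h₀]
      push_cast; ring
    rw [hval] at hlim
    refine hlim.congr fun n => ?_
    simp only [Function.comp_apply]
    rw [integral_const_mul]
  · refine Eventually.of_forall fun n => ?_
    have := measurable_etaHess_right hM η₀
    exact Measurable.aestronglyMeasurable (by fun_prop)
  · filter_upwards [eventually_gt_atTop 0] with n hn0 y
    have hn' : (0 : ℝ) < n := by exact_mod_cast hn0
    rw [norm_mul, Complex.norm_natCast, pow_one]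
    calc _ ≤ (n : ℝ) * |(n : ℝ)⁻¹ * (M.etaHess η₀ y * c)| := by
          gcongr; exact norm_cexp_mul_I_sub_one_le _
      _ = |M.etaHess η₀ y| * |c| := by
          rw [abs_mul, abs_of_pos (inv_pos.2 hn'), abs_mul]; field_simp
      _ ≤ _ := (mul_le_mul_of_nonneg_right (abs_etaHess_le η₀ y) (abs_nonneg c)).trans
          (le_of_eq (by ring))
  · intro y
    exact tendsto_mul_cexp_sub_one _

lemma norm_mul_integral_cexp_etaHess_le {η η₀ : ℝ} (hη : η ∈ M.predictorRange) (c : ℝ) (n : ℕ) :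
    ‖(n : ℂ) * (∫ y, (Complex.exp (((n : ℝ)⁻¹ * (M.etaHess η₀ y * c) : ℝ)
      * Complex.I) - 1) ∂(M.law (M.canon η)))‖
      ≤ (∫ y, |M.etaHess η₀ y| ∂(M.law (M.canon η))) * |c| := by
  rcases Nat.eq_zero_or_pos n with rfl | hn0
  · simp only [Nat.cast_zero, zero_mul, norm_zero]
    exact mul_nonneg (integral_nonneg fun y => abs_nonneg _) (abs_nonneg _)
  have hn' : (0 : ℝ) < n := by exact_mod_cast hn0
  rw [norm_mul, Complex.norm_natCast]
  have hb : ‖∫ y, (Complex.exp (((n : ℝ)⁻¹ * (M.etaHess η₀ y * c) : ℝ)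
      * Complex.I) - 1) ∂(M.law (M.canon η))‖
      ≤ ∫ y, (n : ℝ)⁻¹ * (|M.etaHess η₀ y| * |c|) ∂(M.law (M.canon η)) := by
    refine norm_integral_le_of_norm_le ?_ (ae_of_all _ fun y => ?_)
    · exact ((M.integrable_etaHess hη).abs.mul_const _).const_mul _
    · refine (norm_cexp_mul_I_sub_one_le _).trans (le_of_eq ?_)
      rw [abs_mul, abs_of_pos (inv_pos.2 hn'), abs_mul]
  refine (mul_le_mul_of_nonneg_left hb hn'.le).trans (le_of_eq ?_)
  rw [integral_const_mul, integral_mul_const]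
  field_simp

lemma RegularOn.integral_abs_etaHess_le (h : M.RegularOn P v₀ ε F) :
    ∀ᵐ x ∂P, ∀ v ∈ Metric.ball v₀ ε,
      (∫ y, |M.etaHess (eta0 v₀ x) y| ∂(M.law (M.canon (eta0 v x)))) * ‖x‖ ^ 2 ≤ |F x| := by
  filter_upwards [h.mem, h.hess_le] with x h1 h2 v hv
  have hi : Integrable (fun y => |M.etaHess (eta0 v₀ x) y| * ‖x‖ ^ 2)
      (M.law (M.canon (eta0 v x))) := (M.integrable_etaHess (h1 v hv)).abs.mul_const _
  rw [← integral_mul_const]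
  refine (ENNReal.ofReal_le_ofReal_iff (abs_nonneg _)).1 ?_
  rw [ofReal_integral_eq_lintegral_ofReal hi (ae_of_all _ fun y => by positivity)]
  refine le_trans ?_ ((h2 v hv).trans (ENNReal.ofReal_le_ofReal (le_abs_self _)))
  exact lintegral_mono fun y => le_iSup₂_of_le v₀ (Metric.mem_ball_self h.pos) le_rfl

/-- A first-order expansion with majorant `|F|` suffices, so no second moment of the Hessian is
needed. The Hessian is frozen at `v₀` while the sample follows `v n`. -/
lemma RegularOn.tendsto_integral_cexp_hess [IsProbabilityMeasure P] (hM : M.Nondegenerate)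
    (h : M.RegularOn P v₀ ε F) {v : ℕ → Vec p} (hv : Tendsto v atTop (𝓝 v₀)) (t u : Vec p) (τ : ℝ) :
    Tendsto (fun n : ℕ => (n : ℂ) * (∫ z, Complex.exp (((n : ℝ)⁻¹ * (M.etaHess (eta0 v₀ z.1) z.2 *
      (τ * (eta0 t z.1 * eta0 u z.1))) : ℝ) * Complex.I) ∂(M.armLaw P (eta0 (v n))) - 1))
      atTop (𝓝 ((τ * -⟪t, Matrix.toEuclideanLin (M.info0 P v₀) u⟫ : ℝ) * Complex.I)) := by
  have hball := hv.eventually (Metric.ball_mem_nhds _ h.pos)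
  have hval : ((τ * -⟪t, Matrix.toEuclideanLin (M.info0 P v₀) u⟫ : ℝ) * Complex.I : ℂ)
      = ∫ x, ((-(M.etaInfo (eta0 v₀ x) * (τ * (eta0 t x * eta0 u x))) : ℝ) * Complex.I : ℂ) ∂P := by
    rw [h.inner_info0 hM, integral_mul_const, integral_complex_ofReal, integral_neg,
      ← integral_neg, ← integral_neg, ← integral_const_mul]
    congr 3
    ext x
    ring
  rw [hval]
  have hm := measurable_etaHess_comp hM v₀
  have hm2 : Measurable fun z : Vec p × ℝ => eta0 t z.1 := (measurable_eta0 t).comp measurable_fst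
  have hm3 : Measurable fun z : Vec p × ℝ => eta0 u z.1 := (measurable_eta0 u).comp measurable_fst
  have hlim : Tendsto (fun n : ℕ => ∫ x, (n : ℂ) * (∫ y, (Complex.exp (((n : ℝ)⁻¹ *
      (M.etaHess (eta0 v₀ x) y * (τ * (eta0 t x * eta0 u x))) : ℝ) * Complex.I) - 1)
      ∂(M.law (M.canon (eta0 (v n) x)))) ∂P) atTop
      (𝓝 (∫ x, ((-(M.etaInfo (eta0 v₀ x) * (τ * (eta0 t x * eta0 u x))) : ℝ) * Complex.I : ℂ) ∂P)) := by
    refine tendsto_integral_filter_of_dominated_convergence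
      (fun x => |τ| * ‖t‖ * ‖u‖ * |F x|) ?_ ?_ (h.integrable.abs.const_mul _) ?_
    · filter_upwards [hball] with n hn
      have hd := M.measurable_armDensity hM (v n)
      have : StronglyMeasurable fun z : Vec p × ℝ => M.density (M.canon (eta0 (v n) z.1)) z.2 •
          (Complex.exp (((n : ℝ)⁻¹ * (M.etaHess (eta0 v₀ z.1) z.2 *
            (τ * (eta0 t z.1 * eta0 u z.1))) : ℝ) * Complex.I) - 1) :=
        Measurable.stronglyMeasurable (by fun_prop)
      simp_rw [ExpFamily.integral_law]
      have hsf := M.sigmaFinite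
      exact (this.integral_prod_right (ν := M.ν)).aestronglyMeasurable.const_mul _
    · filter_upwards [hball] with n hn
      filter_upwards [h.mem, h.integral_abs_etaHess_le] with x h1 h2
      refine (norm_mul_integral_cexp_etaHess_le (h1 _ hn) _ _).trans ?_
      have h3 : 0 ≤ ∫ y, |M.etaHess (eta0 v₀ x) y| ∂(M.law (M.canon (eta0 (v n) x))) :=
        integral_nonneg fun y => abs_nonneg _
      rw [abs_mul]
      calc _ ≤ (∫ y, |M.etaHess (eta0 v₀ x) y| ∂(M.law (M.canon (eta0 (v n) x)))) *
            (|τ| * (‖t‖ * ‖u‖ * ‖x‖ ^ 2)) := by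
            gcongr; exact abs_eta0_mul_eta0_le t u x
        _ = |τ| * ‖t‖ * ‖u‖ * ((∫ y, |M.etaHess (eta0 v₀ x) y|
            ∂(M.law (M.canon (eta0 (v n) x)))) * ‖x‖ ^ 2) := by ring
        _ ≤ _ := by gcongr; exact h2 _ hn
    · filter_upwards [h.mem] with x h1
      have h0 := h1 v₀ (Metric.mem_ball_self h.pos)
      exact tendsto_integral_cexp_etaHess hM h0 (((continuous_eta0 x).tendsto v₀).comp hv) _
  refine hlim.congr' ?_
  filter_upwards [hball] with n hn
  have hp := M.isProbabilityMeasure_armLaw P hM (h.ae_mem hn)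
  rw [integral_const_mul]
  congr 1
  have hi : Integrable (fun z : Vec p × ℝ => Complex.exp (((n : ℝ)⁻¹ * (M.etaHess (eta0 v₀ z.1) z.2 *
      (τ * (eta0 t z.1 * eta0 u z.1))) : ℝ) * Complex.I)) (M.armLaw P (eta0 (v n))) := by
    refine Integrable.of_bound (C := 1) (Measurable.aestronglyMeasurable (by fun_prop))
      (ae_of_all _ fun z => ?_)
    rw [Complex.norm_exp_ofReal_mul_I]
  have h1 : ∫ z, Complex.exp (((n : ℝ)⁻¹ * (M.etaHess (eta0 v₀ z.1) z.2 *
      (τ * (eta0 t z.1 * eta0 u z.1))) : ℝ) * Complex.I) ∂(M.armLaw P (eta0 (v n))) - 1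
      = ∫ z, (Complex.exp (((n : ℝ)⁻¹ * (M.etaHess (eta0 v₀ z.1) z.2 *
      (τ * (eta0 t z.1 * eta0 u z.1))) : ℝ) * Complex.I) - 1) ∂(M.armLaw P (eta0 (v n))) := by
    rw [integral_sub hi (integrable_const _)]; simp
  rw [h1]
  exact (M.integral_armLaw P hM (v n) (hi.sub (integrable_const 1))).symm

section Rows

variable {Ω : ℕ → Type*} [∀ n, MeasurableSpace (Ω n)] {Pr : ∀ n, Measure (Ω n)}
  {D : ∀ n, Fin n → Ω n → Vec p × ℝ} {v : ℕ → Vec p}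

/-- The weak law of large numbers for the Hessian of the log-likelihood. -/
lemma RegularOn.tendsto_measure_avg_hess [∀ n, IsProbabilityMeasure (Pr n)]
    [IsProbabilityMeasure P] (hM : M.Nondegenerate)
    (h : M.RegularOn P v₀ ε F) (hv : Tendsto v atTop (𝓝 v₀))
    (hD : ∀ n i, Measurable (D n i)) (hind : ∀ᶠ n in atTop, iIndepFun (D n) (Pr n))
    (hlaw : ∀ᶠ n in atTop, ∀ i, HasLaw (D n i) (M.armLaw P (eta0 (v n))) (Pr n))
    (t u : Vec p) {r : ℝ} (hr : 0 < r) :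
    Tendsto (fun n => Pr n {ω | r ≤ |(n : ℝ)⁻¹ * ∑ i, M.etaHess (eta0 v₀ (D n i ω).1) (D n i ω).2 *
      (eta0 t (D n i ω).1 * eta0 u (D n i ω).1)
      + ⟪t, Matrix.toEuclideanLin (M.info0 P v₀) u⟫|}) atTop (𝓝 0) := by
  have hm := measurable_etaHess_comp hM v₀
  have hm2 : Measurable fun z : Vec p × ℝ => eta0 t z.1 := (measurable_eta0 t).comp measurable_fst
  have hm3 : Measurable fun z : Vec p × ℝ => eta0 u z.1 := (measurable_eta0 u).comp measurable_fst
  have key := tendsto_measure_abs_sub_ge_of_charFun (Pr := Pr)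
    (X := fun n ω => (n : ℝ)⁻¹ * ∑ i, M.etaHess (eta0 v₀ (D n i ω).1) (D n i ω).2 *
      (eta0 t (D n i ω).1 * eta0 u (D n i ω).1)) ?_
    (m := -⟪t, Matrix.toEuclideanLin (M.info0 P v₀) u⟫) ?_ hr
  · simpa only [sub_neg_eq_add] using key
  · intro n
    refine (Finset.measurable_sum _ fun i _ => ?_).const_mul _
    exact (hm.mul (hm2.mul hm3)).comp (hD n i)
  · intro τ
    have h1 := Complex.tendsto_one_add_pow_exp_of_tendsto (h.tendsto_integral_cexp_hess hM hv t u τ)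
    refine h1.congr' ?_
    filter_upwards [hind, hlaw] with n hi hl
    have := integral_cexp_sum hi hl (f := fun z => (n : ℝ)⁻¹ * (M.etaHess (eta0 v₀ z.1) z.2 *
      (τ * (eta0 t z.1 * eta0 u z.1)))) (by fun_prop)
    rw [add_sub_cancel, ← this]
    refine integral_congr_ae (ae_of_all _ fun ω => ?_)
    simp only [Finset.mul_sum]
    congr 3
    refine Finset.sum_congr rfl fun i _ => ?_
    ring

end Rows

end GLM

lemma norm_le_sum_abs {p : ℕ} (w : Vec p) : ‖w‖ ≤ ∑ i, |w i| := by
  have h : w = ∑ i, w i • EuclideanSpace.single i (1 : ℝ) := by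
    ext j
    simp [Finset.sum_apply, Pi.single_apply]
  calc ‖w‖ = ‖∑ i, w i • EuclideanSpace.single i (1 : ℝ)‖ := by rw [← h]
    _ ≤ ∑ i, ‖w i • EuclideanSpace.single i (1 : ℝ)‖ := norm_sum_le _ _
    _ = _ := by simp [norm_smul]

/-! ### The oscillation of the Hessian near `v₀`. -/

namespace GLM

variable {M : GLM} {p : ℕ} {P : Measure (Vec p)} {v₀ : Vec p} {ε : ℝ} {F : Vec p → ℝ}

variable (M) in
/-- The oscillation of the Hessian of the log-likelihood of one observation over a ball. -/
def hessOsc (v₀ : Vec p) (ρ : ℝ) (z : Vec p × ℝ) : ℝ≥0∞ :=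
  ⨆ k, ⨆ (_ : TopologicalSpace.denseSeq (Vec p) k ∈ Metric.ball v₀ ρ), ENNReal.ofReal
    (|M.etaHess (eta0 (TopologicalSpace.denseSeq (Vec p) k) z.1) z.2 - M.etaHess (eta0 v₀ z.1) z.2|
      * ‖z.1‖ ^ 2)

lemma measurable_hessOsc (hM : M.Nondegenerate) (v₀ : Vec p) (ρ : ℝ) :
    Measurable (M.hessOsc v₀ ρ) := by
  refine Measurable.iSup fun k => Measurable.iSup_Prop _ ?_
  have h1 := measurable_etaHess_comp hM (TopologicalSpace.denseSeq (Vec p) k)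
  have h2 := measurable_etaHess_comp hM v₀
  exact (((continuous_abs.measurable.comp (h1.sub h2))).mul
    (measurable_fst.norm.pow_const 2)).ennreal_ofReal

/-- The dense sequence in the definition is there for measurability; continuity in the coefficient
vector recovers the whole ball. -/
lemma le_hessOsc (hM : M.Nondegenerate) {ρ : ℝ} {x : Vec p}
    (hx : ∀ u ∈ Metric.ball v₀ ρ, eta0 u x ∈ M.predictorRange) {u : Vec p}
    (hu : u ∈ Metric.ball v₀ ρ) (y : ℝ) :
    ENNReal.ofReal (|M.etaHess (eta0 u x) y - M.etaHess (eta0 v₀ x) y| * ‖x‖ ^ 2)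
      ≤ M.hessOsc v₀ ρ (x, y) := by
  have hcl := (TopologicalSpace.denseRange_denseSeq (Vec p)).open_subset_closure_inter
    (Metric.isOpen_ball (x := v₀) (ε := ρ)) hu
  rw [mem_closure_iff_frequently] at hcl
  have hc : ContinuousAt (fun w : Vec p => ENNReal.ofReal
      (|M.etaHess (eta0 w x) y - M.etaHess (eta0 v₀ x) y| * ‖x‖ ^ 2)) u := by
    refine ENNReal.continuous_ofReal.continuousAt.comp ?_
    have h1 : ContinuousAt (fun w : Vec p => M.etaHess (eta0 w x) y) u :=
      (M.continuousAt_etaHess hM (hx u hu) y).comp (f := fun w => eta0 w x)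
        (continuous_eta0 x).continuousAt
    exact ((h1.sub continuousAt_const).abs).mul continuousAt_const
  refine le_of_tendsto_of_frequently hc.tendsto (hcl.mono ?_)
  rintro w ⟨hw, k, rfl⟩
  exact le_iSup₂_of_le k hw le_rfl

/-- For a small radius the oscillation is at most `κ ‖x‖² (1 + |y|)`, and the mean of `1 + |y|`
stays below `K + 1` for large `n`. -/
lemma RegularOn.tendsto_lintegral_hessOsc_law (hM : M.Nondegenerate) (h : M.RegularOn P v₀ ε F)
    {v : ℕ → Vec p} (hv : Tendsto v atTop (𝓝 v₀)) {x : Vec p}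
    (hx : ∀ u ∈ Metric.ball v₀ ε, eta0 u x ∈ M.predictorRange) :
    Tendsto (fun q : ℕ × ℝ => ∫⁻ y, M.hessOsc v₀ q.2 (x, y)
      ∂(M.law (M.canon (eta0 (v q.1) x)))) (atTop ×ˢ 𝓝[>] 0) (𝓝 0) := by
  have hη₀ := hx v₀ (Metric.mem_ball_self h.pos)
  set η₀ := eta0 v₀ x with hη₀def
  have hη : Tendsto (fun n => eta0 (v n) x) atTop (𝓝 η₀) := ((continuous_eta0 x).tendsto v₀).comp hv
  have hint := M.tendsto_integral_law (M.canon_mem hη₀) ((M.continuousAt_canon hM hη₀).tendsto.comp hη)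
    (f := fun _ y => 1 + |y|) (f₀ := fun y => 1 + |y|) (C := 1) (k := 1)
    (Eventually.of_forall fun _ => Measurable.aestronglyMeasurable (by fun_prop))
    (Eventually.of_forall fun _ y => by rw [Real.norm_of_nonneg (by positivity)]; simp)
    fun _ => tendsto_const_nhds
  set K := ∫ y, 1 + |y| ∂(M.law (M.canon η₀)) with hK
  have hK0 : 0 ≤ K := integral_nonneg fun y => by positivity
  rw [ENNReal.tendsto_nhds_zero]
  intro e he
  obtain ⟨κ, hκ0, hκ⟩ : ∃ κ : ℝ, 0 < κ ∧ ENNReal.ofReal (κ * ‖x‖ ^ 2 * (K + 1)) ≤ e := by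
    by_cases htop : e = ⊤
    · exact ⟨1, one_pos, htop ▸ le_top⟩
    · have he' := ENNReal.toReal_pos he.ne' htop
      refine ⟨e.toReal / (‖x‖ ^ 2 * (K + 1) + 1), by positivity, ?_⟩
      rw [ENNReal.ofReal_le_iff_le_toReal htop]
      rw [mul_assoc, div_mul_eq_mul_div, div_le_iff₀ (by positivity)]
      gcongr; linarith
  have hd : Tendsto (fun w : Vec p => |deriv M.sensitivity (eta0 w x) - deriv M.sensitivity η₀|
      + |(M.meanAt (eta0 w x) * deriv M.sensitivity (eta0 w x) + M.etaInfo (eta0 w x))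
        - (M.meanAt η₀ * deriv M.sensitivity η₀ + M.etaInfo η₀)|) (𝓝 v₀) (𝓝 0) := by
    have hc := (continuous_eta0 x).tendsto v₀
    have h1 := (M.continuousAt_deriv_sensitivity hM hη₀).tendsto.comp hc
    have h2 := (M.contDiffAt_meanAt hM hη₀).continuousAt.tendsto.comp hc
    have h3 := (M.continuousAt_etaInfo hM hη₀).tendsto.comp hc
    have h4 := (h1.sub_const (deriv M.sensitivity η₀)).abs.add
      (((h2.mul h1).add h3).sub_const (M.meanAt η₀ * deriv M.sensitivity η₀ + M.etaInfo η₀)).abs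
    simpa using h4
  obtain ⟨ρ₀, hρ₀, hsmall⟩ := Metric.eventually_nhds_iff_ball.1
    (hd.eventually (gt_mem_nhds hκ0))
  have hρ : ∀ᶠ ρ : ℝ in 𝓝[>] 0, ρ < ρ₀ :=
    (eventually_nhdsWithin_of_eventually_nhds (gt_mem_nhds hρ₀))
  have hn : ∀ᶠ n in atTop, ∫ y, 1 + |y| ∂(M.law (M.canon (eta0 (v n) x))) < K + 1 :=
    hint.eventually (gt_mem_nhds (lt_add_one K))
  have hmem : ∀ᶠ n in atTop, eta0 (v n) x ∈ M.predictorRange :=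
    (hv.eventually (Metric.ball_mem_nhds _ h.pos)).mono fun n hn => hx _ hn
  filter_upwards [(hn.and hmem).prod_mk hρ] with q hq
  obtain ⟨⟨hq1, hq2⟩, hq3⟩ := hq
  have := M.isProbabilityMeasure_law (M.canon_mem hq2)
  have hi : Integrable (fun y : ℝ => 1 + |y|) (M.law (M.canon (eta0 (v q.1) x))) :=
    (integrable_const _).add (M.integrable_id_law (M.canon_mem hq2)).abs
  calc _ ≤ ∫⁻ y, ENNReal.ofReal (κ * ‖x‖ ^ 2 * (1 + |y|)) ∂(M.law (M.canon (eta0 (v q.1) x))) := by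
        refine lintegral_mono fun y => iSup₂_le fun k hk => ENNReal.ofReal_le_ofReal ?_
        have h1 := hsmall _ (Metric.ball_subset_ball hq3.le hk)
        calc _ ≤ (κ * (1 + |y|)) * ‖x‖ ^ 2 := by
              gcongr
              exact (abs_etaHess_sub_le _ _ y).trans (by gcongr)
          _ = _ := by ring
    _ = ENNReal.ofReal (∫ y, κ * ‖x‖ ^ 2 * (1 + |y|) ∂(M.law (M.canon (eta0 (v q.1) x)))) := by
        rw [ofReal_integral_eq_lintegral_ofReal (hi.const_mul _)
          (ae_of_all _ fun y => by positivity)]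
    _ ≤ ENNReal.ofReal (κ * ‖x‖ ^ 2 * (K + 1)) := by
        rw [integral_const_mul]
        gcongr
    _ ≤ e := hκ

lemma hessOsc_le {ρ : ℝ} (hρ : ρ ≤ ε) (hε : 0 < ε) (x : Vec p) (y : ℝ) :
    M.hessOsc v₀ ρ (x, y) ≤ 2 * ⨆ u ∈ Metric.ball v₀ ε,
      ENNReal.ofReal (|M.etaHess (eta0 u x) y| * ‖x‖ ^ 2) := by
  refine iSup₂_le fun k hk => ?_
  rw [two_mul]
  refine le_trans ?_ (add_le_add (le_iSup₂_of_le _ (Metric.ball_subset_ball hρ hk) le_rfl)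
    (le_iSup₂_of_le v₀ (Metric.mem_ball_self hε) le_rfl))
  rw [← ENNReal.ofReal_add (by positivity) (by positivity), ← add_mul]
  refine ENNReal.ofReal_le_ofReal ?_
  gcongr
  exact abs_sub _ _

/-- Dominated convergence over the covariates with majorant `2 F`. The limit is joint in `n` and the
radius, so that a radius can later be fixed before `n`. -/
lemma RegularOn.tendsto_lintegral_hessOsc [IsProbabilityMeasure P] (hM : M.Nondegenerate)
    (h : M.RegularOn P v₀ ε F) {v : ℕ → Vec p} (hv : Tendsto v atTop (𝓝 v₀)) :
    Tendsto (fun q : ℕ × ℝ => ∫⁻ z, M.hessOsc v₀ q.2 z ∂(M.armLaw P (eta0 (v q.1))))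
      (atTop ×ˢ 𝓝[>] 0) (𝓝 0) := by
  simp_rw [fun q : ℕ × ℝ => M.lintegral_armLaw P hM (v q.1) (measurable_hessOsc hM v₀ q.2)]
  have hz : (0 : ℝ≥0∞) = ∫⁻ _, 0 ∂P := by simp
  rw [hz]
  have hball := hv.eventually (Metric.ball_mem_nhds _ h.pos)
  have hρ : ∀ᶠ ρ : ℝ in 𝓝[>] 0, ρ < ε :=
    (eventually_nhdsWithin_of_eventually_nhds (gt_mem_nhds h.pos))
  refine tendsto_lintegral_filter_of_dominated_convergence (fun x => 2 * ENNReal.ofReal (F x))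
    (Eventually.of_forall fun q => ?_) ?_ ?_ ?_
  · have hd := (M.measurable_armDensity hM (v q.1)).ennreal_ofReal
    have hsf := M.sigmaFinite
    simp_rw [ExpFamily.lintegral_law]
    exact (hd.mul (measurable_hessOsc hM v₀ q.2)).lintegral_prod_right'
  · filter_upwards [hball.prod_mk hρ] with q hq
    filter_upwards [h.hess_le] with x hx
    calc _ ≤ ∫⁻ y, 2 * ⨆ u ∈ Metric.ball v₀ ε,
        ENNReal.ofReal (|M.etaHess (eta0 u x) y| * ‖x‖ ^ 2) ∂(M.law (M.canon (eta0 (v q.1) x))) :=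
          lintegral_mono fun y => hessOsc_le hq.2.le h.pos x y
      _ = 2 * ∫⁻ y, ⨆ u ∈ Metric.ball v₀ ε,
        ENNReal.ofReal (|M.etaHess (eta0 u x) y| * ‖x‖ ^ 2) ∂(M.law (M.canon (eta0 (v q.1) x))) :=
          lintegral_const_mul' _ _ (by norm_num)
      _ ≤ _ := by gcongr; exact hx _ hq.1
  · rw [lintegral_const_mul' _ _ (by norm_num)]
    exact ENNReal.mul_ne_top (by norm_num) 
      ((lintegral_ofReal_le_lintegral_enorm F).trans_lt h.integrable.2).ne
  · filter_upwards [h.mem] with x hx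
    exact h.tendsto_lintegral_hessOsc_law hM hv hx

/-- The mean value inequality for the scalar score on the segment from `v₀` to `u`. Finiteness is
required because `toReal` sends `⊤` to zero. -/
lemma etaScore_sub_linear_le (hM : M.Nondegenerate) {ρ : ℝ} {x : Vec p}
    (hx : ∀ u ∈ Metric.ball v₀ ρ, eta0 u x ∈ M.predictorRange) {u : Vec p}
    (hu : u ∈ Metric.ball v₀ ρ) {y : ℝ} (hfin : M.hessOsc v₀ ρ (x, y) ≠ ⊤) :
    ‖(M.etaScore (eta0 u x) y - M.etaScore (eta0 v₀ x) y
      - M.etaHess (eta0 v₀ x) y * eta0 (u - v₀) x) • x‖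
      ≤ (M.hessOsc v₀ ρ (x, y)).toReal * ‖u - v₀‖ := by
  rcases eq_or_ne x 0 with rfl | hx0
  · simp only [smul_zero, norm_zero]; positivity
  have hxn : 0 < ‖x‖ := norm_pos_iff.2 hx0
  have hρ : 0 < ρ := (dist_nonneg).trans_lt hu
  set C := (M.hessOsc v₀ ρ (x, y)).toReal / ‖x‖ ^ 2 with hC
  set H₀ := M.etaHess (eta0 v₀ x) y with hH₀
  set d := eta0 (u - v₀) x with hd
  have hseg : ∀ s ∈ Set.Icc (0 : ℝ) 1, v₀ + s • (u - v₀) ∈ Metric.ball v₀ ρ := by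
    intro s hs
    have h1 := (convex_ball v₀ ρ) (Metric.mem_ball_self hρ) hu (sub_nonneg.2 hs.2) hs.1 (by ring)
    convert h1 using 1
    module
  have heta : ∀ s : ℝ, eta0 (v₀ + s • (u - v₀)) x = eta0 v₀ x + s * d := fun s => by
    rw [eta0_add, eta0_smul]
  have hder : ∀ s ∈ Set.Icc (0 : ℝ) 1, HasDerivWithinAt
      (fun s : ℝ => M.etaScore (eta0 v₀ x + s * d) y - s * (H₀ * d))
      ((M.etaHess (eta0 v₀ x + s * d) y - H₀) * d) (Set.Icc 0 1) s := by
    intro s hs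
    have hm := hx _ (hseg s hs)
    rw [heta] at hm
    have h1 : HasDerivAt (fun s : ℝ => eta0 v₀ x + s * d) d s := by
      simpa using ((hasDerivAt_id s).mul_const d).const_add (eta0 v₀ x)
    have h2 := (M.hasDerivAt_etaScore hM hm y).comp s h1
    have h3 := h2.sub ((hasDerivAt_id s).mul_const (H₀ * d))
    refine (h3.congr_deriv ?_).hasDerivWithinAt
    ring
  have hbd : ∀ s ∈ Set.Icc (0 : ℝ) 1, ‖(M.etaHess (eta0 v₀ x + s * d) y - H₀) * d‖ ≤ C * |d| := by
    intro s hs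
    have h1 := le_hessOsc hM hx (hseg s hs) y
    rw [ENNReal.ofReal_le_iff_le_toReal hfin, heta] at h1
    rw [norm_mul, Real.norm_eq_abs, Real.norm_eq_abs]
    gcongr
    rwa [hC, le_div_iff₀ (by positivity)]
  have hmv := (convex_Icc (0 : ℝ) 1).norm_image_sub_le_of_norm_hasDerivWithin_le hder hbd
    (Set.left_mem_Icc.2 zero_le_one) (Set.right_mem_Icc.2 zero_le_one)
  have hu' : eta0 u x = eta0 v₀ x + d := by rw [hd, eta0_sub]; ring
  rw [norm_smul]
  have h4 : ‖M.etaScore (eta0 u x) y - M.etaScore (eta0 v₀ x) y - H₀ * d‖ ≤ C * |d| := by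
    rw [hu']
    refine le_trans (le_of_eq ?_) (hmv.trans (le_of_eq (by simp)))
    congr 1
    ring_nf
  have hC0 : 0 ≤ C := by positivity
  calc _ ≤ (C * |d|) * ‖x‖ := by gcongr
    _ ≤ (C * (‖u - v₀‖ * ‖x‖)) * ‖x‖ := by gcongr; exact abs_eta0_le _ _
    _ = (C * ‖x‖ ^ 2) * ‖u - v₀‖ := by ring
    _ = _ := by rw [hC, div_mul_cancel₀ _ (by positivity)]

end GLM

lemma norm_linearMap_apply_le {p : ℕ} (Q : Vec p →ₗ[ℝ] Vec p) (w : Vec p) :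
    ‖Q w‖ ≤ (∑ k, ∑ j, |⟪EuclideanSpace.single j (1 : ℝ), Q (EuclideanSpace.single k 1)⟫|) * ‖w‖ := by
  have h : w = ∑ i, w i • EuclideanSpace.single i (1 : ℝ) := by
    ext j
    simp [Finset.sum_apply, Pi.single_apply]
  calc ‖Q w‖ = ‖∑ i, w i • Q (EuclideanSpace.single i (1 : ℝ))‖ := by
        conv_lhs => rw [h]
        rw [map_sum]; simp_rw [map_smul]
    _ ≤ ∑ i, ‖w i • Q (EuclideanSpace.single i (1 : ℝ))‖ := norm_sum_le _ _
    _ ≤ ∑ k, (∑ j, |⟪EuclideanSpace.single j (1 : ℝ), Q (EuclideanSpace.single k 1)⟫|) * ‖w‖ := by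
        refine Finset.sum_le_sum fun k _ => ?_
        rw [norm_smul, mul_comm]
        gcongr
        · refine (norm_le_sum_abs _).trans (le_of_eq ?_)
          refine Finset.sum_congr rfl fun j _ => ?_
          rw [EuclideanSpace.inner_single_left]; simp
        · exact PiLp.norm_apply_le w k
    _ = _ := by rw [Finset.sum_mul]

/-! ### Linearization of the average score. -/

namespace GLM

variable {M : GLM} {p : ℕ} {P : Measure (Vec p)} {v₀ : Vec p} {ε : ℝ} {F : Vec p → ℝ}

variable (M) in
/-- The empirical Hessian at `v₀` plus the information matrix. -/
def hessError (P : Measure (Vec p)) (v₀ : Vec p) {n : ℕ} (d : Fin n → Vec p × ℝ) :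
    Vec p →ₗ[ℝ] Vec p :=
  (n : ℝ)⁻¹ • ∑ i, M.etaHess (eta0 v₀ (d i).1) (d i).2 •
    ((innerSL ℝ (d i).1).toLinearMap.smulRight (d i).1) + Matrix.toEuclideanLin (M.info0 P v₀)

lemma hessError_apply {n : ℕ} (d : Fin n → Vec p × ℝ) (w : Vec p) :
    M.hessError P v₀ d w = (n : ℝ)⁻¹ • ∑ i, (M.etaHess (eta0 v₀ (d i).1) (d i).2 *
      eta0 w (d i).1) • (d i).1 + Matrix.toEuclideanLin (M.info0 P v₀) w := by
  simp [hessError, LinearMap.sum_apply, smul_smul, eta0, real_inner_comm]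

lemma inner_hessError {n : ℕ} (d : Fin n → Vec p × ℝ) (t w : Vec p) :
    ⟪t, M.hessError P v₀ d w⟫ = (n : ℝ)⁻¹ * ∑ i, M.etaHess (eta0 v₀ (d i).1) (d i).2 *
      (eta0 t (d i).1 * eta0 w (d i).1) + ⟪t, Matrix.toEuclideanLin (M.info0 P v₀) w⟫ := by
  rw [hessError_apply, inner_add_right, real_inner_smul_right, inner_sum]
  congr 2
  refine Finset.sum_congr rfl fun i _ => ?_
  simp only [real_inner_smul_right, eta0]; ring

/-- The linearization error of the score, bounded by the error of the Hessian at `v₀` and the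
oscillation of the Hessian. -/
lemma norm_linearization_le (hM : M.Nondegenerate) {n : ℕ} {d : Fin n → Vec p × ℝ} {ρ : ℝ}
    (hd : ∀ i, ∀ u ∈ Metric.ball v₀ ρ, eta0 u (d i).1 ∈ M.predictorRange)
    {u : Vec p} (hu : u ∈ Metric.ball v₀ ρ) (hfin : ∑ i, M.hessOsc v₀ ρ (d i) ≠ ⊤) :
    ‖(n : ℝ)⁻¹ • ∑ i, (M.etaScore (eta0 u (d i).1) (d i).2 - M.etaScore (eta0 v₀ (d i).1) (d i).2)
      • (d i).1 + Matrix.toEuclideanLin (M.info0 P v₀) (u - v₀)‖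
      ≤ ((n : ℝ)⁻¹ * (∑ i, M.hessOsc v₀ ρ (d i)).toReal
        + ∑ k, ∑ j, |⟪EuclideanSpace.single j (1 : ℝ),
          M.hessError P v₀ d (EuclideanSpace.single k 1)⟫|) * ‖u - v₀‖ := by
  have hfin' : ∀ i, M.hessOsc v₀ ρ (d i) ≠ ⊤ := fun i =>
    (ENNReal.sum_ne_top.1 hfin) i (Finset.mem_univ i)
  have heq : (n : ℝ)⁻¹ • ∑ i, (M.etaScore (eta0 u (d i).1) (d i).2
      - M.etaScore (eta0 v₀ (d i).1) (d i).2) • (d i).1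
      + Matrix.toEuclideanLin (M.info0 P v₀) (u - v₀)
      = (n : ℝ)⁻¹ • ∑ i, (M.etaScore (eta0 u (d i).1) (d i).2 - M.etaScore (eta0 v₀ (d i).1) (d i).2
        - M.etaHess (eta0 v₀ (d i).1) (d i).2 * eta0 (u - v₀) (d i).1) • (d i).1
        + M.hessError P v₀ d (u - v₀) := by
    rw [hessError_apply, ← add_assoc, ← smul_add, ← Finset.sum_add_distrib]
    congr 2
    refine Finset.sum_congr rfl fun i _ => ?_
    module
  rw [heq, add_mul]
  refine (norm_add_le _ _).trans (add_le_add ?_ (norm_linearMap_apply_le _ _))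
  rw [norm_smul, Real.norm_of_nonneg (by positivity), mul_assoc]
  gcongr
  rw [ENNReal.toReal_sum fun i _ => hfin' i, Finset.sum_mul]
  refine (norm_sum_le _ _).trans (Finset.sum_le_sum fun i _ => ?_)
  exact etaScore_sub_linear_le hM (hd i) hu (hfin' i)

section Rows

variable {Ω : ℕ → Type*} [∀ n, MeasurableSpace (Ω n)] {Pr : ∀ n, Measure (Ω n)}
  {D : ∀ n, Fin n → Ω n → Vec p × ℝ} {v : ℕ → Vec p}

lemma RegularOn.ae_forall_mem (h : M.RegularOn P v₀ ε F) {n : ℕ} {w : Vec p}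
    (hlaw : ∀ i, HasLaw (D n i) (M.armLaw P (eta0 w)) (Pr n)) :
    ∀ᵐ ω ∂(Pr n), ∀ i, ∀ u ∈ Metric.ball v₀ ε, eta0 u (D n i ω).1 ∈ M.predictorRange := by
  refine ae_all_iff.2 fun i => ?_
  have h1 := M.ae_armLaw_fst P w h.mem
  rw [← (hlaw i).map_eq] at h1
  exact ae_of_ae_map (hlaw i).aemeasurable h1

/-- At a consistent sequence of estimators, the average score is, up to a negligible factor,
linear in the estimation error, with slope minus the information. -/
lemma RegularOn.tendsto_measure_linearization [∀ n, IsProbabilityMeasure (Pr n)]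
    [IsProbabilityMeasure P] (hM : M.Nondegenerate)
    (h : M.RegularOn P v₀ ε F) (hv : Tendsto v atTop (𝓝 v₀))
    (hD : ∀ n i, Measurable (D n i)) (hind : ∀ᶠ n in atTop, iIndepFun (D n) (Pr n))
    (hlaw : ∀ᶠ n in atTop, ∀ i, HasLaw (D n i) (M.armLaw P (eta0 (v n))) (Pr n))
    {V : ∀ n, Ω n → Vec p}
    (hV : ∀ r > 0, Tendsto (fun n => Pr n {ω | ¬ ‖V n ω - v₀‖ < r}) atTop (𝓝 0))
    {κ : ℝ} (hκ : 0 < κ) :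
    Tendsto (fun n => Pr n {ω | ¬ ‖(n : ℝ)⁻¹ • ∑ i, (M.etaScore (eta0 (V n ω) (D n i ω).1) (D n i ω).2
      - M.etaScore (eta0 v₀ (D n i ω).1) (D n i ω).2) • (D n i ω).1
      + Matrix.toEuclideanLin (M.info0 P v₀) (V n ω - v₀)‖ ≤ κ * ‖V n ω - v₀‖}) atTop (𝓝 0) := by
  rw [ENNReal.tendsto_nhds_zero]
  intro e he
  -- Half of `κ` is shared among the `(p + 1)²` entries of the Hessian error at `v₀`; the other half
  -- is for the oscillation.
  set c : ℝ := κ / 2 / (((p + 1 : ℕ) : ℝ) * ((p + 1 : ℕ) : ℝ)) with hc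
  have hc0 : 0 < c := by positivity
  have he2 : 0 < e / 2 := ENNReal.div_pos he.ne' (by norm_num)
  have hosc : ∃ ρ : ℝ, 0 < ρ ∧ ρ < ε ∧ ∀ᶠ n in atTop,
      ∫⁻ z, M.hessOsc v₀ ρ z ∂(M.armLaw P (eta0 (v n))) ≤ e / 2 * ENNReal.ofReal (κ / 2) := by
    have h1 := ENNReal.tendsto_nhds_zero.1 (h.tendsto_lintegral_hessOsc hM hv)
      (e / 2 * ENNReal.ofReal (κ / 2)) (ENNReal.mul_pos he2.ne' (by simpa using hκ))
    -- With the radius as the outer variable, a single `ρ` serves all large `n`.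
    rw [Filter.eventually_swap_iff] at h1
    have h2 := h1.curry
    have hρ : ∀ᶠ ρ : ℝ in 𝓝[>] 0, ρ < ε :=
      (eventually_nhdsWithin_of_eventually_nhds (gt_mem_nhds h.pos))
    obtain ⟨ρ, ⟨hρ1, hρ2⟩, hρ3⟩ := ((h2.and hρ).and self_mem_nhdsWithin).exists
    exact ⟨ρ, hρ3, hρ2, hρ1⟩
  obtain ⟨ρ, hρ0, hρε, hρ⟩ := hosc
  have hsum : Tendsto (fun n => Pr n {ω | ¬ ‖V n ω - v₀‖ < ρ} + ∑ k, ∑ j,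
      Pr n {ω | c ≤ |⟪EuclideanSpace.single j (1 : ℝ),
          M.hessError P v₀ (fun i => D n i ω) (EuclideanSpace.single k 1)⟫|}) atTop (𝓝 0) := by
    have h1 : Tendsto (fun n => ∑ k, ∑ j, Pr n {ω | c ≤ |⟪EuclideanSpace.single j (1 : ℝ),
          M.hessError P v₀ (fun i => D n i ω) (EuclideanSpace.single k 1)⟫|}) atTop
          (𝓝 (∑ _k : Fin (p + 1), ∑ _j : Fin (p + 1), 0)) := by
      refine tendsto_finsetSum _ fun k _ => tendsto_finsetSum _ fun j _ => ?_
      simp_rw [inner_hessError]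
      exact h.tendsto_measure_avg_hess hM hv hD hind hlaw _ _ hc0
    simpa using (hV ρ hρ0).add h1
  filter_upwards [hρ, ENNReal.tendsto_nhds_zero.1 hsum _ he2, hlaw, eventually_gt_atTop 0]
    with n hn1 hn2 hn3 hn0
  have hn' : (0 : ℝ) < n := by exact_mod_cast hn0
  have hmk : Pr n {ω | ENNReal.ofReal (n * (κ / 2)) ≤ ∑ i, M.hessOsc v₀ ρ (D n i ω)} ≤ e / 2 := by
    have hm := measurable_hessOsc hM v₀ ρ
    refine (meas_ge_le_lintegral_div (Finset.measurable_fun_sum _ fun i _ =>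
      hm.comp (hD n i)).aemeasurable (ENNReal.ofReal_pos.2 (by positivity)).ne' ENNReal.ofReal_ne_top).trans ?_
    refine ENNReal.div_le_of_le_mul ?_
    simp only [Function.comp_apply]
    rw [lintegral_finsetSum (f := fun i ω => M.hessOsc v₀ ρ (D n i ω)) _ fun i _ => hm.comp (hD n i)]
    simp_rw [fun i => (hn3 i).lintegral_comp hm.aemeasurable]
    rw [Finset.sum_const, Finset.card_univ, Fintype.card_fin, nsmul_eq_mul,
      ENNReal.ofReal_mul hn'.le, ENNReal.ofReal_natCast]
    calc _ ≤ (n : ℝ≥0∞) * (e / 2 * ENNReal.ofReal (κ / 2)) := by gcongr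
      _ = _ := by ring
  refine le_trans ?_ ((add_le_add hn2 hmk).trans (ENNReal.add_halves e).le)
  have hU : Pr n (⋃ k, ⋃ j, {ω | c ≤ |⟪EuclideanSpace.single j (1 : ℝ),
          M.hessError P v₀ (fun i => D n i ω) (EuclideanSpace.single k 1)⟫|})
      ≤ ∑ k, ∑ j, Pr n {ω | c ≤ |⟪EuclideanSpace.single j (1 : ℝ),
          M.hessError P v₀ (fun i => D n i ω) (EuclideanSpace.single k 1)⟫|} :=
    (measure_iUnion_fintype_le _ _).trans
      (Finset.sum_le_sum fun k _ => measure_iUnion_fintype_le _ _)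
  refine le_trans ?_ (add_le_add (add_le_add le_rfl hU) le_rfl)
  refine le_trans ?_ (add_le_add (measure_union_le _ _) le_rfl)
  refine le_trans ?_ (measure_union_le _ _)
  refine measure_mono_ae ?_
  filter_upwards [h.ae_forall_mem hn3] with ω hω hbad
  by_contra hcon
  have hcon' : ω ∉ (({ω | ¬ ‖V n ω - v₀‖ < ρ} ∪ ⋃ k, ⋃ j, {ω | c ≤ |⟪EuclideanSpace.single j (1 : ℝ),
          M.hessError P v₀ (fun i => D n i ω) (EuclideanSpace.single k 1)⟫|})
      ∪ {ω | ENNReal.ofReal (n * (κ / 2)) ≤ ∑ i, M.hessOsc v₀ ρ (D n i ω)}) := hcon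
  simp only [Set.mem_union, Set.mem_iUnion, Set.mem_ofPred_eq, not_or, not_exists, not_le,
    not_not] at hcon'
  obtain ⟨⟨h1, h2⟩, h3⟩ := hcon'
  refine hbad ?_
  have hu : V n ω ∈ Metric.ball v₀ ρ := mem_ball_iff_norm.2 h1
  have hlin := norm_linearization_le (P := P) hM (d := fun i => D n i ω) (fun i w hw =>
    hω i w (Metric.ball_subset_ball hρε.le hw)) hu (h3.trans ENNReal.ofReal_lt_top).ne
  refine hlin.trans ?_
  gcongr
  have h4 : (∑ i, M.hessOsc v₀ ρ (D n i ω)).toReal ≤ n * (κ / 2) :=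
    ENNReal.toReal_le_of_le_ofReal (by positivity) h3.le
  have h5 : ∑ k, ∑ j, |⟪EuclideanSpace.single j (1 : ℝ),
      M.hessError P v₀ (fun i => D n i ω) (EuclideanSpace.single k 1)⟫| ≤ κ / 2 := by
    calc _ ≤ ∑ _k : Fin (p + 1), ∑ _j : Fin (p + 1), c :=
          Finset.sum_le_sum fun k _ => Finset.sum_le_sum fun j _ => (h2 k j).le
      _ = κ / 2 := by
          simp only [Finset.sum_const, Finset.card_univ, Fintype.card_fin, nsmul_eq_mul]
          rw [hc]; field_simp
  have h6 : (n : ℝ)⁻¹ * (∑ i, M.hessOsc v₀ ρ (D n i ω)).toReal ≤ κ / 2 := by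
    rw [inv_mul_le_iff₀ hn']; exact h4
  linarith

end Rows

end GLM

/-! ### Linear maps, two independent samples, and Slutsky's lemma. -/

lemma exists_linearMap_bound {p : ℕ} (Q : Vec p →ₗ[ℝ] Vec p) :
    ∃ c, 0 ≤ c ∧ ∀ w, ‖Q w‖ ≤ c * ‖w‖ :=
  ⟨_, Finset.sum_nonneg fun _ _ => Finset.sum_nonneg fun _ _ => abs_nonneg _,
    norm_linearMap_apply_le Q⟩

lemma toEuclideanLin_mul_apply {p : ℕ} (A B : Matrix (Fin (p + 1)) (Fin (p + 1)) ℝ) (w : Vec p) :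
    Matrix.toEuclideanLin (A * B) w = Matrix.toEuclideanLin A (Matrix.toEuclideanLin B w) := by
  simp [Matrix.toLpLin_apply]

lemma inner_toEuclideanLin_comm {p : ℕ} {A : Matrix (Fin (p + 1)) (Fin (p + 1)) ℝ}
    (t w : Vec p) : ⟪t, Matrix.toEuclideanLin A w⟫ = ⟪Matrix.toEuclideanLin A.transpose t, w⟫ := by
  simp only [EuclideanSpace.inner_eq_star_dotProduct, Matrix.toLpLin_apply, star_trivial]
  rw [dotProduct_comm, Matrix.dotProduct_mulVec, Matrix.mulVec_transpose, dotProduct_comm]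

/-- Characteristic functions of sums over two independent samples. -/
lemma integral_cexp_sum_add_sum {Ω E : Type*} [MeasurableSpace Ω] [MeasurableSpace E]
    {Pr : Measure Ω} {n : ℕ} {D₀ D₁ : Fin n → Ω → E}
    (hind : iIndepFun (fun k : Fin n ⊕ Fin n => Sum.elim D₀ D₁ k) Pr) {μ₀ μ₁ : Measure E}
    (h₀ : ∀ i, HasLaw (D₀ i) μ₀ Pr) (h₁ : ∀ i, HasLaw (D₁ i) μ₁ Pr) {f₀ f₁ : E → ℝ}
    (hf₀ : Measurable f₀) (hf₁ : Measurable f₁) :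
    ∫ ω, Complex.exp ((∑ i, f₀ (D₀ i ω) + ∑ i, f₁ (D₁ i ω) : ℝ) * Complex.I) ∂Pr
      = (∫ z, Complex.exp (f₀ z * Complex.I) ∂μ₀) ^ n
        * (∫ z, Complex.exp (f₁ z * Complex.I) ∂μ₁) ^ n := by
  have hg₀ : Measurable fun z => Complex.exp (f₀ z * Complex.I) := by fun_prop
  have hg₁ : Measurable fun z => Complex.exp (f₁ z * Complex.I) := by fun_prop
  let φ : Fin n ⊕ Fin n → E → ℂ := fun k => Sum.elim (fun _ z => Complex.exp (f₀ z * Complex.I))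
    (fun _ z => Complex.exp (f₁ z * Complex.I)) k
  have hφ : ∀ k, Measurable (φ k) := by rintro (i | i); exacts [hg₀, hg₁]
  have hm : ∀ k : Fin n ⊕ Fin n, AEMeasurable (Sum.elim D₀ D₁ k) Pr := by
    rintro (i | i); exacts [(h₀ i).aemeasurable, (h₁ i).aemeasurable]
  have h1 : ∀ ω, Complex.exp ((∑ i, f₀ (D₀ i ω) + ∑ i, f₁ (D₁ i ω) : ℝ) * Complex.I)
      = ∏ k, φ k (Sum.elim D₀ D₁ k ω) := fun ω => by
    rw [Fintype.prod_sum_type]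
    simp only [φ, Sum.elim_inl, Sum.elim_inr]
    rw [← Complex.exp_sum, ← Complex.exp_sum, ← Complex.exp_add]
    push_cast; rw [← Finset.sum_mul, ← Finset.sum_mul, add_mul]
  simp_rw [h1]
  rw [hind.integral_fun_prod_comp (f := φ) hm fun k => (hφ k).aestronglyMeasurable,
    Fintype.prod_sum_type]
  have h2 : ∀ i, ∫ ω, φ (Sum.inl i) (Sum.elim D₀ D₁ (Sum.inl i) ω) ∂Pr
      = ∫ z, Complex.exp (f₀ z * Complex.I) ∂μ₀ := fun i => by
    rw [← (h₀ i).map_eq, integral_map (h₀ i).aemeasurable hg₀.aestronglyMeasurable]; rfl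
  have h3 : ∀ i, ∫ ω, φ (Sum.inr i) (Sum.elim D₀ D₁ (Sum.inr i) ω) ∂Pr
      = ∫ z, Complex.exp (f₁ z * Complex.I) ∂μ₁ := fun i => by
    rw [← (h₁ i).map_eq, integral_map (h₁ i).aemeasurable hg₁.aestronglyMeasurable]; rfl
  simp_rw [h2, h3]
  simp

/-- Slutsky's lemma for characteristic functions, with varying probability spaces. -/
lemma tendsto_integral_cexp_of_sub {Ω : ℕ → Type*} [∀ n, MeasurableSpace (Ω n)]
    {Pr : ∀ n, Measure (Ω n)} [∀ n, IsProbabilityMeasure (Pr n)] {X Y : ∀ n, Ω n → ℝ}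
    (hX : ∀ n, Measurable (X n)) (hY : ∀ n, Measurable (Y n))
    (hXY : ∀ r > 0, Tendsto (fun n => Pr n {ω | r < |X n ω - Y n ω|}) atTop (𝓝 0)) {z : ℂ}
    (h : Tendsto (fun n => ∫ ω, Complex.exp (Y n ω * Complex.I) ∂(Pr n)) atTop (𝓝 z)) :
    Tendsto (fun n => ∫ ω, Complex.exp (X n ω * Complex.I) ∂(Pr n)) atTop (𝓝 z) := by
  refine h.congr_dist ?_
  rw [Metric.tendsto_nhds]
  intro e he
  have h1 := (ENNReal.tendsto_toReal ENNReal.zero_ne_top).comp (hXY (e / 2) (half_pos he))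
  filter_upwards [h1.eventually (gt_mem_nhds (show (0 : ℝ≥0∞).toReal < e / 4 by simp; positivity))]
    with n hn
  simp only [Function.comp_apply] at hn
  have hA : MeasurableSet {ω | e / 2 < |X n ω - Y n ω|} :=
    measurableSet_lt measurable_const (continuous_abs.measurable.comp ((hX n).sub (hY n)))
  have hiX : Integrable (fun ω => Complex.exp (X n ω * Complex.I)) (Pr n) := by
    have := hX n
    refine Integrable.of_bound (C := 1) (Measurable.aestronglyMeasurable (by fun_prop))
      (ae_of_all _ fun z => ?_)
    rw [Complex.norm_exp_ofReal_mul_I]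
  have hiY : Integrable (fun ω => Complex.exp (Y n ω * Complex.I)) (Pr n) := by
    have := hY n
    refine Integrable.of_bound (C := 1) (Measurable.aestronglyMeasurable (by fun_prop))
      (ae_of_all _ fun z => ?_)
    rw [Complex.norm_exp_ofReal_mul_I]
  rw [dist_zero_right, Real.norm_of_nonneg dist_nonneg, dist_eq_norm, ← integral_sub hiY hiX]
  have hpt : ∀ ω, ‖Complex.exp (Y n ω * Complex.I) - Complex.exp (X n ω * Complex.I)‖
      ≤ e / 2 + {ω | e / 2 < |X n ω - Y n ω|}.indicator (fun _ => (2 : ℝ)) ω := by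
    intro ω
    by_cases hω : e / 2 < |X n ω - Y n ω|
    · rw [Set.indicator_of_mem (show ω ∈ {ω | e / 2 < |X n ω - Y n ω|} from hω)]
      refine (norm_sub_le _ _).trans ?_
      rw [Complex.norm_exp_ofReal_mul_I, Complex.norm_exp_ofReal_mul_I]
      linarith
    · rw [Set.indicator_of_notMem (show ω ∉ {ω | e / 2 < |X n ω - Y n ω|} from hω), add_zero]
      have h2 : Complex.exp (Y n ω * Complex.I) - Complex.exp (X n ω * Complex.I)
          = Complex.exp (X n ω * Complex.I)
            * (Complex.exp ((Y n ω - X n ω : ℝ) * Complex.I) - 1) := by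
        rw [mul_sub, ← Complex.exp_add, mul_one]
        push_cast; ring_nf
      rw [h2, norm_mul, Complex.norm_exp_ofReal_mul_I, one_mul]
      refine (norm_cexp_mul_I_sub_one_le _).trans ?_
      rw [abs_sub_comm]
      exact not_lt.1 hω
  have hi : Integrable ({ω | e / 2 < |X n ω - Y n ω|}.indicator (fun _ => (2 : ℝ))) (Pr n) :=
    (integrable_const _).indicator hA
  calc _ ≤ ∫ ω, (e / 2 + {ω | e / 2 < |X n ω - Y n ω|}.indicator (fun _ => (2 : ℝ)) ω) ∂(Pr n) :=
        norm_integral_le_of_norm_le ((integrable_const _).add hi) (ae_of_all _ hpt)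
    _ = e / 2 + (Pr n {ω | e / 2 < |X n ω - Y n ω|}).toReal * 2 := by
        rw [integral_add (integrable_const _) hi, integral_indicator_const _ hA]
        simp [Measure.real]
    _ < e := by linarith

/-! ### The likelihood equation, normalized score sums and tightness. -/

namespace GLM

variable {M : GLM} {p : ℕ} {P : Measure (Vec p)} {v₀ : Vec p} {ε : ℝ} {F : Vec p → ℝ}

lemma isHermitian_info0 (P : Measure (Vec p)) (v : Vec p) : (M.info0 P v).IsHermitian := by
  ext i j
  simp only [Matrix.conjTranspose_apply, star_trivial, info0_apply]
  congr 1; ext x; ring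

lemma transpose_info0 (P : Measure (Vec p)) (v : Vec p) :
    (M.info0 P v).transpose = M.info0 P v := isHermitian_info0 P v

lemma RegularOn.posSemidef_info0 (hM : M.Nondegenerate) (h : M.RegularOn P v₀ ε F) :
    (M.info0 P v₀).PosSemidef := by
  refine Matrix.PosSemidef.of_dotProduct_mulVec_nonneg (isHermitian_info0 P v₀) fun w => ?_
  have h1 := h.inner_info0 hM (WithLp.toLp 2 w) (WithLp.toLp 2 w)
  have h2 : star w ⬝ᵥ (M.info0 P v₀).mulVec w
      = ⟪(WithLp.toLp 2 w : Vec p), Matrix.toEuclideanLin (M.info0 P v₀) (WithLp.toLp 2 w)⟫ := by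
    simp only [EuclideanSpace.inner_eq_star_dotProduct, Matrix.toLpLin_apply, star_trivial]
    rw [dotProduct_comm]
  rw [h2, h1]
  refine integral_nonneg_of_ae ?_
  filter_upwards [h.mem] with x hx
  have := (M.etaInfo_pos hM (hx v₀ (Metric.mem_ball_self h.pos))).le
  exact mul_nonneg this (mul_self_nonneg _)

/-- The likelihood equation. -/
lemma IsMLE.sum_score_eq_zero (hM : M.Nondegenerate) {n : ℕ} {d : Fin n → Vec p × ℝ} {θ : Vec p}
    (h : M.IsMLE d θ) : ∑ i, M.etaScore (eta0 θ (d i).1) (d i).2 • (d i).1 = 0 := by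
  refine ext_inner_left ℝ fun t => ?_
  rw [inner_zero_right, inner_sum]
  have hder : HasDerivAt (fun s : ℝ => ∑ i, M.logDensity (M.canon (eta0 (θ + s • t) (d i).1)) (d i).2)
      (∑ i, M.etaScore (eta0 θ (d i).1) (d i).2 * eta0 t (d i).1) 0 := by
    refine HasDerivAt.fun_sum fun i _ => ?_
    have h1 : HasDerivAt (fun s : ℝ => eta0 (θ + s • t) (d i).1) (eta0 t (d i).1) 0 := by
      simp_rw [eta0_add, eta0_smul]
      simpa using ((hasDerivAt_id (0 : ℝ)).mul_const (eta0 t (d i).1)).const_add (eta0 θ (d i).1)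
    have h2 := M.hasDerivAt_logDensity_canon hM (h.1 i) (d i).2
    have h3 : eta0 θ (d i).1 = eta0 (θ + (0 : ℝ) • t) (d i).1 := by simp
    refine (HasDerivAt.comp (0 : ℝ) (h₂ := fun η => M.logDensity (M.canon η) (d i).2) ?_ h1)
    rw [← h3]
    exact h2
  -- The admissible range is open, so the constrained maximum is an unconstrained local one along
  -- every line.
  have hmax : IsLocalMax
      (fun s : ℝ => ∑ i, M.logDensity (M.canon (eta0 (θ + s • t) (d i).1)) (d i).2) 0 := by
    have hadm : ∀ᶠ s : ℝ in 𝓝 0, ∀ i, eta0 (θ + s • t) (d i).1 ∈ M.predictorRange := by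
      refine eventually_all.2 fun i => ?_
      have hc : ContinuousAt (fun s : ℝ => eta0 (θ + s • t) (d i).1) 0 := by
        unfold eta0; fun_prop
      refine hc.tendsto.eventually ?_
      simp only [zero_smul, add_zero]
      exact M.eventually_mem_predictorRange hM (h.1 i)
    filter_upwards [hadm] with s hs
    simp only [zero_smul, add_zero]
    exact h.2 _ hs
  rw [← hmax.hasDerivAt_eq_zero hder]
  refine Finset.sum_congr rfl fun i _ => ?_
  rw [real_inner_smul_right]; rfl

variable (M) in
/-- The normalized sum of the scores of a sample at the coefficient vector `v`. -/
def scoreSum {n : ℕ} (v : Vec p) (d : Fin n → Vec p × ℝ) : Vec p :=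
  (√(n : ℝ))⁻¹ • ∑ i, M.etaScore (eta0 v (d i).1) (d i).2 • (d i).1

lemma measurable_scoreSum (hM : M.Nondegenerate) {Ω : Type*} [MeasurableSpace Ω] {n : ℕ}
    {D : Fin n → Ω → Vec p × ℝ} (hD : ∀ i, Measurable (D i)) {V : Ω → Vec p} (hV : Measurable V) :
    Measurable fun ω => M.scoreSum (V ω) fun i => D i ω := by
  have hi : ∀ i, Measurable fun ω => M.etaScore (eta0 (V ω) (D i ω).1) (D i ω).2 • (D i ω).1 := by
    intro i
    have h1 : Measurable fun ω => eta0 (V ω) (D i ω).1 := hV.inner (hD i).fst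
    exact ((M.measurable_etaScore hM).comp (h1.prodMk (hD i).snd)).smul (hD i).fst
  unfold scoreSum
  have hsum : Measurable fun ω => ∑ i, M.etaScore (eta0 (V ω) (D i ω).1) (D i ω).2 • (D i ω).1 :=
    Finset.measurable_fun_sum Finset.univ fun i _ => hi i
  exact hsum.const_smul (√(n : ℝ))⁻¹

lemma inner_scoreSum {n : ℕ} (v t : Vec p) (d : Fin n → Vec p × ℝ) :
    ⟪t, M.scoreSum v d⟫
      = ∑ i, (√(n : ℝ))⁻¹ * (M.etaScore (eta0 v (d i).1) (d i).2 * eta0 t (d i).1) := by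
  rw [scoreSum, real_inner_smul_right, inner_sum, Finset.mul_sum]
  refine Finset.sum_congr rfl fun i _ => ?_
  rw [real_inner_smul_right]; rfl

lemma avgScore_eq {n : ℕ} (β₀ θ : Vec p) (d : Fin n → Vec p × ℝ) :
    √(n : ℝ) • M.avgScore β₀ θ d = M.scoreSum (θ + β₀) d := by
  rw [avgScore, scoreSum, smul_smul]
  congr 1
  · rcases Nat.eq_zero_or_pos n with rfl | hn
    · simp
    · have hn' : (0 : ℝ) < n := by exact_mod_cast hn
      have := Real.mul_self_sqrt hn'.le
      have h0 := Real.sqrt_pos.2 hn'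
      field_simp
      rw [pow_two]; exact this
  · simp_rw [score1_eq]

/-- The two score sums determine the score statistic up to a small error, by linearization. -/
lemma norm_sub_le_of_linearization {A₀ A₁ B : Vec p →ₗ[ℝ] Vec p} (hB : ∀ w, B (A₀ w) = w)
    {c e κ : ℝ} (hc : ∀ w, ‖B w‖ ≤ c * ‖w‖) (hc0 : 0 ≤ c) (he : ∀ w, ‖A₁ (B w)‖ ≤ e * ‖w‖)
    (he0 : 0 ≤ e) (hκ : 0 < κ) (hκc : κ * c ≤ 1 / 2) {U Z₀ Z₁ Δ δ : Vec p}
    (h₀ : ‖A₀ Δ - Z₀‖ ≤ κ * ‖Δ‖) (h₁ : ‖U - Z₁ + A₁ Δ‖ ≤ κ * (‖Δ‖ + ‖δ‖)) :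
    ‖U - (Z₁ - A₁ (B Z₀))‖ ≤ κ * (2 * c * (1 + e) * ‖Z₀‖ + ‖δ‖) := by
  -- As `κ * c ≤ 1 / 2`, the error `κ ‖Δ‖` is absorbed into the left side; this is where the `√n`
  -- rate of the estimator comes from.
  have hΔ : ‖Δ‖ ≤ 2 * c * ‖Z₀‖ := by
    have h1 : ‖A₀ Δ‖ ≤ ‖Z₀‖ + κ * ‖Δ‖ := by
      calc ‖A₀ Δ‖ = ‖Z₀ + (A₀ Δ - Z₀)‖ := by congr 1; abel
        _ ≤ _ := (norm_add_le _ _).trans (by gcongr)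
    have h2 : ‖Δ‖ ≤ c * (‖Z₀‖ + κ * ‖Δ‖) := by
      calc ‖Δ‖ = ‖B (A₀ Δ)‖ := by rw [hB]
        _ ≤ c * ‖A₀ Δ‖ := hc _
        _ ≤ _ := by gcongr
    have h3 : κ * c * ‖Δ‖ ≤ 1 / 2 * ‖Δ‖ := by gcongr
    nlinarith
  have heq : U - (Z₁ - A₁ (B Z₀)) = (U - Z₁ + A₁ Δ) - A₁ (B (A₀ Δ - Z₀)) := by
    rw [map_sub, hB, map_sub]; abel
  rw [heq]
  calc _ ≤ κ * (‖Δ‖ + ‖δ‖) + e * (κ * ‖Δ‖) := by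
        refine (norm_sub_le _ _).trans (add_le_add h₁ ((he _).trans ?_))
        gcongr
    _ = κ * ((1 + e) * ‖Δ‖ + ‖δ‖) := by ring
    _ ≤ κ * ((1 + e) * (2 * c * ‖Z₀‖) + ‖δ‖) := by gcongr
    _ = _ := by ring

section Rows

variable {Ω : ℕ → Type*} [∀ n, MeasurableSpace (Ω n)] {Pr : ∀ n, Measure (Ω n)}
  {D : ∀ n, Fin n → Ω n → Vec p × ℝ} {v : ℕ → Vec p}

/-- The central limit theorem for the scores, in terms of characteristic functions. -/
lemma RegularOn.tendsto_integral_cexp_pow [IsProbabilityMeasure P]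
    (hM : M.Nondegenerate) (h : M.RegularOn P v₀ ε F) (hv : Tendsto v atTop (𝓝 v₀)) (t : Vec p) :
    Tendsto (fun n : ℕ => (∫ z, Complex.exp (((√n)⁻¹ *
      (M.etaScore (eta0 (v n) z.1) z.2 * eta0 t z.1) : ℝ) * Complex.I)
        ∂(M.armLaw P (eta0 (v n)))) ^ n) atTop
      (𝓝 (Complex.exp (-(⟪t, Matrix.toEuclideanLin (M.info0 P v₀) t⟫ : ℝ) / 2))) := by
  have h1 := Complex.tendsto_one_add_pow_exp_of_tendsto (h.tendsto_integral_cexp_score hM hv t)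
  simpa only [add_sub_cancel] using h1

/-- Characteristic functions converging to a continuous limit give tightness, hence one bound `K`
for all `n`. -/
lemma RegularOn.exists_measure_norm_scoreSum_gt_le [∀ n, IsProbabilityMeasure (Pr n)]
    [IsProbabilityMeasure P] (hM : M.Nondegenerate) (h : M.RegularOn P v₀ ε F)
    (hv : Tendsto v atTop (𝓝 v₀))
    (hD : ∀ n i, Measurable (D n i)) (hind : ∀ᶠ n in atTop, iIndepFun (D n) (Pr n))
    (hlaw : ∀ᶠ n in atTop, ∀ i, HasLaw (D n i) (M.armLaw P (eta0 (v n))) (Pr n))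
    {e : ℝ≥0∞} (he : 0 < e) :
    ∃ K : ℝ, ∀ n, Pr n {ω | K < ‖M.scoreSum (v n) fun i => D n i ω‖} ≤ e := by
  have hm : ∀ n, Measurable fun ω => M.scoreSum (v n) fun i => D n i ω := fun n =>
    measurable_scoreSum hM (hD n) measurable_const
  have hprob : ∀ n, IsProbabilityMeasure ((Pr n).map fun ω => M.scoreSum (v n) fun i => D n i ω) :=
    fun n => Measure.isProbabilityMeasure_map (hm n).aemeasurable
  have ht : IsTightMeasureSet
      (Set.range fun n => (Pr n).map fun ω => M.scoreSum (v n) fun i => D n i ω) := by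
    refine isTightMeasureSet_of_tendsto_charFun
      (f := fun t => Complex.exp (-(⟪t, Matrix.toEuclideanLin (M.info0 P v₀) t⟫ : ℝ) / 2)) ?_
      fun t => ?_
    · have : Continuous fun t => Matrix.toEuclideanLin (M.info0 P v₀) t :=
        LinearMap.continuous_of_finiteDimensional _
      fun_prop
    · refine (h.tendsto_integral_cexp_pow hM hv t).congr' ?_
      filter_upwards [hind, hlaw] with n h1 h2
      rw [charFun_apply, integral_map (hm n).aemeasurable
        (Measurable.aestronglyMeasurable (by fun_prop))]
      have hs := measurable_etaScore_comp hM (v n)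
      have ht : Measurable fun z : Vec p × ℝ => eta0 t z.1 := (measurable_eta0 t).comp measurable_fst
      have := integral_cexp_sum h1 h2 (f := fun z => (√n)⁻¹ *
        (M.etaScore (eta0 (v n) z.1) z.2 * eta0 t z.1)) (by fun_prop)
      rw [← this]
      simp_rw [real_inner_comm t, inner_scoreSum]
  have h1 := ENNReal.tendsto_nhds_zero.1 (tendsto_measure_norm_gt_of_isTightMeasureSet ht) e he
  obtain ⟨K, hK⟩ := h1.exists
  refine ⟨K, fun n => ?_⟩
  have h2 := (iSup₂_le_iff.1 hK) _ ⟨n, rfl⟩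
  rwa [Measure.map_apply (hm n) (measurableSet_lt measurable_const measurable_norm)] at h2

end Rows

end GLM

/-! ### Asymptotic expansion and limit law of the score statistic. -/

namespace GLM

variable {M : GLM} {p : ℕ} {P₀ P₁ : Measure (Vec p)}
  {β₀ θ₀ δ : Vec p} {ε₀ ε₁ : ℝ} {F₀ F₁ : Vec p → ℝ}

/-- The second summand is a congruence of the positive semidefinite inverse. The characteristic
function of `multivariateGaussian` is available only for such matrices. -/
lemma posSemidef_asympVar (hM : M.Nondegenerate) (h₀ : M.RegularOn P₀ θ₀ ε₀ F₀)
    (h₁ : M.RegularOn P₁ (θ₀ + β₀) ε₁ F₁) : (M.asympVar P₀ P₁ β₀ θ₀).PosSemidef := by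
  rw [asympVar, info1_eq]
  refine (h₁.posSemidef_info0 hM).add ?_
  have h := (h₀.posSemidef_info0 hM).inv.mul_mul_conjTranspose_same (M.info0 P₁ (θ₀ + β₀))
  rwa [(isHermitian_info0 P₁ (θ₀ + β₀)).eq] at h

lemma scoreSum_sub {n : ℕ} (hn : 0 < n) (v w : Vec p) (d : Fin n → Vec p × ℝ) :
    √(n : ℝ) • (n : ℝ)⁻¹ • ∑ i, (M.etaScore (eta0 v (d i).1) (d i).2
      - M.etaScore (eta0 w (d i).1) (d i).2) • (d i).1 = M.scoreSum v d - M.scoreSum w d := by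
  have hn' : (0 : ℝ) < n := by exact_mod_cast hn
  have hs : √(n : ℝ) * (n : ℝ)⁻¹ = (√(n : ℝ))⁻¹ := by
    have h1 := Real.mul_self_sqrt hn'.le
    have h0 := Real.sqrt_pos.2 hn'
    field_simp
    rw [pow_two]; exact h1
  rw [scoreSum, scoreSum, smul_smul, hs, ← smul_sub, ← Finset.sum_sub_distrib]
  simp_rw [sub_smul]

/-- The score statistic at the maximum likelihood estimate, given linearizations of the scores of
the two samples. -/
lemma IsMLE.norm_score_sub_le (hM : M.Nondegenerate) {A₀ A₁ B : Vec p →ₗ[ℝ] Vec p}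
    (hB : ∀ w, B (A₀ w) = w) {c e κ : ℝ} (hc : ∀ w, ‖B w‖ ≤ c * ‖w‖) (hc0 : 0 ≤ c)
    (he : ∀ w, ‖A₁ (B w)‖ ≤ e * ‖w‖) (he0 : 0 ≤ e) (hκ : 0 < κ) (hκc : κ * c ≤ 1 / 2)
    {n : ℕ} (hn : 0 < n) {d₀ d₁ : Fin n → Vec p × ℝ} {θ b : Vec p} (hmle : M.IsMLE d₀ θ)
    (hb : √(n : ℝ) • (b - β₀) = δ)
    (g0 : ‖(n : ℝ)⁻¹ • ∑ i, (M.etaScore (eta0 θ (d₀ i).1) (d₀ i).2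
      - M.etaScore (eta0 θ₀ (d₀ i).1) (d₀ i).2) • (d₀ i).1 + A₀ (θ - θ₀)‖ ≤ κ * ‖θ - θ₀‖)
    (g1 : ‖(n : ℝ)⁻¹ • ∑ i, (M.etaScore (eta0 (θ + β₀) (d₁ i).1) (d₁ i).2
      - M.etaScore (eta0 (θ₀ + β₀) (d₁ i).1) (d₁ i).2) • (d₁ i).1
        + A₁ ((θ + β₀) - (θ₀ + β₀))‖ ≤ κ * ‖(θ + β₀) - (θ₀ + β₀)‖)
    (g2 : ‖(n : ℝ)⁻¹ • ∑ i, (M.etaScore (eta0 (θ₀ + b) (d₁ i).1) (d₁ i).2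
      - M.etaScore (eta0 (θ₀ + β₀) (d₁ i).1) (d₁ i).2) • (d₁ i).1
        + A₁ ((θ₀ + b) - (θ₀ + β₀))‖ ≤ κ * ‖(θ₀ + b) - (θ₀ + β₀)‖) :
    ‖√(n : ℝ) • (M.avgScore β₀ θ d₁ - A₁ (b - β₀))
        - (M.scoreSum (θ₀ + b) d₁ - A₁ (B (M.scoreSum θ₀ d₀)))‖
      ≤ κ * (2 * c * (1 + e) * ‖M.scoreSum θ₀ d₀‖ + ‖δ‖) := by
  have hscale : ∀ (x y : Vec p) (k : ℝ), ‖x‖ ≤ k * ‖y‖ →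
      ‖√(n : ℝ) • x‖ ≤ k * ‖√(n : ℝ) • y‖ := fun x y k hxy => by
    rw [norm_smul, norm_smul, Real.norm_of_nonneg (Real.sqrt_nonneg _), mul_left_comm]
    gcongr
  have hz : M.scoreSum θ d₀ = 0 := by
    rw [scoreSum, hmle.sum_score_eq_zero hM, smul_zero]
  have g0' := hscale _ _ _ g0
  have g1' := hscale _ _ _ g1
  have g2' := hscale _ _ _ g2
  rw [smul_add, scoreSum_sub hn _ _ d₀, hz, zero_sub, ← map_smul] at g0'
  rw [smul_add, scoreSum_sub hn _ _ d₁, ← map_smul, add_sub_add_right_eq_sub] at g1'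
  rw [smul_add, scoreSum_sub hn _ _ d₁, ← map_smul, add_sub_add_left_eq_sub, hb] at g2'
  have hU : √(n : ℝ) • (M.avgScore β₀ θ d₁ - A₁ (b - β₀)) = M.scoreSum (θ + β₀) d₁ - A₁ δ := by
    rw [smul_sub, avgScore_eq, ← map_smul, hb]
  rw [hU]
  refine norm_sub_le_of_linearization (δ := δ) hB hc hc0 he he0 hκ hκc
    (Δ := √(n : ℝ) • (θ - θ₀)) ?_ ?_
  · rwa [neg_add_eq_sub] at g0'
  -- The difference of the expansions at `θ + β₀` and at the true `θ₀ + b` cancels the score at `θ₀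
  -- + β₀` and accounts for the drift `A₁ δ`.
  · have h3 : M.scoreSum (θ + β₀) d₁ - A₁ δ - M.scoreSum (θ₀ + b) d₁ + A₁ (√(n : ℝ) • (θ - θ₀))
        = (M.scoreSum (θ + β₀) d₁ - M.scoreSum (θ₀ + β₀) d₁ + A₁ (√(n : ℝ) • (θ - θ₀)))
          - (M.scoreSum (θ₀ + b) d₁ - M.scoreSum (θ₀ + β₀) d₁ + A₁ δ) := by abel
    rw [h3, mul_add]
    exact (norm_sub_le _ _).trans (add_le_add g1' g2')

section Rows

variable {θhat : ∀ n : ℕ, (Fin n → Vec p × ℝ) → Vec p}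
  {Ω : ℕ → Type*} [∀ n, MeasurableSpace (Ω n)] {Pr : ∀ n, Measure (Ω n)}
  {D₀ D₁ : ∀ n, Fin n → Ω n → Vec p × ℝ} {β : ℕ → Vec p}

/-- The score statistic is asymptotically equivalent to a linear combination of the scores of the
two samples at the true coefficients. -/
lemma tendsto_measure_norm_sub_gt [∀ n, IsProbabilityMeasure (Pr n)]
    [IsProbabilityMeasure P₀] [IsProbabilityMeasure P₁] (hM : M.Nondegenerate)
    (h₀ : M.RegularOn P₀ θ₀ ε₀ F₀) (h₁ : M.RegularOn P₁ (θ₀ + β₀) ε₁ F₁)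
    (hI₀ : (M.info0 P₀ θ₀).det ≠ 0)
    (hθhat : ∀ (n : ℕ) (d : Fin n → Vec p × ℝ), (∃ θ, M.IsMLE d θ) → M.IsMLE d (θhat n d))
    (hD₀ : ∀ n i, Measurable (D₀ n i)) (hD₁ : ∀ n i, Measurable (D₁ n i))
    (hβ : ∀ n, β n = β₀ + (√(n : ℝ))⁻¹ • δ)
    (hs : ∀ᶠ n in atTop, M.IsSample P₀ P₁ (β n) θ₀ (Pr n) (D₀ n) (D₁ n)) {r : ℝ} (hr : 0 < r) :
    Tendsto (fun n => Pr n {ω | r < ‖√(n : ℝ) •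
        (M.avgScore β₀ (θhat n (fun i => D₀ n i ω)) (fun i => D₁ n i ω)
            - Matrix.toEuclideanLin (M.info1 P₁ β₀ θ₀) (β n - β₀))
        - (M.scoreSum (θ₀ + β n) (fun i => D₁ n i ω) - Matrix.toEuclideanLin (M.info0 P₁ (θ₀ + β₀))
          (Matrix.toEuclideanLin (M.info0 P₀ θ₀)⁻¹ (M.scoreSum θ₀ fun i => D₀ n i ω)))‖})
      atTop (𝓝 0) := by
  have hsqrt : Tendsto (fun n : ℕ => (√(n : ℝ))⁻¹) atTop (𝓝 0) :=
    tendsto_inv_atTop_zero.comp (Real.tendsto_sqrt_atTop.comp tendsto_natCast_atTop_atTop)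
  have hβlim : Tendsto (fun n => θ₀ + β n) atTop (𝓝 (θ₀ + β₀)) := by
    simp_rw [hβ]
    have := (hsqrt.smul_const δ).const_add β₀ |>.const_add θ₀
    simpa using this
  have hind₀ : ∀ᶠ n in atTop, iIndepFun (D₀ n) (Pr n) := hs.mono fun n h =>
    iIndepFun.precomp (g := (Sum.inl : Fin n → Fin n ⊕ Fin n)) Sum.inl_injective h.indep
  have hind₁ : ∀ᶠ n in atTop, iIndepFun (D₁ n) (Pr n) := hs.mono fun n h =>
    iIndepFun.precomp (g := (Sum.inr : Fin n → Fin n ⊕ Fin n)) Sum.inr_injective h.indep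
  have hlaw₀ : ∀ᶠ n in atTop, ∀ i, HasLaw (D₀ n i) (M.armLaw P₀ (eta0 θ₀)) (Pr n) :=
    hs.mono fun n h => h.law0
  have hlaw₁ : ∀ᶠ n in atTop, ∀ i, HasLaw (D₁ n i) (M.armLaw P₁ (eta0 (θ₀ + β n))) (Pr n) :=
    hs.mono fun n h i => by
      have h1 := h.law1 i
      have h2 : eta1 (β n) θ₀ = eta0 (θ₀ + β n) := funext fun x => eta1_eq _ _ x
      rwa [h2] at h1
  have hcons := fun (r : ℝ) (hr : 0 < r) =>
    M.tendsto_measure_not_isMLE_or_far hM h₀ hI₀ hθhat hD₀ hind₀ hlaw₀ hr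
  have hVfar : ∀ r > 0, Tendsto (fun n => Pr n {ω | ¬ ‖(θhat n fun i => D₀ n i ω) - θ₀‖ < r})
      atTop (𝓝 0) := fun r hr =>
    tendsto_of_tendsto_of_tendsto_of_le_of_le tendsto_const_nhds (hcons r hr) (fun _ => zero_le)
      fun n => measure_mono fun ω h1 h2 => h1 h2.2
  have hV1 : ∀ r > 0, Tendsto (fun n => Pr n {ω | ¬ ‖((θhat n fun i => D₀ n i ω) + β₀)
      - (θ₀ + β₀)‖ < r}) atTop (𝓝 0) := fun r hr => by
    simpa only [add_sub_add_right_eq_sub] using hVfar r hr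
  -- The true treatment coefficient plays the part of a deterministic consistent estimator, so the
  -- same linearization applies to it.
  have hV2 : ∀ r > 0, Tendsto (fun n => Pr n {_ω | ¬ ‖(θ₀ + β n) - (θ₀ + β₀)‖ < r})
      atTop (𝓝 0) := fun r hr => by
    refine tendsto_const_nhds.congr' ?_
    filter_upwards [hβlim.eventually (Metric.ball_mem_nhds _ hr)] with n hn
    have hn' : ‖(θ₀ + β n) - (θ₀ + β₀)‖ < r := by rwa [← dist_eq_norm]
    simp only [hn', not_true_eq_false]
    simp
  set A₀ := Matrix.toEuclideanLin (M.info0 P₀ θ₀) with hA₀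
  set A₁ := Matrix.toEuclideanLin (M.info0 P₁ (θ₀ + β₀)) with hA₁
  set B := Matrix.toEuclideanLin (M.info0 P₀ θ₀)⁻¹ with hBdef
  have hB : ∀ w, B (A₀ w) = w := fun w => by
    rw [hBdef, hA₀, ← toEuclideanLin_mul_apply, Matrix.nonsing_inv_mul _ (isUnit_iff_ne_zero.2 hI₀)]
    simp
  obtain ⟨c, hc0, hc⟩ := exists_linearMap_bound B
  obtain ⟨a, ha0, ha⟩ := exists_linearMap_bound (A₁.comp B)
  rw [ENNReal.tendsto_nhds_zero]
  intro e he
  have he2 : 0 < e / 2 := ENNReal.div_pos he.ne' (by norm_num)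
  obtain ⟨K, hK⟩ := h₀.exists_measure_norm_scoreSum_gt_le hM (v := fun _ => θ₀) tendsto_const_nhds
    hD₀ hind₀ hlaw₀ he2
  -- The first bound permits absorption; the second makes the total error at most `r` when the
  -- control score sum is at most `K`.
  obtain ⟨κ, hκ, hκc, hκr⟩ : ∃ κ : ℝ, 0 < κ ∧ κ * c ≤ 1 / 2 ∧
      κ * (2 * c * (1 + a) * |K| + ‖δ‖) ≤ r := by
    set s := 2 * c * (1 + a) * |K| + ‖δ‖ with hsdef
    have hs0 : 0 ≤ s := by positivity
    refine ⟨min (1 / (2 * (c + 1))) (r / (s + 1)), by positivity, ?_, ?_⟩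
    · calc _ ≤ 1 / (2 * (c + 1)) * c := by gcongr; exact min_le_left _ _
        _ ≤ 1 / 2 := by
          rw [div_mul_eq_mul_div, div_le_div_iff₀ (by positivity) (by positivity)]; linarith
    · calc _ ≤ r / (s + 1) * s := by gcongr; exact min_le_right _ _
        _ ≤ r := by rw [div_mul_eq_mul_div, div_le_iff₀ (by positivity)]; nlinarith
  have L0 := h₀.tendsto_measure_linearization hM (v := fun _ => θ₀) tendsto_const_nhds hD₀ hind₀
    hlaw₀ hVfar hκ
  have L1 := h₁.tendsto_measure_linearization hM hβlim hD₁ hind₁ hlaw₁ hV1 hκ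
  have L2 := h₁.tendsto_measure_linearization hM hβlim hD₁ hind₁ hlaw₁ hV2 hκ
  have hsum := (((hcons 1 one_pos).add L0).add L1).add L2
  simp only [add_zero] at hsum
  filter_upwards [ENNReal.tendsto_nhds_zero.1 hsum _ he2, eventually_gt_atTop 0] with n hn hn0
  have hn' : (0 : ℝ) < n := by exact_mod_cast hn0
  have hsp : 0 < √(n : ℝ) := Real.sqrt_pos.2 hn'
  -- Union bound over five exceptional events: no estimate near `θ₀`, three failed linearizations,
  -- and a large control score sum.
  refine le_trans ?_ ((add_le_add hn (hK n)).trans (ENNReal.add_halves e).le)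
  refine le_trans ?_ (add_le_add (add_le_add (add_le_add (measure_union_le _ _) le_rfl) le_rfl) le_rfl)
  refine le_trans ?_ (add_le_add (add_le_add (measure_union_le _ _) le_rfl) le_rfl)
  refine le_trans ?_ (add_le_add (measure_union_le _ _) le_rfl)
  refine le_trans ?_ (measure_union_le _ _)
  refine measure_mono fun ω hω => ?_
  by_contra hcon
  obtain ⟨hcon, gK⟩ := not_or.1 hcon
  obtain ⟨hcon, g2⟩ := not_or.1 hcon
  obtain ⟨hcon, g1⟩ := not_or.1 hcon
  obtain ⟨hmle, g0⟩ := not_or.1 hcon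
  replace hmle := (not_not.1 hmle).1
  replace g0 := not_not.1 g0
  replace g1 := not_not.1 g1
  replace g2 := not_not.1 g2
  have gK' : ‖M.scoreSum θ₀ fun i => D₀ n i ω‖ ≤ K := not_lt.1 fun h => gK h
  refine absurd (show r < _ from hω) (not_lt.2 ?_)
  have hδ : √(n : ℝ) • (β n - β₀) = δ := by
    rw [hβ, add_sub_cancel_left, smul_smul, mul_inv_cancel₀ hsp.ne', one_smul]
  rw [info1_eq]
  have key := IsMLE.norm_score_sub_le (θ₀ := θ₀) (β₀ := β₀) (δ := δ) hM (A₀ := A₀) (A₁ := A₁)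
    (B := B) hB hc hc0 ha ha0 hκ hκc (n := n) hn0 (d₀ := fun i => D₀ n i ω)
    (d₁ := fun i => D₁ n i ω) (θ := θhat n fun i => D₀ n i ω) (b := β n) hmle hδ g0 g1 g2
  refine key.trans (le_trans ?_ hκr)
  gcongr
  exact gK'.trans (le_abs_self K)

/-- By independence the characteristic function factors into the control part at `s = -A₀⁻¹ A₁ t`
and the treatment part at `t`; symmetry of `A₀` and `A₁` turns the sum of the two quadratic forms
into that of `asympVar`. -/
lemma tendsto_integral_cexp_inner_linear [IsProbabilityMeasure P₀] [IsProbabilityMeasure P₁]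
    (hM : M.Nondegenerate)
    (h₀ : M.RegularOn P₀ θ₀ ε₀ F₀) (h₁ : M.RegularOn P₁ (θ₀ + β₀) ε₁ F₁)
    (hI₀ : (M.info0 P₀ θ₀).det ≠ 0) (hβ : Tendsto β atTop (𝓝 β₀))
    (hs : ∀ᶠ n in atTop, M.IsSample P₀ P₁ (β n) θ₀ (Pr n) (D₀ n) (D₁ n)) (t : Vec p) :
    Tendsto (fun n => ∫ ω, Complex.exp (⟪t, M.scoreSum (θ₀ + β n) (fun i => D₁ n i ω)
        - Matrix.toEuclideanLin (M.info0 P₁ (θ₀ + β₀))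
          (Matrix.toEuclideanLin (M.info0 P₀ θ₀)⁻¹ (M.scoreSum θ₀ fun i => D₀ n i ω))⟫
        * Complex.I) ∂(Pr n)) atTop
      (𝓝 (Complex.exp (-(⟪t, Matrix.toEuclideanLin (M.asympVar P₀ P₁ β₀ θ₀) t⟫ : ℝ) / 2))) := by
  set s : Vec p := -Matrix.toEuclideanLin (M.info0 P₀ θ₀)⁻¹
    (Matrix.toEuclideanLin (M.info0 P₁ (θ₀ + β₀)) t) with hsdef
  have hsz : ∀ z, -⟪t, Matrix.toEuclideanLin (M.info0 P₁ (θ₀ + β₀))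
      (Matrix.toEuclideanLin (M.info0 P₀ θ₀)⁻¹ z)⟫ = ⟪s, z⟫ := fun z => by
    rw [inner_toEuclideanLin_comm, inner_toEuclideanLin_comm, transpose_info0,
      Matrix.transpose_nonsing_inv, transpose_info0, hsdef, inner_neg_left]
  have hβ' : Tendsto (fun n => θ₀ + β n) atTop (𝓝 (θ₀ + β₀)) := hβ.const_add θ₀
  have hlim := (h₀.tendsto_integral_cexp_pow hM (v := fun _ => θ₀) tendsto_const_nhds s).mul
    (h₁.tendsto_integral_cexp_pow hM hβ' t)
  rw [← Complex.exp_add] at hlim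
  have hval : -(⟪t, Matrix.toEuclideanLin (M.asympVar P₀ P₁ β₀ θ₀) t⟫ : ℝ) / 2
      = (-(⟪s, Matrix.toEuclideanLin (M.info0 P₀ θ₀) s⟫ : ℝ) / 2
        + -(⟪t, Matrix.toEuclideanLin (M.info0 P₁ (θ₀ + β₀)) t⟫ : ℝ) / 2 : ℂ) := by
    have h1 : Matrix.toEuclideanLin (M.info0 P₀ θ₀) s
        = -Matrix.toEuclideanLin (M.info0 P₁ (θ₀ + β₀)) t := by
      rw [hsdef, map_neg, ← toEuclideanLin_mul_apply,
        Matrix.mul_nonsing_inv _ (isUnit_iff_ne_zero.2 hI₀)]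
      simp
    rw [h1, ← hsz, asympVar, info1_eq, map_add, LinearMap.add_apply, inner_add_right,
      toEuclideanLin_mul_apply, toEuclideanLin_mul_apply]
    simp only [map_neg, inner_neg_right, neg_neg]
    push_cast; ring
  rw [hval]
  refine hlim.congr' ?_
  filter_upwards [hs] with n hn
  have hl : ∀ i, HasLaw (D₁ n i) (M.armLaw P₁ (eta0 (θ₀ + β n))) (Pr n) := fun i => by
    have h1 := hn.law1 i
    have h2 : eta1 (β n) θ₀ = eta0 (θ₀ + β n) := funext fun x => eta1_eq _ _ x
    rwa [h2] at h1
  have hm₀ := measurable_etaScore_comp hM θ₀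
  have hm₁ := measurable_etaScore_comp hM (θ₀ + β n)
  have hms : Measurable fun z : Vec p × ℝ => eta0 s z.1 := (measurable_eta0 s).comp measurable_fst
  have hmt : Measurable fun z : Vec p × ℝ => eta0 t z.1 := (measurable_eta0 t).comp measurable_fst
  have := integral_cexp_sum_add_sum hn.indep hn.law0 hl
    (f₀ := fun z => (√n)⁻¹ * (M.etaScore (eta0 θ₀ z.1) z.2 * eta0 s z.1))
    (f₁ := fun z => (√n)⁻¹ * (M.etaScore (eta0 (θ₀ + β n) z.1) z.2 * eta0 t z.1))
    (by fun_prop) (by fun_prop)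
  rw [← this]
  refine integral_congr_ae (ae_of_all _ fun ω => ?_)
  simp only
  rw [inner_sub_right, sub_eq_add_neg, hsz, inner_scoreSum, inner_scoreSum, add_comm]

/-- The asymptotic normality of the score statistic under local alternatives. -/
theorem tendstoInDistribution_score [∀ n, IsProbabilityMeasure (Pr n)]
    [IsProbabilityMeasure P₀] [IsProbabilityMeasure P₁]
    (hreg₀ : M.LocallyRegular P₀ θ₀) (hreg₁ : M.LocallyRegular P₁ (θ₀ + β₀))
    (hI₀ : (M.info0 P₀ θ₀).det ≠ 0) (hθhat_meas : ∀ n, Measurable (θhat n))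
    (hθhat : ∀ (n : ℕ) (d : Fin n → Vec p × ℝ), (∃ θ, M.IsMLE d θ) → M.IsMLE d (θhat n d))
    (hD₀ : ∀ n i, Measurable (D₀ n i)) (hD₁ : ∀ n i, Measurable (D₁ n i))
    (hβ : ∀ n, β n = β₀ + (√(n : ℝ))⁻¹ • δ)
    (hs : ∀ᶠ n in atTop, M.IsSample P₀ P₁ (β n) θ₀ (Pr n) (D₀ n) (D₁ n)) :
    TendstoInDistribution
        (fun (n : ℕ) ω => √(n : ℝ) •
          (M.avgScore β₀ (θhat n (fun i => D₀ n i ω)) (fun i => D₁ n i ω)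
            - Matrix.toEuclideanLin (M.info1 P₁ β₀ θ₀) (β n - β₀)))
        atTop id Pr (multivariateGaussian 0 (M.asympVar P₀ P₁ β₀ θ₀)) := by
  have hM : M.Nondegenerate := by
    obtain ⟨ε, hε, F, -, hae⟩ := hreg₀
    exact M.nondegenerate_of_info0 (hae.mono fun x hx => (hx θ₀ (Metric.mem_ball_self hε)).1) hI₀
  obtain ⟨ε₀, F₀, h₀⟩ := hreg₀.exists_regularOn hM
  obtain ⟨ε₁, F₁, h₁⟩ := hreg₁.exists_regularOn hM
  have hθm : ∀ n, Measurable fun ω => θhat n fun i => D₀ n i ω := fun n =>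
    (hθhat_meas n).comp (measurable_pi_lambda _ (hD₀ n))
  have hU : ∀ n : ℕ, Measurable fun ω => √(n : ℝ) •
          (M.avgScore β₀ (θhat n (fun i => D₀ n i ω)) (fun i => D₁ n i ω)
            - Matrix.toEuclideanLin (M.info1 P₁ β₀ θ₀) (β n - β₀)) := fun n => by
    simp_rw [smul_sub, avgScore_eq]
    exact (measurable_scoreSum hM (hD₁ n) ((hθm n).add_const β₀)).sub_const _
  have hW : ∀ n, Measurable fun ω => M.scoreSum (θ₀ + β n) (fun i => D₁ n i ω)
        - Matrix.toEuclideanLin (M.info0 P₁ (θ₀ + β₀))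
          (Matrix.toEuclideanLin (M.info0 P₀ θ₀)⁻¹ (M.scoreSum θ₀ fun i => D₀ n i ω)) := fun n => by
    have hL : ∀ Q : Vec p →ₗ[ℝ] Vec p, Measurable Q := fun Q =>
      (LinearMap.continuous_of_finiteDimensional Q).measurable
    exact (measurable_scoreSum hM (hD₁ n) measurable_const).sub
      ((hL _).comp ((hL _).comp (measurable_scoreSum hM (hD₀ n) measurable_const)))
  have hβlim : Tendsto β atTop (𝓝 β₀) := by
    have hsqrt : Tendsto (fun n : ℕ => (√(n : ℝ))⁻¹) atTop (𝓝 0) :=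
      tendsto_inv_atTop_zero.comp (Real.tendsto_sqrt_atTop.comp tendsto_natCast_atTop_atTop)
    have h2 := (hsqrt.smul_const δ).const_add β₀
    rw [zero_smul, add_zero] at h2
    exact h2.congr fun n => (hβ n).symm
  refine ⟨fun n => (hU n).aemeasurable, aemeasurable_id, ?_⟩
  refine ProbabilityMeasure.tendsto_iff_tendsto_charFun.2 fun t => ?_
  simp only [ProbabilityMeasure.coe_mk, Measure.map_id]
  rw [charFun_multivariateGaussian (posSemidef_asympVar hM h₀ h₁)]
  have hval : Complex.exp ((⟪t, (0 : Vec p)⟫ : ℝ) * Complex.I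
      - (t.ofLp ⬝ᵥ (M.asympVar P₀ P₁ β₀ θ₀).mulVec t.ofLp : ℝ) / 2)
      = Complex.exp (-(⟪t, Matrix.toEuclideanLin (M.asympVar P₀ P₁ β₀ θ₀) t⟫ : ℝ) / 2) := by
    have : ⟪t, Matrix.toEuclideanLin (M.asympVar P₀ P₁ β₀ θ₀) t⟫
        = t.ofLp ⬝ᵥ (M.asympVar P₀ P₁ β₀ θ₀).mulVec t.ofLp := by
      simp only [EuclideanSpace.inner_eq_star_dotProduct, Matrix.toLpLin_apply, star_trivial]
      rw [dotProduct_comm]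
    rw [this, inner_zero_right]
    congr 1
    push_cast; ring
  rw [hval]
  have hlim := tendsto_integral_cexp_of_sub (Pr := Pr)
    (fun n => (hU n).const_inner (c := t)) (fun n => (hW n).const_inner (c := t)) ?_
    (tendsto_integral_cexp_inner_linear hM h₀ h₁ hI₀ hβlim hs t)
  · refine hlim.congr fun n => ?_
    rw [charFun_apply, integral_map (hU n).aemeasurable
      (Measurable.aestronglyMeasurable (by fun_prop))]
    simp_rw [real_inner_comm t]
  · intro r hr
    -- The added one covers `t = 0`.
    have hr' : 0 < r / (‖t‖ + 1) := by positivity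
    refine tendsto_of_tendsto_of_tendsto_of_le_of_le tendsto_const_nhds
      (tendsto_measure_norm_sub_gt hM h₀ h₁ hI₀ hθhat hD₀ hD₁ hβ hs hr') (fun _ => zero_le)
      fun n => measure_mono fun ω hω => ?_
    simp only [Set.mem_ofPred_eq] at hω ⊢
    rw [← inner_sub_right] at hω
    have h1 := hω.trans_le (abs_real_inner_le_norm _ _)
    rw [div_lt_iff₀ (by positivity)]
    refine h1.trans_le ?_
    rw [mul_comm]
    gcongr
    linarith

end Rows

end GLM

end SeqScore

end

theorem lemma1 {p : ℕ} (M : SeqScore.GLM)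
    (P₀ P₁ : Measure (SeqScore.Vec p)) [IsProbabilityMeasure P₀] [IsProbabilityMeasure P₁]
    (β₀ θ₀ : SeqScore.Vec p)
    (hreg₀ : M.LocallyRegular P₀ θ₀) (hreg₁ : M.LocallyRegular P₁ (θ₀ + β₀))
    (hI₀ : (M.info0 P₀ θ₀).det ≠ 0)
    (θhat : ∀ n : ℕ, (Fin n → SeqScore.Vec p × ℝ) → SeqScore.Vec p)
    (hθhat_meas : ∀ n, Measurable (θhat n))
    (hθhat : ∀ (n : ℕ) (d : Fin n → SeqScore.Vec p × ℝ),
      (∃ θ, M.IsMLE d θ) → M.IsMLE d (θhat n d))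
    {Ω : ℕ → Type*} [∀ n, MeasurableSpace (Ω n)]
    (Pr : ∀ n, Measure (Ω n)) [∀ n, IsProbabilityMeasure (Pr n)]
    (D₀ D₁ : ∀ n, Fin n → Ω n → SeqScore.Vec p × ℝ)
    (hD₀ : ∀ n i, Measurable (D₀ n i)) (hD₁ : ∀ n i, Measurable (D₁ n i)) :
    -- the null hypothesis
    ((∀ n, M.IsSample P₀ P₁ β₀ θ₀ (Pr n) (D₀ n) (D₁ n)) →
      TendstoInDistribution
        (fun (n : ℕ) ω => √(n : ℝ) •
          M.avgScore β₀ (θhat n (fun i => D₀ n i ω)) (fun i => D₁ n i ω))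
        atTop id Pr (multivariateGaussian 0 (M.asympVar P₀ P₁ β₀ θ₀))) ∧
    -- the local alternatives
    (∀ (δ : SeqScore.Vec p) (β : ℕ → SeqScore.Vec p),
      (∀ n, β n = β₀ + (√(n : ℝ))⁻¹ • δ) →
      (∀ᶠ n in atTop, M.IsSample P₀ P₁ (β n) θ₀ (Pr n) (D₀ n) (D₁ n)) →
      TendstoInDistribution
        (fun (n : ℕ) ω => √(n : ℝ) •
          (M.avgScore β₀ (θhat n (fun i => D₀ n i ω)) (fun i => D₁ n i ω)
            - Matrix.toEuclideanLin (M.info1 P₁ β₀ θ₀) (β n - β₀)))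
        atTop id Pr (multivariateGaussian 0 (M.asympVar P₀ P₁ β₀ θ₀))) := by
  refine ⟨fun hs => ?_, fun δ β hβ hs => SeqScore.GLM.tendstoInDistribution_score hreg₀ hreg₁ hI₀
    hθhat_meas hθhat hD₀ hD₁ hβ hs⟩
  -- The null hypothesis is the local alternative without drift.
  have h := SeqScore.GLM.tendstoInDistribution_score (δ := 0) (β := fun _ => β₀) hreg₀ hreg₁ hI₀
    hθhat_meas hθhat hD₀ hD₁ (fun n => by rw [smul_zero, add_zero]) (Eventually.of_forall hs)
  simpa only [sub_self, map_zero, sub_zero] using h
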